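/- Let $D\subset\mathbb R^2$ be a bounded domain and let $\gamma_0$ be a smooth closed curve with positive curvature which, together with its interior, lies in $D$. Put $n(\theta)=(\cos\theta,\sin\theta)$ and parametrize strictly convex closed curves by $\theta\in S=[0,2\pi)$ (periodically) so that $n(\theta)$ is the outward unit normal at the point with parameter $\theta$. Let $\alpha>0$. On a filtered probability space $(\Omega,\mathcal F,(\mathcal F_t)_{t\ge0},P)$ let $w^\varepsilon$, $0<\varepsilon\le1$, be adapted processes with $w^\varepsilon(0)=0$ and, a.s., $w^\varepsilon\in C^\infty([0,\infty))$ for all $\varepsilon$; put $v^\varepsilon=\alpha\dot w^\varepsilon$. Suppose that there are stopping times $\sigma^\varepsilon$ with values in $[0,\infty)$ such that a.s., for all $0<\varepsilon\le1$, $\sigma^\varepsilon>0$ and there is a smooth family of smooth strictly convex closed curves $\gamma^\varepsilon_t=\{X_0^\varepsilon(t,\theta):\theta\in S\}\subset D$, $0\le t\le\sigma^\varepsilon$, with positive curvature, parametrized as above, starting from $\gamma_0$ and moving with inward normal velocity $$V=\kappa-\frac1{|\gamma_t^\varepsilon|}\int_{\gamma^\varepsilon_t}\kappa+\frac{|D|}{2|\gamma_t^\varepsilon|}\,v^\varepsilon(t).$$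 Let $d^\varepsilon(t,\cdot)$ be the signed distance from $\gamma^\varepsilon_t$ (negative inside), and suppose that for some open neighbourhood $O$ of $\gamma_0$ and all $T>0$, $m\in\mathbb N$, a.s., $(\sigma^\varepsilon,d^\varepsilon(\cdot\wedge\sigma^\varepsilon))$ converges in $\mathbb R_+\times C([0,T],C^m(O))$, as $\varepsilon\downarrow0$, to $(\sigma,d(\cdot\wedge\sigma))$, where $\sigma>0$ a.s. is a stopping time and $d(\cdot\wedge\sigma)$ is a continuous adapted process with values in $C^m(O)$ for all $m$. For $\delta>0$ let $V^t_{3\delta}=\{x\in D:|d^\varepsilon(t,x)|<3\delta\}$, and for $x\in V^t_{3\delta}$ let $\theta^\varepsilon(t,x)\in S$ be the parameter $\theta$ in $x=X_0^\varepsilon(t,\theta)+r\,n(\theta)$, $|r|<3\delta$ (derivatives of $\theta^\varepsilon$ are those of real-valued local branches). Suppose that $\delta$ is small enough that the smallest eigenvalue of $I_2+d\nabla^2d$ is bounded below by a positive constant on $V^0_{3\delta}$. For $L\in\mathbb N$ let $\tau_L^\varepsilon$ be the infimum of the times $t\in(0,\sigma^\varepsilon]$ at which $$\max_{\theta}\{\kappa,\kappa^{-1},|\partial_\theta\kappa|\}>L,\quad\text{or}\quad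 \mathrm{dist}(\gamma^\varepsilon_t,\partial D)<\tfrac1L,\quad\text{or}\quad \inf_{V^t_{3\delta}}(I_2+d^\varepsilon\nabla^2d^\varepsilon)<\tfrac1L$$ (the last infimum is that of the smallest eigenvalue; $\inf\emptyset=\infty$). Write $|v|_{N,T}=\sum_{i=0}^N\sup_{[0,T]}|v^{(i)}|$. Then for all $K,M\in\mathbb N$ there is $N=N(K,M)\in\mathbb N$ such that for every $L\in\mathbb N$ there are a constant $C>0$, which depends only on $K,M,L,D,\gamma_0,\delta,\alpha$, and a stopping time $\tau$ with $\tau>0$ a.s. for which the following holds for a.e. $\omega$: there is $\varepsilon_0^*=\varepsilon_0^*(\omega)\in(0,1]$ such that $\min(\tau,\inf_{0<\varepsilon\le\varepsilon_0^*}\sigma^\varepsilon)>0$, and for every $0<\varepsilon\le\varepsilon_0^*$: (i) if $\gamma_0$ satisfies the constraints of level $L$ strictly, that is, if $\max_\theta\{\kappa,\kappa^{-1},|\partial_\theta\kappa|\}<L$, $\mathrm{dist}(\gamma_0,\partial D)>1/L$ and $\inf_{V^0_{3\delta}}(I_2+d\nabla^2d)>1/L$ at time $0$, then $\tau\le\tau_L^\varepsilon$;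 (ii) for every finite $T$ with $0<T\le\min(\tau,\sigma^\varepsilon)$, the coordinate $\theta^\varepsilon(t,x)$ is well defined and smooth on $\{(t,x):t\in[0,T],x\in V^t_{3\delta}\}$, and for all $0\le k\le K$ and $m,|\mathbf m|\le M$, $$\sup_{i=1,2}\ \sup_{\theta\in S}\ \sup_{t\in[0,T]}|\partial_t^k\partial_\theta^mX_0^{\varepsilon,i}(t,\theta)|\le C(1+|v^\varepsilon|_{N,T})^N,$$ $$\sup_{t\in[0,T]}\ \sup_{x\in V^t_{3\delta}}|\partial_t^k\partial_x^{\mathbf m}\theta^\varepsilon(t,x)|\le C(1+|v^\varepsilon|_{N,T})^N.$$ -/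

import Mathlib

open Set Filter Topology MeasureTheory ProbabilityTheory
open scoped NNReal ContDiff

universe u

noncomputable section

/-- The Euclidean plane. -/
abbrev Plane : Type := EuclideanSpace ℝ (Fin 2)

/-- The unit vector with angle `θ` to the direction `(1, 0)`. -/
def unitNormal (θ : ℝ) : Plane := !₂[Real.cos θ, Real.sin θ]

/-- `unitNormal θ` turned by a right angle counterclockwise. -/
def unitTangent (θ : ℝ) : Plane := !₂[-Real.sin θ, Real.cos θ]

/-! ### Strictly convex closed curves -/

/-- `Γ` is the parametrization of a smooth strictly convex closed plane curve by its Gauss map: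
the outward unit normal at `Γ θ` is `unitNormal θ`, and the curvature is positive and finite. -/
structure IsGaussCurve (Γ : ℝ → Plane) : Prop where
  smooth : ContDiff ℝ ∞ Γ
  periodic : Function.Periodic Γ (2 * Real.pi)
  tangent : ∀ θ : ℝ, ∃ ρ : ℝ, 0 < ρ ∧ deriv Γ θ = ρ • unitTangent θ

/-- The curvature `κ(θ)`, given by `|∂_θ Γ| = 1 / κ` in the Gauss parametrization. -/
def curvature (Γ : ℝ → Plane) (θ : ℝ) : ℝ := ‖deriv Γ θ‖⁻¹

/-- The length `|γ|`. -/
def curveLength (Γ : ℝ → Plane) : ℝ := ∫ θ in (0 : ℝ)..(2 * Real.pi), ‖deriv Γ θ‖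

/-- The average of the curvature over the curve with respect to arc length. -/
def averageCurvature (Γ : ℝ → Plane) : ℝ :=
  (curveLength Γ)⁻¹ * ∫ θ in (0 : ℝ)..(2 * Real.pi), curvature Γ θ * ‖deriv Γ θ‖

open scoped Classical in
/-- The signed distance to the convex curve `Γ`, negative inside the curve. -/
def curveSignedDist (Γ : ℝ → Plane) (x : Plane) : ℝ :=
  if x ∈ convexHull ℝ (range Γ) then -Metric.infDist x (range Γ) else Metric.infDist x (range Γ)

/-- The tubular neighbourhood `V_{3δ} = {x ∈ D : |d(x)| < 3δ}` of the curve `Γ`. -/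
def tube (D : Set Plane) (δ : ℝ) (Γ : ℝ → Plane) : Set Plane :=
  {x | x ∈ D ∧ |curveSignedDist Γ x| < 3 * δ}

/-- The quadratic form of the matrix `I₂ + d(x) ∇²d(x)` at the vector `ξ`. -/
def jacobianForm (Γ : ℝ → Plane) (x ξ : Plane) : ℝ :=
  ‖ξ‖ ^ 2 + curveSignedDist Γ x * iteratedFDeriv ℝ 2 (curveSignedDist Γ) x ![ξ, ξ]

/-- The condition `max_θ {κ, 1/κ, |κ'|} > L`, or `dist(γ, ∂D) < 1/L`, or the infimum over `V_{3δ}`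
of (the smallest eigenvalue of) `I₂ + d ∇²d` is `< 1/L`. -/
def exitCondition (D : Set Plane) (δ L : ℝ) (Γ : ℝ → Plane) : Prop :=
  (∃ θ : ℝ, L < curvature Γ θ ∨ L < (curvature Γ θ)⁻¹ ∨ L < |deriv (curvature Γ) θ|) ∨
  (∃ θ : ℝ, ∃ y ∈ frontier D, dist (Γ θ) y < 1 / L) ∨
  (∃ x ∈ tube D δ Γ, ∃ ξ : Plane, ‖ξ‖ = 1 ∧ jacobianForm Γ x ξ < 1 / L)

/-! ### The forced volume preserving curvature flow -/

/-- The curves `X t`, `t ∈ [0, σ]`, are strictly convex closed curves in `D`, parametrized by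
the Gauss map, that start from `Γ₀` and evolve with the inward normal velocity
`V = κ - (average of κ) + |D| / (2 |γ_t|) * v(t)`. -/
structure IsConvexFlow (D : Set Plane) (Γ₀ : ℝ → Plane) (v : ℝ → ℝ) (σ : ℝ)
    (X : ℝ → ℝ → Plane) : Prop where
  smooth : ContDiffOn ℝ ∞ (fun p : ℝ × ℝ => X p.1 p.2) (Icc 0 σ ×ˢ univ)
  gauss : ∀ t ∈ Icc 0 σ, IsGaussCurve (X t)
  inside : ∀ t ∈ Icc 0 σ, ∀ θ : ℝ, X t θ ∈ D
  initial : X 0 = Γ₀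
  velocity : ∀ t ∈ Icc 0 σ, ∀ θ : ℝ,
    -inner ℝ (derivWithin (fun s => X s θ) (Icc 0 σ) t) (unitNormal θ) =
      curvature (X t) θ - averageCurvature (X t)
        + (volume D).toReal / (2 * curveLength (X t)) * v t

/-- The time `τ_L = inf {t > 0 : exit condition at time t}` of a flow given on `[0, σ]`;
it is `⊤` if the exit condition is not met up to `σ`. -/
def exitTime (D : Set Plane) (δ L : ℝ) (σ : ℝ≥0) (X : ℝ → ℝ → Plane) : WithTop ℝ≥0 :=
  sInf {a : WithTop ℝ≥0 |
    ∃ t : ℝ≥0, 0 < t ∧ t ≤ σ ∧ exitCondition D δ L (X t) ∧ a = (t : WithTop ℝ≥0)}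

/-! ### The inverse coordinate `θ(t, x)` -/

open scoped Classical in
/-- `θ(t, x) ∈ S = [0, 2π)`, the angular coordinate of `x` near `γ_t`: the solution of
`x = X(t, θ) + r n(θ)` with `r = d(t, x)`. -/
def gaussAngle (X : ℝ → ℝ → Plane) (t : ℝ) (x : Plane) : ℝ :=
  if h : ∃ φ ∈ Ico (0 : ℝ) (2 * Real.pi), X t φ + curveSignedDist (X t) x • unitNormal φ = x
  then h.choose else 0

/-- The representative of `θ(s, y)` modulo `2π` in `[θ(t, x) - π, θ(t, x) + π)`. As `θ` takes
values in the circle `S`, its derivatives at `(t, x)` are those of this real-valued branch, which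
equals `θ(t, x)` at `(t, x)` itself. -/
def angleBranch (X : ℝ → ℝ → Plane) (t : ℝ) (x : Plane) (s : ℝ) (y : Plane) : ℝ :=
  toIcoMod Real.two_pi_pos (gaussAngle X t x - Real.pi) (gaussAngle X s y)

/-! ### Norms and derivatives -/

/-- `|v|_{N,T} = ∑_{i ≤ N} sup_{t ∈ [0,T]} |v^{(i)}(t)|` for `v ∈ C^∞([0, ∞))`. -/
def timeNorm (N : ℕ) (T : ℝ) (v : ℝ → ℝ) : ℝ :=
  ∑ i ∈ Finset.range (N + 1), ⨆ t : Icc (0 : ℝ) T, |iteratedDerivWithin i v (Ici 0) t|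

/-- `∂_t^k ∂_θ^m X^i (t, θ)`, with time derivatives in `[0, T]`. -/
def derivX (X : ℝ → ℝ → Plane) (T : ℝ) (k m : ℕ) (i : Fin 2) (t θ : ℝ) : ℝ :=
  iteratedDerivWithin k (fun s => iteratedDeriv m (fun φ => X s φ i) θ) (Icc 0 T) t

/-- `∂_t^k ∂_{x_{j 0}} ⋯ ∂_{x_{j (m-1)}} θ (t, x)`, with time derivatives in `[0, T]`. -/
def derivAngle (X : ℝ → ℝ → Plane) (T : ℝ) (k : ℕ) {m : ℕ} (j : Fin m → Fin 2)
    (t : ℝ) (x : Plane) : ℝ :=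
  iteratedDerivWithin k
    (fun s => iteratedFDeriv ℝ m (angleBranch X t x s) x
      (fun l => EuclideanSpace.single (j l) (1 : ℝ))) (Icc 0 T) t

/-! ### The noise and the local solutions -/

/-- The forcing `v = α ẇ` of a path `w` on `[0, ∞)`. -/
def forcing (α : ℝ) (w : ℝ → ℝ) (t : ℝ) : ℝ := α * derivWithin w (Ici 0) t

/-- `w ε`, `0 < ε ≤ 1`, are adapted processes that start from `0` and are almost surely smooth. -/
structure IsSmoothNoise {Ω : Type u} {mΩ : MeasurableSpace Ω} (P : Measure Ω)
    (ℱ : Filtration ℝ≥0 mΩ) (w : ℝ → Ω → ℝ → ℝ) : Prop where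
  adapted : ∀ ε ∈ Ioc (0 : ℝ) 1, ∀ t : ℝ≥0, StronglyMeasurable[ℱ t] (fun o => w ε o t)
  zero : ∀ ε ∈ Ioc (0 : ℝ) 1, ∀ o, w ε o 0 = 0
  smooth : ∀ᵐ o ∂P, ∀ ε ∈ Ioc (0 : ℝ) 1, ContDiffOn ℝ ∞ (w ε o) (Ici 0)

/-- Local solutions of the flow forced by `v = α ẇ^ε` exist up to stopping times `σ ε > 0`, and
`(σ ε, d^ε(· ∧ σ ε))` converges almost surely, in `ℝ₊ × C([0,T], C^m(O))` for all `T` and `m`,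
to a pair `(σ₀, d)`, where `O` is an open neighbourhood of `γ₀`, `d^ε` is the signed
distance from the solution, `σ₀ > 0` is a stopping time and `d = d(· ∧ σ₀)` is a continuous adapted
process with values in `C^m(O)` for all `m`. -/
structure IsConvergentFamily {Ω : Type u} {mΩ : MeasurableSpace Ω} (P : Measure Ω)
    (ℱ : Filtration ℝ≥0 mΩ) (D : Set Plane) (Γ₀ : ℝ → Plane) (α : ℝ) (w : ℝ → Ω → ℝ → ℝ)
    (O : Set Plane) (σ : ℝ → Ω → ℝ≥0) (X : ℝ → Ω → ℝ → ℝ → Plane)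
    (σ₀ : Ω → ℝ≥0) (d : Ω → ℝ → Plane → ℝ) : Prop where
  isOpen : IsOpen O
  subset : range Γ₀ ⊆ O
  stopping : ∀ ε ∈ Ioc (0 : ℝ) 1, IsStoppingTime ℱ (fun o => (σ ε o : WithTop ℝ≥0))
  pos : ∀ᵐ o ∂P, ∀ ε ∈ Ioc (0 : ℝ) 1, 0 < σ ε o
  flow : ∀ᵐ o ∂P, ∀ ε ∈ Ioc (0 : ℝ) 1,
    IsConvexFlow D Γ₀ (forcing α (w ε o)) (σ ε o) (X ε o)
  dist_smooth : ∀ᵐ o ∂P, ∀ ε ∈ Ioc (0 : ℝ) 1, ∀ t ∈ Icc (0 : ℝ) (σ ε o),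
    ContDiffOn ℝ ∞ (curveSignedDist (X ε o t)) O
  stopping_lim : IsStoppingTime ℱ (fun o => (σ₀ o : WithTop ℝ≥0))
  pos_lim : ∀ᵐ o ∂P, 0 < σ₀ o
  stopped_lim : ∀ᵐ o ∂P, ∀ t : ℝ, 0 ≤ t → d o t = d o (min t (σ₀ o))
  smooth_lim : ∀ o, ∀ t : ℝ, 0 ≤ t → ContDiffOn ℝ ∞ (d o t) O
  continuous_lim : ∀ o, ∀ m : ℕ, ∀ t : ℝ, 0 ≤ t → ∀ η : ℝ, 0 < η →
    ∀ᶠ s in 𝓝[Ici 0] t, ∀ x ∈ O,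
      ‖iteratedFDeriv ℝ m (d o s) x - iteratedFDeriv ℝ m (d o t) x‖ ≤ η
  adapted_lim : ∀ m : ℕ, ∀ t : ℝ≥0, ∀ x ∈ O,
    StronglyMeasurable[ℱ t] (fun o => iteratedFDeriv ℝ m (d o t) x)
  tendsto_time : ∀ᵐ o ∂P, Tendsto (fun ε => σ ε o) (𝓝[>] 0) (𝓝 (σ₀ o))
  tendsto_dist : ∀ᵐ o ∂P, ∀ m : ℕ, ∀ T : ℝ, 0 < T → ∀ η : ℝ, 0 < η →
    ∀ᶠ ε in 𝓝[>] (0 : ℝ), ∀ t ∈ Icc 0 T, ∀ x ∈ O,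
      ‖iteratedFDeriv ℝ m (curveSignedDist (X ε o (min t (σ ε o)))) x
        - iteratedFDeriv ℝ m (d o t) x‖ ≤ η

end

/-! ### The moving frame -/

/-! The proof combines a static description of the curves by their signed distance, the flow
equation for the support function, and a rescaling of time.

Geometry. Write `e` for the tangent, `n` for the normal and `ρ = 1/κ`. At the point with parameter
`θ` the signed distance has gradient `n(θ)` and Hessian `κ e ⊗ e`, and its third derivative gives
`∂_θ κ`. A curve whose signed distance is close to that of `γ₀` in `C^{m₀}` is therefore close to
`γ₀` parameter by parameter, together with its curvature. Below `γ₀` the tangential eigenvalue of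
`I₂ + d ∇²d` at depth `r` is `(ρ - 2r)/(ρ - r)`, so its lower bound on the tube means `ρ ≥ 6δ` with
some room, and this room survives small perturbations (`IsGaussCurve.exists_barrier`). The limit `d`
is continuous and adapted, hence close to its initial value up to a positive stopping time;
convergence transfers this to `d^ε` for small `ε`, and a continuity argument keeps the curves inside
`O` (`IsConvergentFamily.exists_isDistClose`). Up to that time all curves obey bounds that depend on
`γ₀`, `δ`, `K`, `M` only, and the constraints of level `L` hold if `γ₀` satisfies them strictly.

Flow. The bounds on `∇^m d`, `m ≤ m₀`, along the curve control the angular derivatives, so no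
parabolic smoothing is needed. The support function `h = ⟨X, n⟩` satisfies `∂_t h = -1/ρ + (2π - |D|
v / 2) / ∫ρ` with `ρ = h + ∂_θ² h`, so that each time derivative is traded for two angular ones
(`ScaledFlow.mixedBdd_support`). The polynomial dependence on `v` comes from scaling: with `t = a s`
and `a = (1 + |v|_{N,T})⁻¹` the forcing is bounded by `1` in `C^N` and the coefficient of the
curvature is at most `1`. The derivatives in `s` are then bounded by a constant, and returning to
`t` costs a factor `(1 + |v|_{N,T})^k` (`IsConvexFlow.exists_deriv_bound`).

Angle. `θ(t, x)` solves `⟨x - X(t, φ), e(φ)⟩ = 0`, whose `φ`-derivative is `-(ρ + r)`. Its modulus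
is at least `3δ` on the tube, because `ρ ≥ 6δ` and `|r| < 3δ`. Implicit differentiation bounds the
derivatives of `θ` by those of `X` (`exists_abs_derivAngle_le`). -/

theorem Plane.inner_eq (x y : Plane) : inner ℝ x y = x 0 * y 0 + x 1 * y 1 := by
  simp [PiLp.inner_apply, Fin.sum_univ_two]
  ring

@[simp] theorem unitNormal_zero (θ : ℝ) : unitNormal θ 0 = Real.cos θ := rfl
@[simp] theorem unitNormal_one (θ : ℝ) : unitNormal θ 1 = Real.sin θ := rfl
@[simp] theorem unitTangent_zero (θ : ℝ) : unitTangent θ 0 = -Real.sin θ := rfl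
@[simp] theorem unitTangent_one (θ : ℝ) : unitTangent θ 1 = Real.cos θ := rfl

theorem Plane.ext' {x y : Plane} (h0 : x 0 = y 0) (h1 : x 1 = y 1) : x = y := by
  ext i; fin_cases i <;> assumption

theorem inner_unitNormal_self (θ : ℝ) : inner ℝ (unitNormal θ) (unitNormal θ) = 1 := by
  rw [Plane.inner_eq]; simp [← sq]

theorem inner_unitTangent_self (θ : ℝ) : inner ℝ (unitTangent θ) (unitTangent θ) = 1 := by
  rw [Plane.inner_eq]; simp [← sq]

theorem inner_unitTangent_unitNormal (θ : ℝ) :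
    inner ℝ (unitTangent θ) (unitNormal θ) = 0 := by
  simp [Plane.inner_eq]; ring

theorem inner_unitNormal_unitTangent (θ : ℝ) :
    inner ℝ (unitNormal θ) (unitTangent θ) = 0 := by
  simp [Plane.inner_eq]; ring

@[simp] theorem norm_unitNormal (θ : ℝ) : ‖unitNormal θ‖ = 1 := by
  simp [EuclideanSpace.norm_eq, Fin.sum_univ_two]

@[simp] theorem norm_unitTangent (θ : ℝ) : ‖unitTangent θ‖ = 1 := by
  simp [EuclideanSpace.norm_eq, Fin.sum_univ_two]

theorem frame_expansion (θ : ℝ) (x : Plane) :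
    x = inner ℝ x (unitTangent θ) • unitTangent θ + inner ℝ x (unitNormal θ) • unitNormal θ := by
  have h := Real.sin_sq_add_cos_sq θ
  apply Plane.ext' <;> simp [Plane.inner_eq]
  · linear_combination (-x 0) * h
  · linear_combination (-x 1) * h

theorem contDiff_unitNormal : ContDiff ℝ ω unitNormal := by
  rw [contDiff_euclidean]
  intro i; fin_cases i
  · exact Real.contDiff_cos
  · exact Real.contDiff_sin

theorem contDiff_unitTangent : ContDiff ℝ ω unitTangent := by
  rw [contDiff_euclidean]
  intro i; fin_cases i
  · exact Real.contDiff_sin.neg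
  · exact Real.contDiff_cos

theorem Plane.hasDerivAt {f : ℝ → Plane} {f' : Plane} {t : ℝ}
    (h0 : HasDerivAt (fun s => f s 0) (f' 0) t) (h1 : HasDerivAt (fun s => f s 1) (f' 1) t) :
    HasDerivAt f f' t := by
  have h : HasDerivAt (fun s i => f s i) (fun i => f' i) t :=
    hasDerivAt_pi.2 fun i => by fin_cases i <;> assumption
  exact (PiLp.continuousLinearEquiv 2 ℝ fun _ : Fin 2 => ℝ).symm.hasFDerivAt.comp_hasDerivAt t h

theorem hasDerivAt_unitNormal (θ : ℝ) : HasDerivAt unitNormal (unitTangent θ) θ := by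
  refine Plane.hasDerivAt ?_ ?_
  · exact Real.hasDerivAt_cos θ
  · exact Real.hasDerivAt_sin θ

theorem hasDerivAt_unitTangent (θ : ℝ) : HasDerivAt unitTangent (-unitNormal θ) θ := by
  refine Plane.hasDerivAt ?_ ?_
  · exact (Real.hasDerivAt_sin θ).neg
  · exact Real.hasDerivAt_cos θ

theorem periodic_unitNormal : Function.Periodic unitNormal (2 * Real.pi) := fun θ => by
  apply Plane.ext' <;> simp

theorem inner_unitTangent_unitNormal_eq_sin (φ θ : ℝ) :
    inner ℝ (unitTangent φ) (unitNormal θ) = -Real.sin (φ - θ) := by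
  rw [Real.sin_sub]; simp [Plane.inner_eq]; ring

theorem unitNormal_eq_smul_of_norm (v : Plane) : ∃ ψ, v = ‖v‖ • unitNormal ψ := by
  refine ⟨Complex.arg ⟨v 0, v 1⟩, ?_⟩
  have hn : ‖(⟨v 0, v 1⟩ : ℂ)‖ = ‖v‖ := by
    rw [EuclideanSpace.norm_eq, Fin.sum_univ_two, Complex.norm_eq_sqrt_sq_add_sq]
    simp
  apply Plane.ext'
  · simpa [hn] using (Complex.norm_mul_cos_arg ⟨v 0, v 1⟩).symm
  · simpa [hn] using (Complex.norm_mul_sin_arg ⟨v 0, v 1⟩).symm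

theorem norm_unitNormal_sub (φ ψ : ℝ) :
    ‖unitNormal φ - unitNormal ψ‖ ^ 2 = 2 - 2 * Real.cos (φ - ψ) := by
  rw [← real_inner_self_eq_norm_sq, Real.cos_sub]
  simp only [Plane.inner_eq, PiLp.sub_apply, unitNormal_zero, unitNormal_one]
  linear_combination Real.sin_sq_add_cos_sq φ + Real.sin_sq_add_cos_sq ψ

/-- Jordan's inequality for the chord of the unit circle. -/
theorem abs_sub_le_norm_unitNormal_sub {φ ψ : ℝ} (h : |φ - ψ| ≤ Real.pi) :
    |φ - ψ| ≤ Real.pi / 2 * ‖unitNormal φ - unitNormal ψ‖ := by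
  have h1 := Real.cos_le_one_sub_mul_cos_sq h
  have h3 := norm_unitNormal_sub φ ψ
  have hpi := Real.pi_pos
  have h4 : |φ - ψ| ^ 2 ≤ (Real.pi / 2 * ‖unitNormal φ - unitNormal ψ‖) ^ 2 := by
    rw [mul_pow, h3, sq_abs]
    have : 2 / Real.pi ^ 2 * (φ - ψ) ^ 2 * Real.pi ^ 2 = 2 * (φ - ψ) ^ 2 := by
      field_simp
    nlinarith [sq_nonneg (Real.pi)]
  exact le_of_sq_le_sq h4 (by positivity)

theorem unitNormal_injOn : InjOn unitNormal (Ico 0 (2 * Real.pi)) := by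
  intro φ hφ ψ hψ h
  have hc : Real.cos (φ - ψ) = 1 := by
    have := norm_unitNormal_sub φ ψ
    rw [h, sub_self, norm_zero] at this
    linarith
  have := (Real.cos_eq_one_iff_of_lt_of_lt (by linarith [hφ.1, hψ.2]) (by linarith [hφ.2, hψ.1])).1 hc
  linarith

theorem exists_zsmul_near (φ θ : ℝ) : ∃ k : ℤ, |φ - k • (2 * Real.pi) - θ| ≤ Real.pi := by
  refine ⟨toIcoDiv Real.two_pi_pos (θ - Real.pi) φ, ?_⟩
  rw [self_sub_toIcoDiv_zsmul]
  have := toIcoMod_mem_Ico Real.two_pi_pos (θ - Real.pi) φ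
  rw [abs_le]; constructor <;> linarith [this.1, this.2]

/-! ### Convexity in the Gauss parametrization -/

/-- A closed curve with tangent `ρ • unitTangent`, `ρ ≥ 0`, stays behind its tangent lines. -/
theorem inner_sub_unitNormal_nonpos {Z : ℝ → Plane} {ρ : ℝ → ℝ}
    (hp : Function.Periodic Z (2 * Real.pi)) (hZ : ∀ θ, HasDerivAt Z (ρ θ • unitTangent θ) θ)
    (hρ : ∀ θ, 0 ≤ ρ θ) (φ θ : ℝ) : inner ℝ (Z φ - Z θ) (unitNormal θ) ≤ 0 := by
  -- The height in the direction `n(θ)` increases on `[θ - π, θ]` and decreases on `[θ, θ + π]`.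
  -- Periodicity moves `φ` into this window.
  have hd : ∀ φ, HasDerivAt (fun φ => inner ℝ (Z φ) (unitNormal θ))
      (-(ρ φ * Real.sin (φ - θ))) φ := fun φ => by
    have := (hZ φ).inner ℝ (hasDerivAt_const φ (unitNormal θ))
    simpa [inner_smul_left, inner_unitTangent_unitNormal_eq_sin] using this
  have hc : Continuous fun φ => inner ℝ (Z φ) (unitNormal θ) :=
    continuous_iff_continuousAt.2 fun φ => (hd φ).continuousAt
  obtain ⟨k, hk⟩ := exists_zsmul_near φ θ
  rw [← hp.sub_zsmul_eq k, inner_sub_left, sub_nonpos]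
  set ψ := φ - k • (2 * Real.pi)
  rw [abs_le] at hk
  rcases le_total θ ψ with h | h
  · refine antitoneOn_of_deriv_nonpos (convex_Icc θ (θ + Real.pi)) hc.continuousOn
      (fun x _ => (hd x).differentiableAt.differentiableWithinAt) (fun x hx => ?_)
      ⟨le_rfl, by linarith [Real.pi_pos]⟩ ⟨h, by linarith⟩ h
    rw [interior_Icc] at hx
    rw [(hd x).deriv]
    have := Real.sin_nonneg_of_nonneg_of_le_pi (x := x - θ) (by linarith [hx.1]) (by linarith [hx.2])
    nlinarith [hρ x, mul_nonneg (hρ x) this]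
  · refine monotoneOn_of_deriv_nonneg (convex_Icc (θ - Real.pi) θ) hc.continuousOn
      (fun x _ => (hd x).differentiableAt.differentiableWithinAt) (fun x hx => ?_)
      ⟨by linarith, h⟩ ⟨by linarith [Real.pi_pos], le_rfl⟩ h
    rw [interior_Icc] at hx
    rw [(hd x).deriv]
    have := Real.sin_nonpos_of_nonpos_of_neg_pi_le (x := x - θ) (by linarith [hx.2])
      (by linarith [hx.1])
    nlinarith [hρ x, mul_nonneg (hρ x) (neg_nonneg.2 this)]

namespace IsGaussCurve

variable {Γ : ℝ → Plane}

theorem norm_deriv_pos (h : IsGaussCurve Γ) (θ : ℝ) : 0 < ‖deriv Γ θ‖ := by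
  obtain ⟨ρ, hρ, e⟩ := h.tangent θ
  rw [e, norm_smul, norm_unitTangent, mul_one]
  exact norm_pos_iff.2 hρ.ne'

theorem deriv_eq (h : IsGaussCurve Γ) (θ : ℝ) : deriv Γ θ = ‖deriv Γ θ‖ • unitTangent θ := by
  obtain ⟨ρ, hρ, e⟩ := h.tangent θ
  rw [e, norm_smul, norm_unitTangent, mul_one, Real.norm_of_nonneg hρ.le]

theorem hasDerivAt (h : IsGaussCurve Γ) (θ : ℝ) :
    HasDerivAt Γ (‖deriv Γ θ‖ • unitTangent θ) θ := by
  rw [← h.deriv_eq]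
  exact (h.smooth.differentiable (by simp) θ).hasDerivAt

theorem continuous (h : IsGaussCurve Γ) : Continuous Γ := h.smooth.continuous

theorem norm_deriv_eq_inner (h : IsGaussCurve Γ) (θ : ℝ) :
    ‖deriv Γ θ‖ = inner ℝ (deriv Γ θ) (unitTangent θ) := by
  conv_rhs => rw [h.deriv_eq, inner_smul_left, inner_unitTangent_self]
  simp

theorem contDiff_norm_deriv (h : IsGaussCurve Γ) : ContDiff ℝ ∞ fun θ => ‖deriv Γ θ‖ := by
  have : (fun θ => ‖deriv Γ θ‖) = fun θ => inner ℝ (deriv Γ θ) (unitTangent θ) :=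
    funext h.norm_deriv_eq_inner
  rw [this]
  exact ((contDiff_infty_iff_deriv.1 h.smooth).2).inner ℝ (contDiff_unitTangent.of_le le_top)

theorem range_eq (h : IsGaussCurve Γ) : range Γ = Γ '' Icc 0 (2 * Real.pi) := by
  refine (h.periodic.image_Icc Real.two_pi_pos 0).symm.trans ?_
  simp

theorem isCompact_range (h : IsGaussCurve Γ) : IsCompact (range Γ) := by
  rw [h.range_eq]
  exact isCompact_Icc.image h.continuous

theorem hasDerivAt_add_smul (h : IsGaussCurve Γ) (r θ : ℝ) :
    HasDerivAt (fun θ => Γ θ + r • unitNormal θ) ((‖deriv Γ θ‖ + r) • unitTangent θ) θ := by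
  rw [add_smul]
  exact (h.hasDerivAt θ).add ((hasDerivAt_unitNormal θ).const_smul r)

theorem periodic_add_smul (h : IsGaussCurve Γ) (r : ℝ) :
    Function.Periodic (fun θ => Γ θ + r • unitNormal θ) (2 * Real.pi) := fun θ => by
  simp only [h.periodic θ, periodic_unitNormal θ]

/-- The parallel curve at distance `r` has tangent `(ρ + r) e`, so it remains convex as long as no
radius of curvature is smaller than `-r`. Negative `r` turn plain convexity into quantitative
convexity. -/
theorem inner_parallel_sub_nonpos (h : IsGaussCurve Γ) {r : ℝ} (hr : ∀ θ, -r ≤ ‖deriv Γ θ‖)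
    (φ θ : ℝ) : inner ℝ ((Γ φ + r • unitNormal φ) - (Γ θ + r • unitNormal θ)) (unitNormal θ) ≤ 0 :=
  inner_sub_unitNormal_nonpos (h.periodic_add_smul r) (h.hasDerivAt_add_smul r)
    (fun θ => by linarith [hr θ]) φ θ

theorem inner_sub_nonpos (h : IsGaussCurve Γ) (φ θ : ℝ) :
    inner ℝ (Γ φ - Γ θ) (unitNormal θ) ≤ 0 := by
  simpa using h.inner_parallel_sub_nonpos (r := 0) (fun θ => by simp) φ θ

/-- The Gauss parametrization is strongly monotone. -/
theorem le_inner_sub_sub (h : IsGaussCurve Γ) {R : ℝ} (hR : ∀ θ, R ≤ ‖deriv Γ θ‖) (φ ψ : ℝ) :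
    R * ‖unitNormal φ - unitNormal ψ‖ ^ 2
      ≤ inner ℝ (Γ φ - Γ ψ) (unitNormal φ - unitNormal ψ) := by
  -- The inner parallel curve `Γ - R n` is still convex. Adding its support inequalities at `φ` and
  -- at `ψ` gives the claim.
  have h1 := h.inner_parallel_sub_nonpos (r := -R) (fun θ => by simpa using hR θ) φ ψ
  have h2 := h.inner_parallel_sub_nonpos (r := -R) (fun θ => by simpa using hR θ) ψ φ
  rw [← real_inner_self_eq_norm_sq]
  simp only [Plane.inner_eq, PiLp.sub_apply, PiLp.add_apply, PiLp.smul_apply, smul_eq_mul] at *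
  linarith

theorem inner_sub_nonpos_of_mem_convexHull (h : IsGaussCurve Γ) {x : Plane}
    (hx : x ∈ convexHull ℝ (range Γ)) (ψ : ℝ) : inner ℝ (x - Γ ψ) (unitNormal ψ) ≤ 0 := by
  have hsub : convexHull ℝ (range Γ) ⊆ {y | inner ℝ (unitNormal ψ) y
      ≤ inner ℝ (unitNormal ψ) (Γ ψ)} := by
    apply convexHull_min
    · rintro _ ⟨φ, rfl⟩
      have := h.inner_sub_nonpos φ ψ
      rw [real_inner_comm, inner_sub_right] at this
      simpa using this
    · exact convex_halfSpace_le (f := fun y => inner ℝ (unitNormal ψ) y)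
        (innerₛₗ ℝ (unitNormal ψ)).isLinear _
  have := hsub hx
  rw [real_inner_comm, inner_sub_right]
  simpa using this

/-- The hull of a finite `s`-net of the curve is closed, so a point outside it is strictly separated
from it. The separating normal is a multiple of some `n(ψ)`, and a net point within `s` of `Γ ψ`
lies on the wrong side. -/
theorem mem_convexHull_of_inner_sub_le (h : IsGaussCurve Γ) {x : Plane} {s : ℝ} (hs : 0 < s)
    (hx : ∀ ψ, inner ℝ (x - Γ ψ) (unitNormal ψ) ≤ -s) : x ∈ convexHull ℝ (range Γ) := by
  obtain ⟨t, htΓ, htf, ht⟩ := h.isCompact_range.finite_cover_balls hs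
  refine convexHull_mono htΓ ?_
  by_contra hn
  obtain ⟨f, u, hf, hu⟩ := geometric_hahn_banach_closed_point (convex_convexHull ℝ t)
    (htf.isClosed_convexHull ℝ) hn
  obtain ⟨v, hv⟩ : ∃ v : Plane, ∀ y, f y = inner ℝ v y :=
    ⟨(InnerProductSpace.toDual ℝ Plane).symm f, fun y => by simp⟩
  obtain ⟨ψ, hψ⟩ := unitNormal_eq_smul_of_norm v
  obtain ⟨y, hy, hyb⟩ := mem_iUnion₂.1 (ht ⟨ψ, rfl⟩)
  have h1 := (hf y (subset_convexHull ℝ _ hy)).trans hu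
  rw [hv, hv, ← sub_neg, ← inner_sub_right, hψ, inner_smul_left] at h1
  have h2 := hx ψ
  have h3 := real_inner_le_norm (Γ ψ - y) (unitNormal ψ)
  rw [norm_unitNormal, mul_one, ← dist_eq_norm] at h3
  have h4 : inner ℝ (unitNormal ψ) (y - x)
      = - inner ℝ (x - Γ ψ) (unitNormal ψ) - inner ℝ (Γ ψ - y) (unitNormal ψ) := by
    rw [real_inner_comm, ← inner_neg_left, ← inner_sub_left]; congr 1; abel
  have h5 : 0 ≤ inner ℝ (unitNormal ψ) (y - x) := by
    rw [h4]; linarith [Metric.mem_ball.1 hyb]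
  have := mul_nonneg (norm_nonneg v) h5
  simp at h1
  linarith

theorem abs_curveSignedDist (Γ : ℝ → Plane) (x : Plane) :
    |curveSignedDist Γ x| = Metric.infDist x (range Γ) := by
  unfold curveSignedDist
  split_ifs <;> simp [abs_of_nonneg Metric.infDist_nonneg]

/-- For `r < 0` this places the point `Γ φ + r n(φ)` at depth at least `|r|` behind every tangent
line, which yields both its distance from the curve and its membership in the hull. -/
theorem le_inner_sub (h : IsGaussCurve Γ) {r : ℝ} (hr : ∀ θ, -r ≤ ‖deriv Γ θ‖) (φ ψ : ℝ) :
    inner ℝ (Γ φ + r • unitNormal φ - Γ ψ) (unitNormal ψ) ≤ r := by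
  have h1 := h.inner_parallel_sub_nonpos hr φ ψ
  have h2 := inner_unitNormal_self ψ
  simp only [Plane.inner_eq, PiLp.sub_apply, PiLp.add_apply, PiLp.smul_apply, smul_eq_mul] at *
  linear_combination h1 + r * h2

/-- The signed distance along the normals, up to the smallest radius of curvature. -/
theorem curveSignedDist_add_smul (h : IsGaussCurve Γ) {r : ℝ} (hr : ∀ θ, -r ≤ ‖deriv Γ θ‖)
    (φ : ℝ) : curveSignedDist Γ (Γ φ + r • unitNormal φ) = r := by
  set x := Γ φ + r • unitNormal φ with hx
  have hxφ : x - Γ φ = r • unitNormal φ := by simp [hx]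
  have hdist : dist x (Γ φ) = |r| := by
    rw [dist_eq_norm, hxφ, norm_smul, norm_unitNormal, mul_one, Real.norm_eq_abs]
  have hinf : Metric.infDist x (range Γ) = |r| := by
    apply le_antisymm
    · rw [← hdist]; exact Metric.infDist_le_dist_of_mem ⟨φ, rfl⟩
    · refine (Metric.le_infDist (range_nonempty Γ)).2 ?_
      rintro _ ⟨ψ, rfl⟩
      rw [dist_eq_norm]
      -- On the outer side the tangent line at `φ` separates `x` from the curve by `r`. On the inner
      -- side the tangent line at `ψ` bounds the distance to `Γ ψ` from below by `|r|`.
      rcases le_total 0 r with h0 | h0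
      · rw [abs_of_nonneg h0]
        have h1 := h.inner_sub_nonpos ψ φ
        have h2 := real_inner_le_norm (x - Γ ψ) (unitNormal φ)
        have h3 : inner ℝ (x - Γ ψ) (unitNormal φ)
            = r - inner ℝ (Γ ψ - Γ φ) (unitNormal φ) := by
          have : x - Γ ψ = r • unitNormal φ - (Γ ψ - Γ φ) := by rw [← hxφ]; abel
          rw [this, inner_sub_left, inner_smul_left, inner_unitNormal_self]; simp
        rw [norm_unitNormal, mul_one] at h2
        linarith
      · rw [abs_of_nonpos h0]
        have h1 := h.le_inner_sub hr φ ψ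
        have h2 := abs_real_inner_le_norm (x - Γ ψ) (unitNormal ψ)
        rw [norm_unitNormal, mul_one] at h2
        linarith [neg_abs_le (inner ℝ (x - Γ ψ) (unitNormal ψ))]
  have hmem : x ∈ convexHull ℝ (range Γ) ↔ r ≤ 0 := by
    constructor
    · intro H
      have := h.inner_sub_nonpos_of_mem_convexHull H φ
      rwa [hxφ, inner_smul_left, inner_unitNormal_self, mul_one] at this
    · intro h0
      rcases h0.eq_or_lt with rfl | h0
      · exact subset_convexHull ℝ _ ⟨φ, by simp [hx]⟩
      · refine h.mem_convexHull_of_inner_sub_le (neg_pos.2 h0) fun ψ => ?_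
        simpa using h.le_inner_sub hr φ ψ
  unfold curveSignedDist
  rw [hinf]
  split_ifs with H
  · rw [abs_of_nonpos (hmem.1 H), neg_neg]
  · rw [abs_of_nonneg (le_of_not_ge fun h' => H (hmem.2 h'))]

/-- Normal coordinates cover the points closer to the curve than the smallest radius of
curvature. -/
theorem exists_normal_coordinate (h : IsGaussCurve Γ) {R : ℝ} (hR : ∀ θ, R ≤ ‖deriv Γ θ‖)
    {x : Plane} (hx : |curveSignedDist Γ x| < R) :
    ∃ φ ∈ Ico 0 (2 * Real.pi), Γ φ + curveSignedDist Γ x • unitNormal φ = x := by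
  obtain ⟨_, ⟨φ₀, rfl⟩, hφ₀⟩ := h.isCompact_range.exists_infDist_eq_dist (range_nonempty Γ) x
  obtain ⟨φ, hφ, hφφ⟩ := h.periodic.exists_mem_Ico₀ Real.two_pi_pos φ₀
  rw [hφφ] at hφ₀
  have hmin : IsLocalMin (fun ψ => ‖x - Γ ψ‖ ^ 2) φ := by
    refine Filter.Eventually.of_forall fun ψ => ?_
    have : dist x (Γ φ) ≤ dist x (Γ ψ) := hφ₀ ▸ Metric.infDist_le_dist_of_mem ⟨ψ, rfl⟩
    rw [dist_eq_norm, dist_eq_norm] at this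
    exact pow_le_pow_left₀ (norm_nonneg _) this 2
  have hd : HasDerivAt (fun ψ => ‖x - Γ ψ‖ ^ 2)
      (2 * inner ℝ (x - Γ φ) (-(‖deriv Γ φ‖ • unitTangent φ))) φ :=
    HasDerivAt.norm_sq ((h.hasDerivAt φ).const_sub x)
  have h0 := hmin.hasDerivAt_eq_zero hd
  have hT : inner ℝ (x - Γ φ) (unitTangent φ) = 0 := by
    rw [inner_neg_right, inner_smul_right] at h0
    have := (h.norm_deriv_pos φ).ne'
    simpa [this] using h0
  have hexp := frame_expansion φ (x - Γ φ)
  rw [hT, zero_smul, zero_add] at hexp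
  set r := inner ℝ (x - Γ φ) (unitNormal φ) with hr
  have hxr : Γ φ + r • unitNormal φ = x := by rw [← hexp]; abel
  refine ⟨φ, hφ, ?_⟩
  -- Minimality determines `r` up to sign. Since `|r| < R`, the formula for the signed distance
  -- along normals applies and identifies `r` with the signed distance.
  have habs : |curveSignedDist Γ x| = |r| := by
    rw [abs_curveSignedDist, hφ₀, dist_eq_norm, hexp, norm_smul, norm_unitNormal, mul_one,
      Real.norm_eq_abs]
  have hrR : ∀ θ, -r ≤ ‖deriv Γ θ‖ := fun θ => by
    have := neg_abs_le r
    linarith [hR θ]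
  have := h.curveSignedDist_add_smul hrR φ
  rw [hxr] at this
  rw [this, hxr]

end IsGaussCurve

/-- Stability of the normal coordinate under perturbations of the curve and of the point. -/
theorem norm_unitNormal_sub_le {Γ Γ' : ℝ → Plane} (h : IsGaussCurve Γ) {R : ℝ}
    (hR : ∀ θ, R ≤ ‖deriv Γ θ‖) {c r r' φ ψ : ℝ} (hc : 0 < c) (hr : 2 * c ≤ 2 * R + (r + r')) :
    ‖unitNormal φ - unitNormal ψ‖ ≤
      (‖(Γ φ + r • unitNormal φ) - (Γ' ψ + r' • unitNormal ψ)‖ + ‖Γ ψ - Γ' ψ‖) / c := by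
  set v := unitNormal φ - unitNormal ψ with hv
  set w := (Γ φ + r • unitNormal φ) - (Γ' ψ + r' • unitNormal ψ) with hw
  have h1 := h.le_inner_sub_sub hR φ ψ
  -- Both normals have length one, so the antisymmetric part in `r - r'` vanishes. The monotonicity
  -- constant thus becomes `R + (r + r')/2 ≥ c`.
  have h2 : inner ℝ (r • unitNormal φ - r' • unitNormal ψ) v = (r + r') / 2 * ‖v‖ ^ 2 := by
    rw [← real_inner_self_eq_norm_sq, hv]
    simp only [Plane.inner_eq, PiLp.sub_apply, PiLp.smul_apply, smul_eq_mul, unitNormal_zero,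
      unitNormal_one]
    linear_combination (r - r') / 2 * (Real.sin_sq_add_cos_sq φ - Real.sin_sq_add_cos_sq ψ)
  have h3 : inner ℝ (w - (Γ ψ - Γ' ψ)) v = inner ℝ (Γ φ - Γ ψ) v
      + inner ℝ (r • unitNormal φ - r' • unitNormal ψ) v := by
    rw [← inner_add_left]; congr 1; rw [hw]; abel
  have h4 := real_inner_le_norm (w - (Γ ψ - Γ' ψ)) v
  have h5 := norm_sub_le w (Γ ψ - Γ' ψ)
  rw [le_div_iff₀ hc]
  rcases (norm_nonneg v).eq_or_lt with h0 | h0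
  · rw [← h0, zero_mul]; positivity
  · have h6 : c * ‖v‖ ^ 2 ≤ (‖w‖ + ‖Γ ψ - Γ' ψ‖) * ‖v‖ := by
      calc c * ‖v‖ ^ 2 ≤ (R + (r + r') / 2) * ‖v‖ ^ 2 := by
            gcongr; linarith
        _ ≤ ‖w - (Γ ψ - Γ' ψ)‖ * ‖v‖ := by linarith
        _ ≤ _ := by gcongr
    nlinarith

/-! ### Regularity of the signed distance in the range of the normal coordinates -/

/-- The derivative of the normal coordinates, as an isomorphism. -/
noncomputable def normalCoordinateEquiv (φ s : ℝ) (hs : s ≠ 0) : (ℝ × ℝ) ≃L[ℝ] Plane :=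
  ContinuousLinearEquiv.equivOfInverse
    ((ContinuousLinearMap.fst ℝ ℝ ℝ).smulRight (s • unitTangent φ)
      + (ContinuousLinearMap.snd ℝ ℝ ℝ).smulRight (unitNormal φ))
    ((s⁻¹ • innerSL ℝ (unitTangent φ)).prod (innerSL ℝ (unitNormal φ)))
    (fun p => by
      simp [inner_add_right, inner_smul_right, inner_unitTangent_unitNormal,
        inner_unitNormal_unitTangent]
      ext
      · simp; field_simp
      · simp)
    (fun x => by
      conv_rhs => rw [frame_expansion φ x]
      simp [smul_smul, real_inner_comm]
      field_simp)

namespace IsGaussCurve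

variable {Γ : ℝ → Plane}

theorem contDiff_normalCoordinate (h : IsGaussCurve Γ) :
    ContDiff ℝ ∞ fun p : ℝ × ℝ => Γ p.1 + p.2 • unitNormal p.1 :=
  (h.smooth.comp contDiff_fst).add
    (contDiff_snd.smul ((contDiff_unitNormal.of_le le_top).comp contDiff_fst))

theorem hasFDerivAt_normalCoordinate (h : IsGaussCurve Γ) (φ r : ℝ) (hs : ‖deriv Γ φ‖ + r ≠ 0) :
    HasFDerivAt (fun p : ℝ × ℝ => Γ p.1 + p.2 • unitNormal p.1)
      (normalCoordinateEquiv φ (‖deriv Γ φ‖ + r) hs : (ℝ × ℝ) →L[ℝ] Plane) (φ, r) := by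
  have h1 : HasFDerivAt (fun p : ℝ × ℝ => Γ p.1) _ (φ, r) :=
    (h.hasDerivAt φ).hasFDerivAt.comp (φ, r) hasFDerivAt_fst
  have h2 : HasFDerivAt (fun p : ℝ × ℝ => unitNormal p.1) _ (φ, r) :=
    HasFDerivAt.comp (g := unitNormal) (φ, r) (hasDerivAt_unitNormal φ).hasFDerivAt
      hasFDerivAt_fst
  refine (h1.add (hasFDerivAt_snd.smul h2)).congr_fderiv ?_
  ext p <;> simp [normalCoordinateEquiv, add_smul, smul_smul]

/-- The normal coordinates have derivative with factors `ρ + r ≠ 0` and `1`, hence a smooth local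
inverse. Its second component is the signed distance because the formula along normals holds for all
`r > -R`. -/
theorem eventually_curveSignedDist_eq (h : IsGaussCurve Γ) {R : ℝ} (hR : ∀ θ, R ≤ ‖deriv Γ θ‖)
    {r : ℝ} (hr : -R < r) (φ : ℝ) :
    ∃ g : Plane → ℝ × ℝ, ContDiffAt ℝ ∞ g (Γ φ + r • unitNormal φ) ∧
      ∀ᶠ y in 𝓝 (Γ φ + r • unitNormal φ), curveSignedDist Γ y = (g y).2 := by
  have hs : ‖deriv Γ φ‖ + r ≠ 0 := by linarith [hR φ]
  have hf : ContDiffAt ℝ ∞ (fun p : ℝ × ℝ => Γ p.1 + p.2 • unitNormal p.1) (φ, r) :=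
    h.contDiff_normalCoordinate.contDiffAt
  have hf' := h.hasFDerivAt_normalCoordinate φ r hs
  have hst := hf.hasStrictFDerivAt' hf' (by simp)
  have hg := hf.to_localInverse hf' (by simp)
  refine ⟨_, hg, ?_⟩
  have hc := hg.continuousAt
  have himg := hf.localInverse_apply_image hf' (by simp)
  have h1 : ∀ᶠ y in 𝓝 (Γ φ + r • unitNormal φ),
      -R < (hf.localInverse hf' (by simp) y).2 := by
    have : Tendsto (fun y => (hf.localInverse hf' (by simp) y).2)
        (𝓝 (Γ φ + r • unitNormal φ)) (𝓝 r) := by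
      have := (continuous_snd.tendsto _).comp hc.tendsto
      rwa [himg] at this
    exact this.eventually (lt_mem_nhds hr)
  filter_upwards [h1, hst.eventually_right_inverse] with y hy1 hy2
  have := h.curveSignedDist_add_smul (r := (hf.localInverse hf' (by simp) y).2)
    (fun θ => by linarith [hR θ]) (hf.localInverse hf' (by simp) y).1
  change (fun p : ℝ × ℝ => Γ p.1 + p.2 • unitNormal p.1) (hf.localInverse hf' (by simp) y) = y
    at hy2
  dsimp only at hy2
  rw [hy2] at this
  exact this

theorem contDiffAt_curveSignedDist (h : IsGaussCurve Γ) {R : ℝ} (hR : ∀ θ, R ≤ ‖deriv Γ θ‖)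
    {r : ℝ} (hr : -R < r) (φ : ℝ) :
    ContDiffAt ℝ ∞ (curveSignedDist Γ) (Γ φ + r • unitNormal φ) := by
  obtain ⟨g, hg, he⟩ := h.eventually_curveSignedDist_eq hR hr φ
  exact (contDiffAt_snd.comp _ hg).congr_of_eventuallyEq he

/-- The signed distance is constant on parallel curves and has slope one along normals. -/
theorem fderiv_curveSignedDist (h : IsGaussCurve Γ) {R : ℝ} (hR : ∀ θ, R ≤ ‖deriv Γ θ‖)
    {r : ℝ} (hr : -R < r) (φ : ℝ) :
    fderiv ℝ (curveSignedDist Γ) (Γ φ + r • unitNormal φ) = innerSL ℝ (unitNormal φ) := by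
  have hd := ((h.contDiffAt_curveSignedDist hR hr φ).differentiableAt (by simp)).hasFDerivAt
  have hs : ‖deriv Γ φ‖ + r ≠ 0 := by linarith [hR φ]
  have hT : fderiv ℝ (curveSignedDist Γ) (Γ φ + r • unitNormal φ) (unitTangent φ) = 0 := by
    have h1 := hd.comp_hasDerivAt φ (h.hasDerivAt_add_smul r φ)
    have h2 : (curveSignedDist Γ ∘ fun θ => Γ θ + r • unitNormal θ) = fun _ => r :=
      funext fun θ => h.curveSignedDist_add_smul (fun θ => by linarith [hR θ]) θ
    rw [h2] at h1
    have := h1.unique (hasDerivAt_const φ r)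
    rw [map_smul, smul_eq_mul] at this
    exact (mul_eq_zero.1 this).resolve_left hs
  have hn : fderiv ℝ (curveSignedDist Γ) (Γ φ + r • unitNormal φ) (unitNormal φ) = 1 := by
    have h0 : HasDerivAt (fun s : ℝ => Γ φ + s • unitNormal φ) (unitNormal φ) r := by
      simpa using ((hasDerivAt_id r).smul_const (unitNormal φ)).const_add (Γ φ)
    have h1 := hd.comp_hasDerivAt r h0
    have h2 : (curveSignedDist Γ ∘ fun s : ℝ => Γ φ + s • unitNormal φ) =ᶠ[𝓝 r] fun s => s := by
      filter_upwards [lt_mem_nhds hr] with s hs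
      exact h.curveSignedDist_add_smul (fun θ => by linarith [hR θ]) φ
    exact (h1.congr_of_eventuallyEq h2.symm).unique (hasDerivAt_id r)
  ext x
  conv_lhs => rw [frame_expansion φ x]
  rw [map_add, map_smul, map_smul, hT, hn, innerSL_apply_apply]
  simp [real_inner_comm]

/-- The identity `∇d = n(θ)` is differentiated along the parallel curves, whose speed is `ρ + r`,
and along the normals, where the gradient is constant. -/
theorem fderiv_fderiv_curveSignedDist (h : IsGaussCurve Γ) {R : ℝ}
    (hR : ∀ θ, R ≤ ‖deriv Γ θ‖) {r : ℝ} (hr : -R < r) (φ : ℝ) (x y : Plane) :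
    fderiv ℝ (fderiv ℝ (curveSignedDist Γ)) (Γ φ + r • unitNormal φ) x y
      = (‖deriv Γ φ‖ + r)⁻¹ * inner ℝ x (unitTangent φ) * inner ℝ y (unitTangent φ) := by
  have hd : HasFDerivAt (fderiv ℝ (curveSignedDist Γ)) _ (Γ φ + r • unitNormal φ) :=
    (((h.contDiffAt_curveSignedDist hR hr φ).fderiv_right (m := 1)
      (by norm_cast)).differentiableAt (by simp)).hasFDerivAt
  have hs : ‖deriv Γ φ‖ + r ≠ 0 := by linarith [hR φ]
  set D := fderiv ℝ (fderiv ℝ (curveSignedDist Γ)) (Γ φ + r • unitNormal φ)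
  have hT : (‖deriv Γ φ‖ + r) • D (unitTangent φ) = innerSL ℝ (unitTangent φ) := by
    have h1 := hd.comp_hasDerivAt φ (h.hasDerivAt_add_smul r φ)
    have h2 : (fderiv ℝ (curveSignedDist Γ) ∘ fun θ => Γ θ + r • unitNormal θ)
        = fun θ => innerSL ℝ (unitNormal θ) :=
      funext fun θ => h.fderiv_curveSignedDist hR hr θ
    rw [h2] at h1
    rw [← map_smul]
    exact h1.unique ((innerSL ℝ (E := Plane)).hasFDerivAt.comp_hasDerivAt φ
      (hasDerivAt_unitNormal φ))
  have hn : D (unitNormal φ) = 0 := by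
    have h0 : HasDerivAt (fun s : ℝ => Γ φ + s • unitNormal φ) (unitNormal φ) r := by
      simpa using ((hasDerivAt_id r).smul_const (unitNormal φ)).const_add (Γ φ)
    have h1 := hd.comp_hasDerivAt r h0
    have h2 : (fderiv ℝ (curveSignedDist Γ) ∘ fun s : ℝ => Γ φ + s • unitNormal φ)
        =ᶠ[𝓝 r] fun _ => innerSL ℝ (unitNormal φ) := by
      filter_upwards [lt_mem_nhds hr] with s hs
      exact h.fderiv_curveSignedDist hR hs φ
    exact (h1.congr_of_eventuallyEq h2.symm).unique (hasDerivAt_const r _)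
  have hT' : D (unitTangent φ) = (‖deriv Γ φ‖ + r)⁻¹ • innerSL ℝ (unitTangent φ) := by
    rw [← hT, smul_smul, inv_mul_cancel₀ hs, one_smul]
  conv_lhs => rw [frame_expansion φ x]
  rw [map_add, map_smul, map_smul, hT', hn]
  simp [real_inner_comm]
  ring

theorem jacobianForm_eq (h : IsGaussCurve Γ) {R : ℝ} (hR : ∀ θ, R ≤ ‖deriv Γ θ‖)
    {r : ℝ} (hr : -R < r) (φ : ℝ) (ξ : Plane) :
    jacobianForm Γ (Γ φ + r • unitNormal φ) ξ
      = ‖ξ‖ ^ 2 + r * ((‖deriv Γ φ‖ + r)⁻¹ * inner ℝ ξ (unitTangent φ) ^ 2) := by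
  rw [jacobianForm, iteratedFDeriv_two_apply,
    h.curveSignedDist_add_smul (fun θ => by linarith [hR θ]) φ]
  rw [h.fderiv_fderiv_curveSignedDist hR hr]
  simp; left; ring

theorem periodic_norm_deriv (h : IsGaussCurve Γ) :
    Function.Periodic (fun θ => ‖deriv Γ θ‖) (2 * Real.pi) := fun θ => by
  have : (fun x => Γ (x + 2 * Real.pi)) = Γ := funext h.periodic
  change ‖deriv Γ (θ + 2 * Real.pi)‖ = ‖deriv Γ θ‖
  rw [← deriv_comp_add_const, this]

theorem exists_min_radius (h : IsGaussCurve Γ) : ∃ θ₀, ∀ θ, ‖deriv Γ θ₀‖ ≤ ‖deriv Γ θ‖ := by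
  obtain ⟨θ₀, -, hθ₀⟩ := isCompact_Icc.exists_isMinOn
    (nonempty_Icc.2 Real.two_pi_pos.le) h.contDiff_norm_deriv.continuous.continuousOn
  refine ⟨θ₀, fun θ => ?_⟩
  obtain ⟨ψ, hψ, e⟩ := h.periodic_norm_deriv.exists_mem_Ico₀ Real.two_pi_pos θ
  change ‖deriv Γ θ‖ = ‖deriv Γ ψ‖ at e
  rw [e]
  exact hθ₀ (Ico_subset_Icc_self hψ)

theorem exists_max_radius (h : IsGaussCurve Γ) : ∃ B, 0 < B ∧ ∀ θ, ‖deriv Γ θ‖ ≤ B := by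
  obtain ⟨B, hB⟩ := (h.periodic_norm_deriv.isBounded_of_continuous Real.two_pi_pos.ne'
    h.contDiff_norm_deriv.continuous).exists_norm_le
  have hB' : ∀ θ, ‖deriv Γ θ‖ ≤ B := fun θ => by simpa using hB _ ⟨θ, rfl⟩
  exact ⟨B, (h.norm_deriv_pos 0).trans_le (hB' 0), hB'⟩

/-- The lower bound of `I₂ + d ∇²d` on the tube, in terms of the radius of curvature. -/
theorem radius_bound_of_not_exitCondition (h : IsGaussCurve Γ) {D : Set Plane} {δ l : ℝ}
    (hD : convexHull ℝ (range Γ) ⊆ D) (hδ : 0 < δ) (hl : 0 < l) (he : ¬ exitCondition D δ l Γ)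
    (θ : ℝ) : 6 * δ ≤ ‖deriv Γ θ‖ ∧ ‖deriv Γ θ‖ - 3 * δ ≤ l * (‖deriv Γ θ‖ - 6 * δ) := by
  obtain ⟨θ₀, hθ₀⟩ := h.exists_min_radius
  set R := ‖deriv Γ θ₀‖ with hRdef
  have hR0 : 0 < R := h.norm_deriv_pos θ₀
  -- At depth `r` below the point of smallest radius `R` the tangential eigenvalue is `(R - 2r)/(R -
  -- r)`, and it must be at least `1/l`. The point belongs to the tube because the convex hull lies
  -- in `D`.
  have key : ∀ r, 0 < r → r < R → r < 3 * δ → R - r ≤ l * (R - 2 * r) := by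
    intro r h0 hrR hrδ
    have hsd := h.curveSignedDist_add_smul (r := -r) (fun θ => by linarith [hθ₀ θ]) θ₀
    have hx : Γ θ₀ + (-r) • unitNormal θ₀ ∈ tube D δ Γ := by
      refine ⟨hD ?_, ?_⟩
      · by_contra hn
        rw [curveSignedDist, if_neg hn] at hsd
        linarith [Metric.infDist_nonneg (x := Γ θ₀ + (-r) • unitNormal θ₀) (s := range Γ)]
      · rw [hsd, abs_neg, abs_of_pos h0]; exact hrδ
    have hj : ¬ jacobianForm Γ (Γ θ₀ + (-r) • unitNormal θ₀) (unitTangent θ₀) < 1 / l :=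
      fun hlt => he (Or.inr (Or.inr ⟨_, hx, _, norm_unitTangent θ₀, hlt⟩))
    rw [h.jacobianForm_eq hθ₀ (by linarith), inner_unitTangent_self, norm_unitTangent, not_lt,
      ← hRdef] at hj
    have hpos : 0 < R + -r := by linarith
    have e : (1 : ℝ) ^ 2 + -r * ((R + -r)⁻¹ * 1 ^ 2) = (R - 2 * r) / (R + -r) := by
      field_simp; ring
    rw [e, div_le_div_iff₀ hl hpos] at hj
    linarith
  -- If `R < 6δ`, a depth slightly larger than `R/2` would still be admissible, with negative
  -- eigenvalue.
  have h6 : 6 * δ ≤ R := by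
    by_contra hlt
    push Not at hlt
    have hm : R / 2 < min R (3 * δ) := lt_min (by linarith) (by linarith)
    obtain ⟨r, hr1, hr2⟩ := exists_between hm
    have := key r (by linarith) (hr2.trans_le (min_le_left _ _)) (hr2.trans_le (min_le_right _ _))
    nlinarith [hr2.trans_le (min_le_left R (3 * δ))]
  -- Passage to the limit `r → 3δ`, which is legitimate because the inequality is closed in `r`.
  have h3 : R - 3 * δ ≤ l * (R - 6 * δ) := by
    have hcl : IsClosed {r : ℝ | R - r ≤ l * (R - 2 * r)} :=
      isClosed_le (by fun_prop) (by fun_prop)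
    have hsub : Ioo 0 (3 * δ) ⊆ {r : ℝ | R - r ≤ l * (R - 2 * r)} :=
      fun r hr => key r hr.1 (by linarith [hr.2]) hr.2
    have := hcl.closure_subset_iff.2 hsub
    rw [closure_Ioo (by linarith)] at this
    have := this (right_mem_Icc.2 (by linarith))
    change R - 3 * δ ≤ l * (R - 2 * (3 * δ)) at this
    linarith
  -- For `l > 1` the inequality is monotone in the radius and passes from the smallest radius to all
  -- others.
  have hl1 : 1 < l := by
    by_contra hle
    push Not at hle
    nlinarith
  have := hθ₀ θ
  exact ⟨h6.trans this, by nlinarith⟩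

/-- Converse of the previous bound: the normal eigenvalue is `1`, and the tangential one, `(ρ +
2r)/(ρ + r)`, increases in `r`, so the worst case is `r = -3δ`. The geometric constraint on a nearby
curve thus reduces to an inequality for its radii. -/
theorem le_jacobianForm (h : IsGaussCurve Γ) {D : Set Plane} {δ L : ℝ} (hδ : 0 < δ) (hL : 1 ≤ L)
    (hρ : ∀ θ, 6 * δ ≤ ‖deriv Γ θ‖ ∧ ‖deriv Γ θ‖ - 3 * δ ≤ L * (‖deriv Γ θ‖ - 6 * δ))
    {x ξ : Plane} (hx : x ∈ tube D δ Γ) (hξ : ‖ξ‖ = 1) : 1 / L ≤ jacobianForm Γ x ξ := by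
  obtain ⟨φ, -, hφ⟩ := h.exists_normal_coordinate (fun θ => (hρ θ).1)
    (hx.2.trans (by linarith : 3 * δ < 6 * δ))
  set r := curveSignedDist Γ x
  have hr := abs_lt.1 hx.2
  rw [← hφ, h.jacobianForm_eq (fun θ => (hρ θ).1) (by linarith), hξ]
  obtain ⟨h1, h2⟩ := hρ φ
  set ρ := ‖deriv Γ φ‖
  have ht : inner ℝ ξ (unitTangent φ) ^ 2 ≤ 1 := by
    have := abs_real_inner_le_norm ξ (unitTangent φ)
    rw [hξ, norm_unitTangent, one_mul] at this
    exact (sq_le_one_iff_abs_le_one _).2 this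
  set a := inner ℝ ξ (unitTangent φ) ^ 2
  have ha : 0 ≤ a := sq_nonneg _
  have hpos : 0 < ρ + r := by linarith
  have e : (1 : ℝ) ^ 2 + r * ((ρ + r)⁻¹ * a) = ((ρ + r) + r * a) / (ρ + r) := by field_simp
  have hr1 : -(3 * δ) ≤ r := hr.1.le
  rw [e, div_le_div_iff₀ (by linarith) hpos]
  rcases le_total 0 r with h0 | h0
  · nlinarith [mul_nonneg h0 ha]
  · nlinarith [mul_nonneg (neg_nonneg.2 h0) (sub_nonneg.2 ht), mul_nonneg (by linarith : 0 ≤ L - 1) (by linarith : 0 ≤ r + 3 * δ)]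

end IsGaussCurve

/-! ### Curvature through the signed distance, and stability of the curve -/

namespace IsGaussCurve

variable {Γ Γ₀ : ℝ → Plane}

theorem contDiffAt_curveSignedDist_apply (h : IsGaussCurve Γ) (θ : ℝ) :
    ContDiffAt ℝ ∞ (curveSignedDist Γ) (Γ θ) := by
  obtain ⟨θ₀, hθ₀⟩ := h.exists_min_radius
  simpa using h.contDiffAt_curveSignedDist hθ₀ (r := 0) (by linarith [h.norm_deriv_pos θ₀]) θ

theorem fderiv_curveSignedDist_apply (h : IsGaussCurve Γ) (θ : ℝ) :
    fderiv ℝ (curveSignedDist Γ) (Γ θ) = innerSL ℝ (unitNormal θ) := by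
  obtain ⟨θ₀, hθ₀⟩ := h.exists_min_radius
  simpa using h.fderiv_curveSignedDist hθ₀ (r := 0) (by linarith [h.norm_deriv_pos θ₀]) θ

theorem fderiv_fderiv_curveSignedDist_apply (h : IsGaussCurve Γ) (θ : ℝ) (x y : Plane) :
    fderiv ℝ (fderiv ℝ (curveSignedDist Γ)) (Γ θ) x y
      = ‖deriv Γ θ‖⁻¹ * inner ℝ x (unitTangent θ) * inner ℝ y (unitTangent θ) := by
  obtain ⟨θ₀, hθ₀⟩ := h.exists_min_radius
  simpa using h.fderiv_fderiv_curveSignedDist hθ₀ (r := 0) (by linarith [h.norm_deriv_pos θ₀]) θ x y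

theorem curvature_eq (h : IsGaussCurve Γ) (θ : ℝ) : curvature Γ θ
    = iteratedFDeriv ℝ 2 (curveSignedDist Γ) (Γ θ) ![unitTangent θ, unitTangent θ] := by
  rw [iteratedFDeriv_two_apply]
  refine Eq.trans ?_ (h.fderiv_fderiv_curveSignedDist_apply θ (unitTangent θ) (unitTangent θ)).symm
  rw [inner_unitTangent_self, curvature]
  ring

theorem hasDerivAt_iteratedFDeriv_apply (h : IsGaussCurve Γ) {m : ℕ} (e : Fin m → Plane) (θ : ℝ) :
    HasDerivAt (fun θ => iteratedFDeriv ℝ m (curveSignedDist Γ) (Γ θ) e)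
      (‖deriv Γ θ‖ * iteratedFDeriv ℝ (m + 1) (curveSignedDist Γ) (Γ θ)
        (Fin.cons (unitTangent θ) e)) θ := by
  have h1 : HasFDerivAt (iteratedFDeriv ℝ m (curveSignedDist Γ)) _ (Γ θ) :=
    (((h.contDiffAt_curveSignedDist_apply θ).iteratedFDeriv_right (m := 1) (i := m)
      (by norm_cast; simp)).differentiableAt (by simp)).hasFDerivAt
  have h2 := h1.comp_hasDerivAt θ (h.hasDerivAt θ)
  have h3 := ((ContinuousMultilinearMap.apply ℝ (fun _ : Fin m => Plane) ℝ e).hasFDerivAt).comp_hasDerivAt θ h2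
  refine h3.congr_deriv ?_
  simp [iteratedFDeriv_succ_apply_left]

/-- In the derivative of `κ = ∇²d(e, e)` the terms from the rotation of `e` vanish, because `e' =
-n` lies in the kernel of `∇²d`. Only the third derivative of `d` along the curve is left. -/
theorem deriv_curvature_eq (h : IsGaussCurve Γ) (θ : ℝ) : deriv (curvature Γ) θ
    = ‖deriv Γ θ‖ * iteratedFDeriv ℝ 3 (curveSignedDist Γ) (Γ θ)
        ![unitTangent θ, unitTangent θ, unitTangent θ] := by
  set D2 := fderiv ℝ (fderiv ℝ (curveSignedDist Γ)) with hD2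
  have hκ : curvature Γ = fun θ => D2 (Γ θ) (unitTangent θ) (unitTangent θ) := by
    funext θ
    rw [hD2, h.fderiv_fderiv_curveSignedDist_apply, inner_unitTangent_self, curvature]
    ring
  have h1 : HasFDerivAt D2 (fderiv ℝ D2 (Γ θ)) (Γ θ) :=
    ((((h.contDiffAt_curveSignedDist_apply θ).fderiv_right (m := 2)
      (by norm_cast)).fderiv_right (m := 1) (by norm_cast)).differentiableAt (by simp)).hasFDerivAt
  have hc := HasFDerivAt.comp_hasDerivAt (F := Plane) (E := Plane →L[ℝ] Plane →L[ℝ] ℝ) θ h1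
    (h.hasDerivAt θ)
  have h2 : HasDerivAt (curvature Γ)
      (fderiv ℝ D2 (Γ θ) (‖deriv Γ θ‖ • unitTangent θ) (unitTangent θ) (unitTangent θ)) θ := by
    rw [hκ]
    refine ((hc.clm_apply (hasDerivAt_unitTangent θ)).clm_apply
      (hasDerivAt_unitTangent θ)).congr_deriv ?_
    have e1 : D2 (Γ θ) (-unitNormal θ) (unitTangent θ) = 0 := by
      rw [hD2, h.fderiv_fderiv_curveSignedDist_apply, inner_neg_left,
        inner_unitNormal_unitTangent]
      simp
    have e2 : D2 (Γ θ) (unitTangent θ) (-unitNormal θ) = 0 := by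
      rw [hD2, h.fderiv_fderiv_curveSignedDist_apply, inner_neg_left,
        inner_unitNormal_unitTangent]
      simp
    simp only [Function.comp_apply, add_apply, e1, e2, add_zero]
  have h3 := h.hasDerivAt_iteratedFDeriv_apply ![unitTangent θ, unitTangent θ] θ
  have h4 : HasDerivAt (fun φ => iteratedFDeriv ℝ 2 (curveSignedDist Γ) (Γ φ)
      ![unitTangent θ, unitTangent θ])
      (fderiv ℝ D2 (Γ θ) (‖deriv Γ θ‖ • unitTangent θ) (unitTangent θ) (unitTangent θ)) θ := by
    have e : (fun φ => iteratedFDeriv ℝ 2 (curveSignedDist Γ) (Γ φ)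
      ![unitTangent θ, unitTangent θ]) = fun φ => D2 (Γ φ) (unitTangent θ) (unitTangent θ) :=
      funext fun φ => iteratedFDeriv_two_apply _ _ _
    rw [e]
    refine ((hc.clm_apply (hasDerivAt_const θ (unitTangent θ))).clm_apply
      (hasDerivAt_const θ (unitTangent θ))).congr_deriv ?_
    simp only [Function.comp_apply, map_zero, add_zero]
  exact h2.deriv.trans (h4.unique h3)

/-- The gradients at the two points are the two normals. Testing their difference on `v = n(θ) -
n(φ)` itself produces `‖v‖²`. -/
theorem norm_unitNormal_sub_le_iteratedFDeriv (h : IsGaussCurve Γ) (h₀ : IsGaussCurve Γ₀)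
    (θ φ : ℝ) : ‖unitNormal θ - unitNormal φ‖ ≤ ‖iteratedFDeriv ℝ 1 (curveSignedDist Γ) (Γ θ)
      - iteratedFDeriv ℝ 1 (curveSignedDist Γ₀) (Γ₀ φ)‖ := by
  set v := unitNormal θ - unitNormal φ with hv
  have h1 := (iteratedFDeriv ℝ 1 (curveSignedDist Γ) (Γ θ)
      - iteratedFDeriv ℝ 1 (curveSignedDist Γ₀) (Γ₀ φ)).le_opNorm ![v]
  rw [sub_apply, iteratedFDeriv_one_apply, iteratedFDeriv_one_apply,
    h.fderiv_curveSignedDist_apply, h₀.fderiv_curveSignedDist_apply] at h1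
  simp only [Finset.univ_unique, Finset.prod_singleton, innerSL_apply_apply, Matrix.cons_val_fin_one,
    ← inner_sub_left, ← hv, real_inner_self_eq_norm_sq, norm_pow, norm_norm] at h1
  rcases (norm_nonneg v).eq_or_lt with h0 | h0
  · rw [← h0]; positivity
  · nlinarith

theorem exists_norm_sub_le (h : IsGaussCurve Γ) : ∃ B, 0 < B ∧
    ∀ θ φ, ‖Γ θ - Γ φ‖ ≤ B * ‖unitNormal θ - unitNormal φ‖ := by
  obtain ⟨B, hB0, hB⟩ := h.exists_max_radius
  refine ⟨B * (Real.pi / 2), by positivity, fun θ φ => ?_⟩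
  obtain ⟨k, hk⟩ := exists_zsmul_near θ φ
  rw [← h.periodic.sub_zsmul_eq k, ← periodic_unitNormal.sub_zsmul_eq (x := θ) k]
  have h1 := Convex.norm_image_sub_le_of_norm_deriv_le (s := univ) (f := Γ) (C := B)
    (fun x _ => h.smooth.differentiable (by simp) x) (fun x _ => hB x) convex_univ
    (mem_univ φ) (mem_univ (θ - k • (2 * Real.pi)))
  rw [Real.norm_eq_abs] at h1
  have h2 := abs_sub_le_norm_unitNormal_sub hk
  calc _ ≤ _ := h1
    _ ≤ B * (Real.pi / 2 * _) := by gcongr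
    _ = _ := by ring

theorem exists_uniform_iteratedFDeriv (h : IsGaussCurve Γ) (m₀ : ℕ) {ζ : ℝ} (hζ : 0 < ζ) :
    ∃ η > 0, ∀ m ≤ m₀, ∀ θ y, dist (Γ θ) y < η →
      ‖iteratedFDeriv ℝ m (curveSignedDist Γ) y
        - iteratedFDeriv ℝ m (curveSignedDist Γ) (Γ θ)‖ < ζ := by
  have key : ∀ m, ∃ η > 0, ∀ θ y, dist (Γ θ) y < η →
      ‖iteratedFDeriv ℝ m (curveSignedDist Γ) y
        - iteratedFDeriv ℝ m (curveSignedDist Γ) (Γ θ)‖ < ζ := fun m => by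
    have hu := h.isCompact_range.uniformContinuousAt_of_continuousAt
      (iteratedFDeriv ℝ m (curveSignedDist Γ)) (fun a ha => by
        obtain ⟨θ, rfl⟩ := ha
        exact ((h.contDiffAt_curveSignedDist_apply θ).iteratedFDeriv_right (m := 0) (i := m)
          (by norm_cast; simp)).continuousAt) (Metric.dist_mem_uniformity hζ)
    obtain ⟨η, hη, H⟩ := Metric.mem_uniformity_dist.1 hu
    refine ⟨η, hη, fun θ y hy => ?_⟩
    have := H hy ⟨θ, rfl⟩
    rwa [mem_ofPred_eq, dist_comm, dist_eq_norm] at this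
  choose η hη H using key
  refine ⟨(Finset.range (m₀ + 1)).inf' Finset.nonempty_range_add_one η, ?_, fun m hm θ y hy => H m θ y ?_⟩
  · exact (Finset.lt_inf'_iff _).2 fun m _ => hη m
  · exact hy.trans_le (Finset.inf'_le _ (Finset.mem_range.2 (by omega)))

theorem exists_bound_iteratedFDeriv (h : IsGaussCurve Γ) (m₀ : ℕ) :
    ∃ B > 0, ∀ m ≤ m₀, ∀ θ, ‖iteratedFDeriv ℝ m (curveSignedDist Γ) (Γ θ)‖ ≤ B := by
  have key : ∀ m, ∃ B, ∀ θ, ‖iteratedFDeriv ℝ m (curveSignedDist Γ) (Γ θ)‖ ≤ B := fun m => by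
    obtain ⟨B, hB⟩ := h.isCompact_range.exists_bound_of_continuousOn
      (f := iteratedFDeriv ℝ m (curveSignedDist Γ)) (fun a ha => by
        obtain ⟨θ, rfl⟩ := ha
        exact ((h.contDiffAt_curveSignedDist_apply θ).iteratedFDeriv_right (m := 0) (i := m)
          (by norm_cast; simp)).continuousAt.continuousWithinAt)
    exact ⟨B, fun θ => hB _ ⟨θ, rfl⟩⟩
  choose B hB using key
  refine ⟨1 + ∑ m ∈ Finset.range (m₀ + 1), |B m|, by positivity, fun m hm θ => ?_⟩
  have := Finset.single_le_sum (f := fun m => |B m|) (fun i _ => abs_nonneg _)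
    (Finset.mem_range.2 (by omega : m < m₀ + 1))
  linarith [hB m θ, le_abs_self (B m)]

end IsGaussCurve

/-- `Γ` lies in the neighbourhood `O` of `Γ₀`, within distance `η` from `Γ₀`, and the signed
distances of the two curves differ by at most `η` in `C^{m₀}(O)`. -/
structure IsDistClose (O : Set Plane) (m₀ : ℕ) (η : ℝ) (Γ₀ Γ : ℝ → Plane) : Prop where
  mem : ∀ θ, Γ θ ∈ O
  infDist_le : ∀ θ, Metric.infDist (Γ θ) (range Γ₀) ≤ η
  dist_le : ∀ m ≤ m₀, ∀ x ∈ O, ‖iteratedFDeriv ℝ m (curveSignedDist Γ) x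
    - iteratedFDeriv ℝ m (curveSignedDist Γ₀) x‖ ≤ η

/-- Curves with `C^{m₀}`-close signed distances are close in the Gauss parametrization. -/
theorem IsGaussCurve.exists_stability {Γ₀ : ℝ → Plane} (h₀ : IsGaussCurve Γ₀) {m₀ : ℕ}
    (hm₀ : 1 ≤ m₀) {ζ : ℝ} (hζ : 0 < ζ) : ∃ η > 0, ∀ O Γ, IsGaussCurve Γ →
      IsDistClose O m₀ η Γ₀ Γ → ∀ θ, ‖Γ θ - Γ₀ θ‖ ≤ ζ ∧ ∀ m ≤ m₀,
        ‖iteratedFDeriv ℝ m (curveSignedDist Γ) (Γ θ)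
          - iteratedFDeriv ℝ m (curveSignedDist Γ₀) (Γ₀ θ)‖ ≤ ζ := by
  obtain ⟨B, hB0, hB⟩ := h₀.exists_norm_sub_le
  obtain ⟨η₁, hη₁, H₁⟩ := h₀.exists_uniform_iteratedFDeriv m₀ (half_pos hζ)
  set ζ' := min (ζ / 2) (η₁ / 2) with hζ'
  have hζ'0 : 0 < ζ' := by positivity
  obtain ⟨η₂, hη₂, H₂⟩ := h₀.exists_uniform_iteratedFDeriv m₀ (ζ := ζ' / (2 * B)) (by positivity)
  set η := min (min (ζ' / 2) (η₂ / 2)) (min (ζ' / (4 * B)) (ζ / 2)) with hη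
  have e1 : η ≤ ζ' / 2 := (min_le_left _ _).trans (min_le_left _ _)
  have e2 : η ≤ η₂ / 2 := (min_le_left _ _).trans (min_le_right _ _)
  have e3 : η ≤ ζ' / (4 * B) := (min_le_right _ _).trans (min_le_left _ _)
  have e4 : η ≤ ζ / 2 := (min_le_right _ _).trans (min_le_right _ _)
  refine ⟨η, by positivity, fun O Γ hΓ hc θ => ?_⟩
  -- The point of `Γ₀` nearest to `Γ θ` has a parameter `φ` that may differ from `θ`. Comparing
  -- gradients shows that `n(φ)` is close to `n(θ)`, hence that `Γ₀ φ` is close to `Γ₀ θ`.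
  obtain ⟨_, ⟨φ, rfl⟩, hφ⟩ := h₀.isCompact_range.exists_infDist_eq_dist (range_nonempty Γ₀) (Γ θ)
  have hd : dist (Γ₀ φ) (Γ θ) ≤ η := by rw [dist_comm, ← hφ]; exact hc.infDist_le θ
  have hn : ‖unitNormal θ - unitNormal φ‖ ≤ η + ζ' / (2 * B) := by
    refine (hΓ.norm_unitNormal_sub_le_iteratedFDeriv h₀ θ φ).trans ?_
    refine (norm_sub_le_norm_sub_add_norm_sub _
      (iteratedFDeriv ℝ 1 (curveSignedDist Γ₀) (Γ θ)) _).trans ?_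
    exact add_le_add (hc.dist_le 1 hm₀ _ (hc.mem θ)) (H₂ 1 hm₀ φ (Γ θ) (by linarith)).le
  have hΓ₀ : ‖Γ₀ φ - Γ₀ θ‖ ≤ 3 / 4 * ζ' := by
    rw [norm_sub_rev]
    calc _ ≤ _ := hB θ φ
      _ ≤ B * (ζ' / (4 * B) + ζ' / (2 * B)) := by gcongr; linarith
      _ = _ := by field_simp; norm_num
  have hclose : ‖Γ θ - Γ₀ θ‖ ≤ 5 / 4 * ζ' := by
    have := norm_sub_le_norm_sub_add_norm_sub (Γ θ) (Γ₀ φ) (Γ₀ θ)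
    rw [dist_comm, dist_eq_norm] at hd
    linarith
  have z1 : ζ' ≤ ζ / 2 := min_le_left _ _
  have z2 : ζ' ≤ η₁ / 2 := min_le_right _ _
  refine ⟨by linarith, fun m hm => ?_⟩
  refine (norm_sub_le_norm_sub_add_norm_sub _
      (iteratedFDeriv ℝ m (curveSignedDist Γ₀) (Γ θ)) _).trans ?_
  have h1 := hc.dist_le m hm _ (hc.mem θ)
  have h2 := H₁ m hm θ (Γ θ) (by rw [dist_comm, dist_eq_norm]; linarith)
  linarith

theorem IsGaussCurve.exists_curvature_stability {Γ₀ : ℝ → Plane} (h₀ : IsGaussCurve Γ₀) {m₀ : ℕ}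
    (hm₀ : 3 ≤ m₀) {ζ : ℝ} (hζ : 0 < ζ) : ∃ η > 0, ∀ O Γ, IsGaussCurve Γ →
      IsDistClose O m₀ η Γ₀ Γ → ∀ θ, ‖Γ θ - Γ₀ θ‖ ≤ ζ ∧
        |‖deriv Γ θ‖ - ‖deriv Γ₀ θ‖| ≤ ζ ∧ |curvature Γ θ - curvature Γ₀ θ| ≤ ζ ∧
        |deriv (curvature Γ) θ - deriv (curvature Γ₀) θ| ≤ ζ ∧ ∀ m ≤ m₀,
        ‖iteratedFDeriv ℝ m (curveSignedDist Γ) (Γ θ)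
          - iteratedFDeriv ℝ m (curveSignedDist Γ₀) (Γ₀ θ)‖ ≤ ζ := by
  obtain ⟨B, hB0, hB⟩ := h₀.exists_max_radius
  obtain ⟨A, hA0, hA⟩ := h₀.exists_bound_iteratedFDeriv m₀
  set W := 2 * B ^ 2 * (A + 1) + B + 2 * B ^ 2 + 1 with hW
  have hW1 : 1 ≤ W := by rw [hW]; nlinarith [sq_nonneg B, mul_nonneg (sq_nonneg B) hA0.le]
  -- The bound `z ≤ 1/(2B)` keeps `κ ≥ 1/(2B)`, hence `ρ ≤ 2B`, when `κ` changes by `z`. The number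
  -- `W` dominates the factors with which an error `z` in the jets of the distance enters `ρ` and
  -- `∂_θ κ`.
  set z := min (min (1 / (2 * B)) 1) (ζ / W) with hz
  have z0 : 0 < z := by positivity
  have z1 : z ≤ 1 / (2 * B) := (min_le_left _ _).trans (min_le_left _ _)
  have z2 : z ≤ 1 := (min_le_left _ _).trans (min_le_right _ _)
  have z3 : z * W ≤ ζ := (le_div_iff₀ (by positivity)).1 (min_le_right _ _)
  have hzζ : z ≤ ζ := le_trans (by nlinarith) z3
  obtain ⟨η, hη, H⟩ := h₀.exists_stability (by omega : 1 ≤ m₀) z0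
  refine ⟨η, hη, fun O Γ hΓ hc θ => ?_⟩
  obtain ⟨hΓθ, hD⟩ := H O Γ hΓ hc θ
  have hκ : |curvature Γ θ - curvature Γ₀ θ| ≤ z := by
    rw [hΓ.curvature_eq, h₀.curvature_eq, ← sub_apply, ← Real.norm_eq_abs]
    refine (ContinuousMultilinearMap.le_opNorm _ _).trans ?_
    simpa [Fin.prod_univ_two] using hD 2 (by omega)
  set ρ := ‖deriv Γ θ‖ with hρ
  set ρ₀ := ‖deriv Γ₀ θ‖ with hρ₀
  have hρpos : 0 < ρ := hΓ.norm_deriv_pos θ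
  have hρ₀pos : 0 < ρ₀ := h₀.norm_deriv_pos θ
  have hκρ : |ρ⁻¹ - ρ₀⁻¹| ≤ z := hκ
  have hρB : ρ ≤ 2 * B := by
    have h1 : 1 / B ≤ ρ₀⁻¹ := by
      rw [one_div]; exact inv_anti₀ hρ₀pos (hB θ)
    have h2 := (abs_le.1 hκρ).1
    have h3 : 1 / (2 * B) ≤ ρ⁻¹ := by
      have : 1 / B = 1 / (2 * B) + 1 / (2 * B) := by field_simp; norm_num
      linarith
    rw [one_div] at h3
    exact (inv_le_inv₀ (by positivity) hρpos).1 h3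
  have hρd : |ρ - ρ₀| ≤ z * (2 * B ^ 2) := by
    have e : ρ - ρ₀ = -(ρ⁻¹ - ρ₀⁻¹) * (ρ * ρ₀) := by field_simp; ring
    rw [e, abs_mul, abs_neg, abs_of_pos (mul_pos hρpos hρ₀pos)]
    have : ρ * ρ₀ ≤ 2 * B * B := mul_le_mul hρB (hB θ) hρ₀pos.le (by positivity)
    calc _ ≤ z * (2 * B * B) := mul_le_mul hκρ this (by positivity) z0.le
      _ = _ := by ring
  refine ⟨hΓθ.trans hzζ, hρd.trans ?_, hκ.trans hzζ, ?_, fun m hm => (hD m hm).trans hzζ⟩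
  · refine le_trans (mul_le_mul_of_nonneg_left ?_ z0.le) z3
    rw [hW]; nlinarith [mul_nonneg (sq_nonneg B) hA0.le]
  · rw [hΓ.deriv_curvature_eq, h₀.deriv_curvature_eq, ← hρ, ← hρ₀]
    set v := ![unitTangent θ, unitTangent θ, unitTangent θ]
    have hv : ∀ f : Plane [×3]→L[ℝ] ℝ, |f v| ≤ ‖f‖ := fun f => by
      simpa [Fin.prod_univ_three, v] using f.le_opNorm v
    set a := iteratedFDeriv ℝ 3 (curveSignedDist Γ) (Γ θ)
    set a₀ := iteratedFDeriv ℝ 3 (curveSignedDist Γ₀) (Γ₀ θ)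
    have h1 : |a v - a₀ v| ≤ z := (hv (a - a₀)).trans (hD 3 hm₀)
    have h2 : |a₀ v| ≤ A := (hv a₀).trans (hA 3 hm₀ θ)
    have e : ρ * a v - ρ₀ * a₀ v = (ρ - ρ₀) * (a v) + ρ₀ * (a v - a₀ v) := by ring
    have h3 : |a v| ≤ A + 1 := by
      have := abs_add_le (a v - a₀ v) (a₀ v)
      rw [sub_add_cancel] at this
      linarith
    rw [e]
    calc _ ≤ |(ρ - ρ₀) * (a v)| + |ρ₀ * (a v - a₀ v)| := abs_add_le _ _
      _ = |ρ - ρ₀| * |a v| + ρ₀ * |a v - a₀ v| := by rw [abs_mul, abs_mul, abs_of_pos hρ₀pos]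
      _ ≤ z * (2 * B ^ 2) * (A + 1) + B * z := by
        gcongr
        exact hB θ
      _ ≤ z * W := by
        have h6 : 0 ≤ z * (2 * B ^ 2 + 1) := by positivity
        rw [hW]
        linarith
      _ ≤ ζ := z3

theorem IsGaussCurve.not_exitCondition_of_close {Γ₀ Γ : ℝ → Plane} (h₀ : IsGaussCurve Γ₀)
    (hΓ : IsGaussCurve Γ) {D : Set Plane} {δ l L ζ : ℝ} (hD : convexHull ℝ (range Γ₀) ⊆ D)
    (hδ : 0 < δ) (hl : 0 < l) (hL : 1 ≤ L) (he : ¬ exitCondition D δ l Γ₀) (hζ : 0 < ζ)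
    (h1 : ζ ≤ L - l) (h2 : ζ ≤ 1 / l - 1 / L) (h3 : ζ * (l * L) ≤ (L - l) * (3 * δ))
    (h6 : ∀ θ, 6 * δ ≤ ‖deriv Γ θ‖)
    (hc : ∀ θ, ‖Γ θ - Γ₀ θ‖ ≤ ζ ∧
        |‖deriv Γ θ‖ - ‖deriv Γ₀ θ‖| ≤ ζ ∧ |curvature Γ θ - curvature Γ₀ θ| ≤ ζ ∧
        |deriv (curvature Γ) θ - deriv (curvature Γ₀) θ| ≤ ζ) : ¬ exitCondition D δ L Γ := by
  have hrad := h₀.radius_bound_of_not_exitCondition hD hδ hl he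
  simp only [exitCondition, not_or, not_exists, not_and, not_lt] at he ⊢
  obtain ⟨e1, e2, -⟩ := he
  refine ⟨fun θ => ?_, fun θ y hy => ?_, fun x hx ξ hξ => ?_⟩
  · obtain ⟨a1, a2, a3⟩ := e1 θ
    obtain ⟨-, b2, b3, b4⟩ := hc θ
    rw [curvature, inv_inv] at a2
    refine ⟨by linarith [(abs_le.1 b3).2], ?_, ?_⟩
    · rw [curvature, inv_inv]; linarith [(abs_le.1 b2).2]
    · have := abs_sub_abs_le_abs_sub (deriv (curvature Γ) θ) (deriv (curvature Γ₀) θ)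
      linarith
  · have a := e2 θ y hy
    have b := (hc θ).1
    rw [← dist_eq_norm] at b
    have := dist_triangle_left (Γ₀ θ) y (Γ θ)
    linarith
  · refine hΓ.le_jacobianForm hδ hL (fun θ => ⟨h6 θ, ?_⟩) hx hξ
    obtain ⟨c1, c2⟩ := hrad θ
    have b2 := (abs_le.1 (hc θ).2.1).1
    set ρ := ‖deriv Γ θ‖
    set ρ₀ := ‖deriv Γ₀ θ‖
    -- Passing from level `l` to level `L` leaves the slack `(L - l)(ρ₀ - 6δ)` in the radius
    -- inequality. The smallness of `ζ` makes the perturbation, at most `ζ L`, fit into it.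
    have c3 : 3 * δ ≤ l * (ρ₀ - 6 * δ) := by linarith
    have c4 : (L - l) * (3 * δ) ≤ l * ((L - l) * (ρ₀ - 6 * δ)) := by nlinarith
    have c5 : ζ * L ≤ (L - l) * (ρ₀ - 6 * δ) := by
      have : l * (ζ * L) ≤ l * ((L - l) * (ρ₀ - 6 * δ)) := by linarith
      exact le_of_mul_le_mul_left this hl
    nlinarith

/-- Near `Γ₀` the geometry of a curve is controlled by constants which depend on `Γ₀` only. -/
theorem IsGaussCurve.exists_barrier {Γ₀ : ℝ → Plane} (h₀ : IsGaussCurve Γ₀) {D : Set Plane} {δ : ℝ}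
    (hD : convexHull ℝ (range Γ₀) ⊆ D) (hδ : 0 < δ)
    (he : ∃ l : ℝ, 0 < l ∧ ¬ exitCondition D δ l Γ₀) {m₀ : ℕ} (hm₀ : 3 ≤ m₀) :
    ∃ B > 0, ∀ L : ℕ, ∃ η > 0, ∀ O Γ, IsGaussCurve Γ → IsDistClose O m₀ η Γ₀ Γ →
      (∀ θ, 6 * δ ≤ ‖deriv Γ θ‖ ∧ ‖deriv Γ θ‖ ≤ B ∧ ‖Γ θ‖ ≤ B ∧
        ∀ m ≤ m₀, ‖iteratedFDeriv ℝ m (curveSignedDist Γ) (Γ θ)‖ ≤ B) ∧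
      ((∃ l : ℝ, 0 < l ∧ l < L ∧ ¬ exitCondition D δ l Γ₀) → ¬ exitCondition D δ L Γ) := by
  obtain ⟨l₀, hl₀, he₀⟩ := he
  have hrad := h₀.radius_bound_of_not_exitCondition hD hδ hl₀ he₀
  obtain ⟨B₁, hB₁, H₁⟩ := h₀.exists_max_radius
  obtain ⟨B₂, hB₂, H₂⟩ := h₀.exists_bound_iteratedFDeriv m₀
  obtain ⟨B₃, H₃⟩ := h₀.isCompact_range.isBounded.exists_norm_le
  have H₃' : ∀ θ, ‖Γ₀ θ‖ ≤ B₃ := fun θ => H₃ _ ⟨θ, rfl⟩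
  have hB₃ : 0 ≤ B₃ := (norm_nonneg _).trans (H₃' 0)
  refine ⟨B₁ + B₂ + B₃ + 1, by positivity, fun L => ?_⟩
  -- The condition `ζ l₀ ≤ 3δ` keeps the radii above `6δ`, since `l₀ (ρ₀ - 6δ) ≥ 3δ`. The conditions
  -- involving `L` matter only if `γ₀` satisfies the constraints strictly. Only `ζ` and `η` depend
  -- on `L`, while the bound on the geometry was fixed before.
  obtain ⟨ζ, hζ, z1, z2, z3⟩ : ∃ ζ > 0, ζ ≤ 1 ∧ ζ * l₀ ≤ 3 * δ ∧
      ((∃ l : ℝ, 0 < l ∧ l < L ∧ ¬ exitCondition D δ l Γ₀) → ∃ l : ℝ, 0 < l ∧ l < L ∧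
        ¬ exitCondition D δ l Γ₀ ∧ ζ ≤ L - l ∧ ζ ≤ 1 / l - 1 / L ∧
          ζ * (l * L) ≤ (L - l) * (3 * δ)) := by
    have hb : 0 < min 1 (3 * δ / l₀) := by positivity
    have hb2 : min 1 (3 * δ / l₀) * l₀ ≤ 3 * δ := by
      rw [← le_div_iff₀ hl₀]; exact min_le_right _ _
    by_cases hs : ∃ l : ℝ, 0 < l ∧ l < L ∧ ¬ exitCondition D δ l Γ₀
    · obtain ⟨l, hl, hlL, hel⟩ := hs
      have hL : (0 : ℝ) < L := hl.trans hlL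
      have p1 : 0 < (L : ℝ) - l := sub_pos.2 hlL
      have p2 : 0 < 1 / l - 1 / L := sub_pos.2 (one_div_lt_one_div_of_lt hl hlL)
      set z := min (min (L - l) (1 / l - 1 / L)) ((L - l) * (3 * δ) / (l * L))
      have hz : 0 < z := by positivity
      refine ⟨min (min 1 (3 * δ / l₀)) z, lt_min hb hz,
        (min_le_left _ _).trans (min_le_left _ _), ?_, fun _ => ⟨l, hl, hlL, hel, ?_, ?_, ?_⟩⟩
      · exact le_trans (mul_le_mul_of_nonneg_right (min_le_left _ _) hl₀.le) hb2
      · exact (min_le_right _ _).trans ((min_le_left _ _).trans (min_le_left _ _))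
      · exact (min_le_right _ _).trans ((min_le_left _ _).trans (min_le_right _ _))
      · rw [← le_div_iff₀ (by positivity)]
        exact (min_le_right _ _).trans (min_le_right _ _)
    · exact ⟨_, hb, min_le_left _ _, hb2, fun h => (hs h).elim⟩
  obtain ⟨η, hη, H⟩ := h₀.exists_curvature_stability hm₀ hζ
  refine ⟨η, hη, fun O Γ hΓ hc => ?_⟩
  have hcl := H O Γ hΓ hc
  have h6 : ∀ θ, 6 * δ ≤ ‖deriv Γ θ‖ := fun θ => by
    obtain ⟨c1, c2⟩ := hrad θ
    have b2 := (abs_le.1 (hcl θ).2.1).1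
    have : l₀ * ζ ≤ l₀ * (‖deriv Γ₀ θ‖ - 6 * δ) := by linarith
    linarith [le_of_mul_le_mul_left this hl₀]
  refine ⟨fun θ => ⟨h6 θ, ?_, ?_, fun m hm => ?_⟩, fun hs => ?_⟩
  · linarith [H₁ θ, (abs_le.1 (hcl θ).2.1).2]
  · linarith [H₃' θ, norm_le_norm_add_norm_sub' (Γ θ) (Γ₀ θ), (hcl θ).1]
  · linarith [H₂ m hm θ, norm_le_norm_add_norm_sub' (iteratedFDeriv ℝ m (curveSignedDist Γ) (Γ θ))
      (iteratedFDeriv ℝ m (curveSignedDist Γ₀) (Γ₀ θ)), (hcl θ).2.2.2.2 m hm]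
  · obtain ⟨l, hl, hlL, hel, y1, y2, y3⟩ := z3 hs
    have hL : (1 : ℝ) ≤ L := by
      have : 0 < L := by exact_mod_cast hl.trans hlL
      exact_mod_cast this
    exact h₀.not_exitCondition_of_close hΓ hD hδ hl hL hel hζ y1 y2 y3 h6
      fun θ => ⟨(hcl θ).1, (hcl θ).2.1, (hcl θ).2.2.1, (hcl θ).2.2.2.1⟩

/-- A moving curve cannot leave a neighbourhood of its initial position in which the signed
distance stays close to the initial one. -/
theorem infDist_le_of_curveSignedDist_close {X : ℝ → ℝ → Plane} {T η r : ℝ} {O : Set Plane}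
    (hX : ∀ θ, ContinuousOn (fun t => X t θ) (Icc 0 T)) (hr : Metric.thickening r (range (X 0)) ⊆ O)
    (hη : η < r) (hη0 : 0 ≤ η)
    (hd : ∀ t ∈ Icc 0 T, ∀ x ∈ O, |curveSignedDist (X t) x - curveSignedDist (X 0) x| ≤ η)
    {t : ℝ} (ht : t ∈ Icc 0 T) (θ : ℝ) : Metric.infDist (X t θ) (range (X 0)) ≤ η := by
  by_contra hlt
  push Not at hlt
  -- Otherwise the distance from the initial curve takes a value `c` with `η < c < r` at an earlier
  -- time. The point is then still in `O`, where the vanishing of its own signed distance forces a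
  -- distance at most `η`.
  obtain ⟨c, hc1, hc2⟩ := exists_between (lt_min hη hlt)
  have hq : ContinuousOn (fun s => Metric.infDist (X s θ) (range (X 0))) (Icc 0 t) :=
    (Metric.continuous_infDist_pt _).comp_continuousOn
      ((hX θ).mono (Icc_subset_Icc_right ht.2))
  have h0 : Metric.infDist (X 0 θ) (range (X 0)) = 0 := Metric.infDist_zero_of_mem ⟨θ, rfl⟩
  obtain ⟨s, hs, hsc⟩ := intermediate_value_Icc ht.1 hq
    ⟨by rw [h0]; linarith, (hc2.trans_le (min_le_right _ _)).le⟩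
  have hsO : X s θ ∈ O := hr ((Metric.mem_thickening_iff_infDist_lt (range_nonempty _)).2
    (by simp only at hsc; rw [hsc]; exact hc2.trans_le (min_le_left _ _)))
  have h1 := hd s ⟨hs.1, hs.2.trans ht.2⟩ _ hsO
  have h2 : curveSignedDist (X s) (X s θ) = 0 := by
    rw [← abs_eq_zero, IsGaussCurve.abs_curveSignedDist]
    exact Metric.infDist_zero_of_mem ⟨θ, rfl⟩
  rw [h2, zero_sub, abs_neg, IsGaussCurve.abs_curveSignedDist] at h1
  simp only at hsc
  linarith

/-! ### Families of functions on strips with uniformly bounded mixed derivatives -/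

section Mixed

variable {ι : Type*}

/-- The family of time derivatives. -/
noncomputable def timeDeriv (f : ι → ℝ → ℝ → ℝ) : ι → ℝ → ℝ → ℝ :=
  fun i t θ => deriv (fun s => f i s θ) t

/-- The family of angular derivatives. -/
noncomputable def angleDeriv (f : ι → ℝ → ℝ → ℝ) : ι → ℝ → ℝ → ℝ := fun i t θ => deriv (f i t) θ

/-- The mixed derivatives of order at most `k` in `t ∈ (0, S i)` and at most `j` in `θ` exist and
are bounded uniformly in the family. -/
inductive MixedBdd (S : ι → ℝ) : ℕ → ℕ → (ι → ℝ → ℝ → ℝ) → Prop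
  | intro {k j : ℕ} {f : ι → ℝ → ℝ → ℝ}
      (bdd : ∃ C, ∀ i, ∀ t ∈ Ioo 0 (S i), ∀ θ, |f i t θ| ≤ C)
      (diff_time : 0 < k → ∀ i, ∀ t ∈ Ioo 0 (S i), ∀ θ, DifferentiableAt ℝ (fun s => f i s θ) t)
      (diff_angle : 0 < j → ∀ i, ∀ t ∈ Ioo 0 (S i), ∀ θ, DifferentiableAt ℝ (f i t) θ)
      (time : ∀ k', k = k' + 1 → MixedBdd S k' j (timeDeriv f))
      (angle : ∀ j', j = j' + 1 → MixedBdd S k j' (angleDeriv f)) : MixedBdd S k j f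

/-- Each member of the family is smooth on its strip. -/
def SmoothFamily (S : ι → ℝ) (f : ι → ℝ → ℝ → ℝ) : Prop :=
  ∀ i, ContDiffOn ℝ ∞ (fun p : ℝ × ℝ => f i p.1 p.2) (Ioo 0 (S i) ×ˢ univ)

variable {S : ι → ℝ} {k j : ℕ} {f g : ι → ℝ → ℝ → ℝ}

namespace MixedBdd

theorem bdd (h : MixedBdd S k j f) : ∃ C, ∀ i, ∀ t ∈ Ioo 0 (S i), ∀ θ, |f i t θ| ≤ C := by
  cases h; assumption

theorem diff_time (h : MixedBdd S k j f) (hk : 0 < k) :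
    ∀ i, ∀ t ∈ Ioo 0 (S i), ∀ θ, DifferentiableAt ℝ (fun s => f i s θ) t := by
  cases h with | intro _ h _ _ _ => exact h hk

theorem diff_angle (h : MixedBdd S k j f) (hj : 0 < j) :
    ∀ i, ∀ t ∈ Ioo 0 (S i), ∀ θ, DifferentiableAt ℝ (f i t) θ := by
  cases h with | intro _ _ h _ _ => exact h hj

theorem time (h : MixedBdd S (k + 1) j f) : MixedBdd S k j (timeDeriv f) := by
  cases h with | intro _ _ _ h _ => exact h k rfl

theorem angle (h : MixedBdd S k (j + 1) f) : MixedBdd S k j (angleDeriv f) := by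
  cases h with | intro _ _ _ _ h => exact h j rfl

theorem mono (h : MixedBdd S k j f) : ∀ {k' j' : ℕ}, k' ≤ k → j' ≤ j → MixedBdd S k' j' f := by
  induction h with
  | @intro k j f b d1 d2 _ _ ih1 ih2 =>
    intro k' j' hk hj
    refine ⟨b, fun h => d1 (by omega), fun h => d2 (by omega), fun a ha => ?_, fun a ha => ?_⟩
    · exact ih1 (k - 1) (by omega) (by omega) hj
    · exact ih2 (j - 1) (by omega) hk (by omega)

theorem _root_.timeDeriv_eqOn (hfg : ∀ i, ∀ t ∈ Ioo 0 (S i), ∀ θ, f i t θ = g i t θ) :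
    ∀ i, ∀ t ∈ Ioo 0 (S i), ∀ θ, timeDeriv f i t θ = timeDeriv g i t θ := fun i t ht θ =>
  Filter.EventuallyEq.deriv_eq (by
    filter_upwards [isOpen_Ioo.mem_nhds ht] with s hs using hfg i s hs θ)

theorem _root_.angleDeriv_eqOn (hfg : ∀ i, ∀ t ∈ Ioo 0 (S i), ∀ θ, f i t θ = g i t θ) :
    ∀ i, ∀ t ∈ Ioo 0 (S i), ∀ θ, angleDeriv f i t θ = angleDeriv g i t θ := fun i t ht θ => by
  have : f i t = g i t := funext (hfg i t ht)
  simp [angleDeriv, this]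

theorem congr (h : MixedBdd S k j f) : ∀ {g : ι → ℝ → ℝ → ℝ},
    (∀ i, ∀ t ∈ Ioo 0 (S i), ∀ θ, f i t θ = g i t θ) → MixedBdd S k j g := by
  induction h with
  | @intro k j f b d1 d2 _ _ ih1 ih2 =>
    intro g hfg
    refine ⟨?_, fun h i t ht θ => ?_, fun h i t ht θ => ?_,
      fun a ha => ih1 a ha (timeDeriv_eqOn hfg), fun a ha => ih2 a ha (angleDeriv_eqOn hfg)⟩
    · obtain ⟨C, hC⟩ := b
      exact ⟨C, fun i t ht θ => hfg i t ht θ ▸ hC i t ht θ⟩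
    · refine (d1 h i t ht θ).congr_of_eventuallyEq ?_
      filter_upwards [isOpen_Ioo.mem_nhds ht] with s hs using (hfg i s hs θ).symm
    · have : f i t = g i t := funext (hfg i t ht)
      exact this ▸ d2 h i t ht θ

theorem zero : ∀ {k j : ℕ}, MixedBdd S k j (fun _ _ _ => 0) := by
  suffices ∀ n k j, k + j = n → MixedBdd S k j (fun _ _ _ => 0) from fun {k j} => this _ k j rfl
  intro n
  induction n with
  | zero => 
    intro k j h
    refine ⟨⟨0, by simp⟩, fun _ _ _ _ _ => by simp, fun _ _ _ _ _ => by simp, by omega, by omega⟩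
  | succ n ih =>
    intro k j h
    refine ⟨⟨0, by simp⟩, fun _ _ _ _ _ => by simp, fun _ _ _ _ _ => by simp,
      fun a ha => ?_, fun a ha => ?_⟩
    · exact (ih a j (by omega)).congr fun i t _ θ => by simp [timeDeriv]
    · exact (ih k a (by omega)).congr fun i t _ θ => by simp [angleDeriv]

theorem of_time {u : ι → ℝ → ℝ} (hu : ∀ i, ContDiffOn ℝ ∞ (u i) (Ioo 0 (S i))) :
    ∀ {k j : ℕ}, (∃ C, ∀ i, ∀ t ∈ Ioo 0 (S i), ∀ a ≤ k, |iteratedDeriv a (u i) t| ≤ C) →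
      MixedBdd S k j (fun i t _ => u i t) := by
  intro k
  induction k generalizing u with
  | zero =>
    rintro j ⟨C, hC⟩
    refine ⟨⟨C, fun i t ht _ => by simpa using hC i t ht 0 le_rfl⟩, by simp,
      fun _ _ _ _ _ => by simp, by omega, fun a ha => ?_⟩
    exact zero.congr fun i t _ θ => by simp [angleDeriv]
  | succ k ih =>
    rintro j ⟨C, hC⟩
    refine ⟨⟨C, fun i t ht _ => by simpa using hC i t ht 0 (by omega)⟩,
      fun _ i t ht θ => ?_, fun _ _ _ _ _ => by simp, fun a ha => ?_, fun a ha => ?_⟩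
    · exact ((hu i).differentiableOn (by simp)).differentiableAt (isOpen_Ioo.mem_nhds ht)
    · obtain rfl : a = k := by omega
      refine ih (u := fun i => deriv (u i)) (fun i => ?_) ⟨C, fun i t ht b hb => ?_⟩
      · exact ((contDiffOn_infty_iff_deriv_of_isOpen isOpen_Ioo).1 (hu i)).2
      · rw [← iteratedDeriv_succ']
        exact hC i t ht (b + 1) (by omega)
    · exact zero.congr fun i t _ θ => by simp [angleDeriv]

theorem const_param {c : ι → ℝ} (hc : ∃ C, ∀ i, |c i| ≤ C) :
    MixedBdd S k j (fun i _ _ => c i) := by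
  obtain ⟨C, hC⟩ := hc
  refine of_time (u := fun i _ => c i) (fun i => contDiffOn_const) ⟨|C|, fun i t _ a _ => ?_⟩
  cases a with
  | zero => simpa using (hC i).trans (le_abs_self C)
  | succ a => simp [iteratedDeriv_const]

theorem add (hf : MixedBdd S k j f) (hg : MixedBdd S k j g) :
    MixedBdd S k j (fun i t θ => f i t θ + g i t θ) := by
  induction hf generalizing g with
  | intro b d1 d2 _ _ ih1 ih2 =>
    refine ⟨?_, fun h i t ht θ => (d1 h i t ht θ).add (hg.diff_time h i t ht θ),
      fun h i t ht θ => (d2 h i t ht θ).add (hg.diff_angle h i t ht θ), fun a ha => ?_,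
      fun a ha => ?_⟩
    · obtain ⟨C, hC⟩ := b
      obtain ⟨C', hC'⟩ := hg.bdd
      exact ⟨C + C', fun i t ht θ => (abs_add_le _ _).trans (add_le_add (hC i t ht θ) (hC' i t ht θ))⟩
    · subst ha
      refine (ih1 a rfl hg.time).congr fun i t ht θ => ?_
      exact (deriv_add (d1 (by omega) i t ht θ) (hg.diff_time (by omega) i t ht θ)).symm
    · subst ha
      refine (ih2 a rfl hg.angle).congr fun i t ht θ => ?_
      exact (deriv_add (d2 (by omega) i t ht θ) (hg.diff_angle (by omega) i t ht θ)).symm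

theorem mul : ∀ {k j : ℕ} {f g : ι → ℝ → ℝ → ℝ}, MixedBdd S k j f → MixedBdd S k j g →
    MixedBdd S k j (fun i t θ => f i t θ * g i t θ) := by
  suffices ∀ n k j, k + j = n → ∀ f g, MixedBdd S k j f → MixedBdd S k j g →
    MixedBdd S k j (fun i t θ => f i t θ * g i t θ) from fun {k j f g} => this _ k j rfl f g
  intro n
  induction n with
  | zero =>
    intro k j hkj f g hf hg
    obtain ⟨C, hC⟩ := hf.bdd
    obtain ⟨C', hC'⟩ := hg.bdd
    refine ⟨⟨C * C', fun i t ht θ => ?_⟩, by omega, by omega, by omega, by omega⟩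
    rw [abs_mul]
    exact mul_le_mul (hC i t ht θ) (hC' i t ht θ) (abs_nonneg _)
      ((abs_nonneg _).trans (hC i t ht θ))
  | succ n ih =>
    intro k j hkj f g hf hg
    obtain ⟨C, hC⟩ := hf.bdd
    obtain ⟨C', hC'⟩ := hg.bdd
    refine ⟨⟨C * C', fun i t ht θ => ?_⟩, 
      fun h i t ht θ => (hf.diff_time h i t ht θ).mul (hg.diff_time h i t ht θ),
      fun h i t ht θ => (hf.diff_angle h i t ht θ).mul (hg.diff_angle h i t ht θ),
      fun a ha => ?_, fun a ha => ?_⟩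
    · rw [abs_mul]
      exact mul_le_mul (hC i t ht θ) (hC' i t ht θ) (abs_nonneg _)
        ((abs_nonneg _).trans (hC i t ht θ))
    · subst ha
      refine ((ih a j (by omega) _ _ hf.time (hg.mono (by omega) le_rfl)).add
        (ih a j (by omega) _ _ (hf.mono (by omega) le_rfl) hg.time)).congr fun i t ht θ => ?_
      exact (deriv_mul (hf.diff_time (by omega) i t ht θ)
        (hg.diff_time (by omega) i t ht θ)).symm
    · subst ha
      refine ((ih k a (by omega) _ _ hf.angle (hg.mono le_rfl (by omega))).add
        (ih k a (by omega) _ _ (hf.mono le_rfl (by omega)) hg.angle)).congr fun i t ht θ => ?_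
      exact (deriv_mul (hf.diff_angle (by omega) i t ht θ)
        (hg.diff_angle (by omega) i t ht θ)).symm

theorem const (c : ℝ) : MixedBdd S k j (fun _ _ _ => c) := const_param ⟨|c|, fun _ => le_rfl⟩

theorem neg (hf : MixedBdd S k j f) : MixedBdd S k j (fun i t θ => -f i t θ) :=
  ((const (-1)).mul hf).congr fun i t _ θ => by ring

/-- The derivative `-f' f⁻¹ f⁻¹` contains `f⁻¹` with one order less, so induction on the total order
`k + j` closes. -/
theorem inv {c : ℝ} (hc : 0 < c) : ∀ {k j : ℕ} {f : ι → ℝ → ℝ → ℝ}, MixedBdd S k j f →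
    (∀ i, ∀ t ∈ Ioo 0 (S i), ∀ θ, c ≤ f i t θ) → MixedBdd S k j (fun i t θ => (f i t θ)⁻¹) := by
  suffices ∀ n k j, k + j = n → ∀ f, MixedBdd S k j f →
    (∀ i, ∀ t ∈ Ioo 0 (S i), ∀ θ, c ≤ f i t θ) → MixedBdd S k j (fun i t θ => (f i t θ)⁻¹)
    from fun {k j f} => this _ k j rfl f
  have hb : ∀ f : ι → ℝ → ℝ → ℝ, (∀ i, ∀ t ∈ Ioo 0 (S i), ∀ θ, c ≤ f i t θ) →
      ∃ C, ∀ i, ∀ t ∈ Ioo 0 (S i), ∀ θ, |(f i t θ)⁻¹| ≤ C := fun f hf =>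
    ⟨c⁻¹, fun i t ht θ => by
      rw [abs_inv, abs_of_pos (hc.trans_le (hf i t ht θ))]
      exact inv_anti₀ hc (hf i t ht θ)⟩
  intro n
  induction n with
  | zero =>
    intro k j hkj f hf hfc
    exact ⟨hb f hfc, by omega, by omega, by omega, by omega⟩
  | succ n ih =>
    intro k j hkj f hf hfc
    have hne : ∀ i, ∀ t ∈ Ioo 0 (S i), ∀ θ, f i t θ ≠ 0 := fun i t ht θ =>
      (hc.trans_le (hfc i t ht θ)).ne'
    refine ⟨hb f hfc, 
      fun h i t ht θ => (hf.diff_time h i t ht θ).inv (hne i t ht θ),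
      fun h i t ht θ => (hf.diff_angle h i t ht θ).inv (hne i t ht θ),
      fun a ha => ?_, fun a ha => ?_⟩
    · subst ha
      have hi := ih a j (by omega) f (hf.mono (by omega) le_rfl) hfc
      refine ((hf.time.mul hi).mul hi).neg.congr fun i t ht θ => ?_
      have := (hf.diff_time (by omega) i t ht θ).hasDerivAt.fun_inv (hne i t ht θ)
      refine Eq.trans ?_ this.deriv.symm
      change -(deriv (fun s => f i s θ) t * _ * _) = _
      field_simp
    · subst ha
      have hi := ih k a (by omega) f (hf.mono le_rfl (by omega)) hfc
      refine ((hf.angle.mul hi).mul hi).neg.congr fun i t ht θ => ?_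
      have := (hf.diff_angle (by omega) i t ht θ).hasDerivAt.fun_inv (hne i t ht θ)
      refine Eq.trans ?_ this.deriv.symm
      change -(deriv (f i t) θ * _ * _) = _
      field_simp

theorem trig : MixedBdd S k j (fun _ _ θ => Real.cos θ) ∧ MixedBdd S k j (fun _ _ θ => Real.sin θ) := by
  induction j with
  | zero =>
    have hc : MixedBdd S k 0 (fun _ _ θ => Real.cos θ) := by
      refine ⟨⟨1, fun _ _ _ θ => Real.abs_cos_le_one θ⟩, fun _ _ _ _ _ => by simp,
        fun _ _ _ _ θ => Real.differentiableAt_cos, fun a _ => ?_, by omega⟩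
      exact zero.congr fun i t _ θ => by simp [timeDeriv]
    have hs : MixedBdd S k 0 (fun _ _ θ => Real.sin θ) := by
      refine ⟨⟨1, fun _ _ _ θ => Real.abs_sin_le_one θ⟩, fun _ _ _ _ _ => by simp,
        fun _ _ _ _ θ => Real.differentiableAt_sin, fun a _ => ?_, by omega⟩
      exact zero.congr fun i t _ θ => by simp [timeDeriv]
    exact ⟨hc, hs⟩
  | succ j ih =>
    constructor
    · refine ⟨⟨1, fun _ _ _ θ => Real.abs_cos_le_one θ⟩, fun _ _ _ _ _ => by simp,
        fun _ _ _ _ θ => Real.differentiableAt_cos, fun a _ => ?_, fun a ha => ?_⟩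
      · exact zero.congr fun i t _ θ => by simp [timeDeriv]
      · obtain rfl : a = j := by omega
        exact ih.2.neg.congr fun i t _ θ => by simp [angleDeriv]
    · refine ⟨⟨1, fun _ _ _ θ => Real.abs_sin_le_one θ⟩, fun _ _ _ _ _ => by simp,
        fun _ _ _ _ θ => Real.differentiableAt_sin, fun a _ => ?_, fun a ha => ?_⟩
      · exact zero.congr fun i t _ θ => by simp [timeDeriv]
      · obtain rfl : a = j := by omega
        exact ih.1.congr fun i t _ θ => by simp [angleDeriv]

theorem cos : MixedBdd S k j (fun _ _ θ => Real.cos θ) := trig.1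

theorem sin : MixedBdd S k j (fun _ _ θ => Real.sin θ) := trig.2

end MixedBdd

namespace SmoothFamily

theorem hasFDerivAt (hf : SmoothFamily S f) {i : ι} {t : ℝ} (ht : t ∈ Ioo 0 (S i)) (θ : ℝ) :
    HasFDerivAt (fun p : ℝ × ℝ => f i p.1 p.2)
      (fderiv ℝ (fun p : ℝ × ℝ => f i p.1 p.2) (t, θ)) (t, θ) :=
  (((hf i).differentiableOn (by simp)).differentiableAt
    ((isOpen_Ioo.prod isOpen_univ).mem_nhds ⟨ht, mem_univ θ⟩)).hasFDerivAt

theorem hasDerivAt_time (hf : SmoothFamily S f) {i : ι} {t : ℝ} (ht : t ∈ Ioo 0 (S i)) (θ : ℝ) :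
    HasDerivAt (fun s => f i s θ) (fderiv ℝ (fun p : ℝ × ℝ => f i p.1 p.2) (t, θ) (1, 0)) t :=
  HasFDerivAt.comp_hasDerivAt (f := fun s : ℝ => (s, θ)) t (hf.hasFDerivAt ht θ)
    ((hasDerivAt_id t).prodMk (hasDerivAt_const t θ))

theorem hasDerivAt_angle (hf : SmoothFamily S f) {i : ι} {t : ℝ} (ht : t ∈ Ioo 0 (S i)) (θ : ℝ) :
    HasDerivAt (f i t) (fderiv ℝ (fun p : ℝ × ℝ => f i p.1 p.2) (t, θ) (0, 1)) θ :=
  HasFDerivAt.comp_hasDerivAt (f := fun s : ℝ => (t, s)) θ (hf.hasFDerivAt ht θ)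
    ((hasDerivAt_const θ t).prodMk (hasDerivAt_id θ))

theorem timeDeriv_eq (hf : SmoothFamily S f) {i : ι} {t : ℝ} (ht : t ∈ Ioo 0 (S i)) (θ : ℝ) :
    timeDeriv f i t θ = fderiv ℝ (fun p : ℝ × ℝ => f i p.1 p.2) (t, θ) (1, 0) :=
  (hf.hasDerivAt_time ht θ).deriv

theorem angleDeriv_eq (hf : SmoothFamily S f) {i : ι} {t : ℝ} (ht : t ∈ Ioo 0 (S i)) (θ : ℝ) :
    angleDeriv f i t θ = fderiv ℝ (fun p : ℝ × ℝ => f i p.1 p.2) (t, θ) (0, 1) :=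
  (hf.hasDerivAt_angle ht θ).deriv

theorem fderiv_smooth (hf : SmoothFamily S f) (i : ι) :
    ContDiffOn ℝ ∞ (fderiv ℝ (fun p : ℝ × ℝ => f i p.1 p.2)) (Ioo 0 (S i) ×ˢ univ) :=
  ((contDiffOn_infty_iff_fderiv_of_isOpen (isOpen_Ioo.prod isOpen_univ)).1 (hf i)).2

theorem time (hf : SmoothFamily S f) : SmoothFamily S (timeDeriv f) := fun i =>
  ((hf.fderiv_smooth i).clm_apply contDiffOn_const).congr fun p hp => hf.timeDeriv_eq hp.1 p.2

theorem angle (hf : SmoothFamily S f) : SmoothFamily S (angleDeriv f) := fun i =>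
  ((hf.fderiv_smooth i).clm_apply contDiffOn_const).congr fun p hp => hf.angleDeriv_eq hp.1 p.2

theorem timeDeriv_angleDeriv (hf : SmoothFamily S f) {i : ι} {t : ℝ} (ht : t ∈ Ioo 0 (S i))
    (θ : ℝ) : timeDeriv (angleDeriv f) i t θ = angleDeriv (timeDeriv f) i t θ := by
  have hU : IsOpen (Ioo 0 (S i) ×ˢ (univ : Set ℝ)) := isOpen_Ioo.prod isOpen_univ
  have hm : Ioo 0 (S i) ×ˢ (univ : Set ℝ) ∈ 𝓝 (t, θ) := hU.mem_nhds ⟨ht, mem_univ θ⟩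
  have hsymm : IsSymmSndFDerivAt ℝ (fun p : ℝ × ℝ => f i p.1 p.2) (t, θ) :=
    ((hf i).contDiffAt hm).isSymmSndFDerivAt
      (by simpa using (WithTop.coe_le_coe.2 le_top : ((2 : ℕ∞) : ℕ∞ω) ≤ ∞))
  have hd : DifferentiableAt ℝ (fderiv ℝ (fun p : ℝ × ℝ => f i p.1 p.2)) (t, θ) :=
    ((hf.fderiv_smooth i).differentiableOn (by simp)).differentiableAt hm
  rw [hf.angle.timeDeriv_eq ht, hf.time.angleDeriv_eq ht]
  have e1 : fderiv ℝ (fun p : ℝ × ℝ => angleDeriv f i p.1 p.2) (t, θ)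
      = fderiv ℝ (fun p => fderiv ℝ (fun p : ℝ × ℝ => f i p.1 p.2) p (0, 1)) (t, θ) :=
    Filter.EventuallyEq.fderiv_eq (by
      filter_upwards [hm] with p hp using hf.angleDeriv_eq hp.1 p.2)
  have e2 : fderiv ℝ (fun p : ℝ × ℝ => timeDeriv f i p.1 p.2) (t, θ)
      = fderiv ℝ (fun p => fderiv ℝ (fun p : ℝ × ℝ => f i p.1 p.2) p (1, 0)) (t, θ) :=
    Filter.EventuallyEq.fderiv_eq (by
      filter_upwards [hm] with p hp using hf.timeDeriv_eq hp.1 p.2)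
  rw [e1, e2, fderiv_clm_apply hd (by simp), fderiv_clm_apply hd (by simp)]
  simpa using hsymm.eq (1, 0) (0, 1)

end SmoothFamily

/-- An evolution equation controls `∂_t f` only. Bounds for `f` in the angle alone supply the rest,
once mixed derivatives are commuted so that angular derivatives of `f` inherit the equation. -/
theorem MixedBdd.of_timeDeriv (hf : SmoothFamily S f) (h0 : MixedBdd S 0 j f)
    (h : MixedBdd S k j (timeDeriv f)) : MixedBdd S (k + 1) j f := by
  induction j generalizing f with
  | zero =>
    refine ⟨h0.bdd, fun _ i t ht θ => (hf.hasDerivAt_time ht θ).differentiableAt, by omega,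
      fun a ha => ?_, by omega⟩
    obtain rfl : a = k := by omega
    exact h
  | succ j ih =>
    refine ⟨h0.bdd, fun _ i t ht θ => (hf.hasDerivAt_time ht θ).differentiableAt,
      fun _ i t ht θ => (hf.hasDerivAt_angle ht θ).differentiableAt, fun a ha => ?_, fun a ha => ?_⟩
    · obtain rfl : a = k := by omega
      exact h
    · obtain rfl : a = j := by omega
      exact ih hf.angle h0.angle
        (h.angle.congr fun i t ht θ => (hf.timeDeriv_angleDeriv ht θ).symm)

theorem SmoothFamily.continuous_slice (hf : SmoothFamily S f) {i : ι} {t : ℝ}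
    (ht : t ∈ Ioo 0 (S i)) : Continuous (f i t) :=
  continuous_iff_continuousAt.2 fun θ => (hf.hasDerivAt_angle ht θ).continuousAt

theorem SmoothFamily.hasDerivAt_integral (hf : SmoothFamily S f)
    (hb : ∃ C, ∀ i, ∀ t ∈ Ioo 0 (S i), ∀ θ, |timeDeriv f i t θ| ≤ C) {i : ι} {t : ℝ}
    (ht : t ∈ Ioo 0 (S i)) (a b : ℝ) :
    HasDerivAt (fun s => ∫ φ in a..b, f i s φ) (∫ φ in a..b, timeDeriv f i t φ) t := by
  obtain ⟨C, hC⟩ := hb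
  refine (intervalIntegral.hasDerivAt_integral_of_dominated_loc_of_deriv_le (bound := fun _ => C)
    (F' := fun s φ => timeDeriv f i s φ) (isOpen_Ioo.mem_nhds ht) ?_ ?_ ?_ ?_ ?_ ?_).2
  · filter_upwards [isOpen_Ioo.mem_nhds ht] with s hs
    exact (hf.continuous_slice hs).aestronglyMeasurable
  · exact (hf.continuous_slice ht).intervalIntegrable _ _
  · exact (hf.time.continuous_slice ht).aestronglyMeasurable
  · exact Filter.Eventually.of_forall fun φ _ s hs => hC i s hs φ
  · exact intervalIntegrable_const
  · refine Filter.Eventually.of_forall fun φ _ s hs => ?_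
    have := hf.hasDerivAt_time hs φ
    rwa [← hf.timeDeriv_eq hs] at this

/-- The integral does not depend on the angle, so no angular derivative of `f` is consumed, while
any number `j` may be claimed. -/
theorem MixedBdd.integral (hf : SmoothFamily S f) (h : MixedBdd S k 0 f) (a b : ℝ) :
    MixedBdd S k j (fun i t _ => ∫ φ in a..b, f i t φ) := by
  induction k generalizing f with
  | zero =>
    obtain ⟨C, hC⟩ := h.bdd
    refine ⟨⟨C * |b - a|, fun i t ht θ => ?_⟩, by omega, fun _ _ _ _ _ => by simp, by omega,
      fun c hc => zero.congr fun i t _ θ => by simp [angleDeriv]⟩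
    exact intervalIntegral.norm_integral_le_of_norm_le_const (f := f i t) fun φ _ => hC i t ht φ
  | succ k ih =>
    obtain ⟨C, hC⟩ := h.bdd
    refine ⟨⟨C * |b - a|, fun i t ht θ => ?_⟩,
      fun _ i t ht θ => (hf.hasDerivAt_integral h.time.bdd ht a b).differentiableAt,
      fun _ _ _ _ _ => by simp, fun c hc => ?_,
      fun c hc => zero.congr fun i t _ θ => by simp [angleDeriv]⟩
    · exact intervalIntegral.norm_integral_le_of_norm_le_const (f := f i t) fun φ _ => hC i t ht φ
    · obtain rfl : c = k := by omega
      exact (ih hf.time h.time).congr fun i t ht θ =>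
        (hf.hasDerivAt_integral h.time.bdd ht a b).deriv.symm

/-- Bounded mixed derivatives bound the Fréchet derivatives. -/
theorem MixedBdd.exists_iteratedFDerivWithin_le (hf : SmoothFamily S f) {n : ℕ}
    (h : MixedBdd S n n f) : ∃ C, ∀ i, ∀ z ∈ Ioo 0 (S i) ×ˢ (univ : Set ℝ),
      ‖iteratedFDerivWithin ℝ n (fun p : ℝ × ℝ => f i p.1 p.2) (Ioo 0 (S i) ×ˢ univ) z‖ ≤ C := by
  induction n generalizing f with
  | zero =>
    obtain ⟨C, hC⟩ := h.bdd
    exact ⟨C, fun i z hz => by simpa using hC i z.1 hz.1 z.2⟩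
  | succ n ih =>
    obtain ⟨C₁, h₁⟩ := ih hf.time (h.time.mono le_rfl (by omega))
    obtain ⟨C₂, h₂⟩ := ih hf.angle (h.angle.mono (by omega) le_rfl)
    set L₁ := ContinuousLinearMap.toSpanSingleton ℝ (ContinuousLinearMap.fst ℝ ℝ ℝ)
    set L₂ := ContinuousLinearMap.toSpanSingleton ℝ (ContinuousLinearMap.snd ℝ ℝ ℝ)
    refine ⟨‖L₁‖ * C₁ + ‖L₂‖ * C₂, fun i z hz => ?_⟩
    have hU : IsOpen (Ioo 0 (S i) ×ˢ (univ : Set ℝ)) := isOpen_Ioo.prod isOpen_univ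
    rw [← norm_iteratedFDerivWithin_fderivWithin hU.uniqueDiffOn hz]
    have hcongr : EqOn (fderivWithin ℝ (fun p : ℝ × ℝ => f i p.1 p.2) (Ioo 0 (S i) ×ˢ univ))
        ((L₁ ∘ fun p : ℝ × ℝ => timeDeriv f i p.1 p.2)
          + (L₂ ∘ fun p : ℝ × ℝ => angleDeriv f i p.1 p.2)) (Ioo 0 (S i) ×ˢ univ) := by
      intro p hp
      rw [fderivWithin_of_isOpen hU hp]
      ext <;> simp [L₁, L₂, hf.timeDeriv_eq hp.1, hf.angleDeriv_eq hp.1]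
    rw [iteratedFDerivWithin_congr hcongr hz]
    have c1 := (hf.time i).of_le (show (n : ℕ∞ω) ≤ ∞ by exact_mod_cast le_top)
    have c2 := (hf.angle i).of_le (show (n : ℕ∞ω) ≤ ∞ by exact_mod_cast le_top)
    rw [iteratedFDerivWithin_add_apply ((L₁.contDiff.comp_contDiffOn c1) z hz)
      ((L₂.contDiff.comp_contDiffOn c2) z hz) hU.uniqueDiffOn hz]
    refine (norm_add_le _ _).trans (add_le_add ?_ ?_)
    · refine (L₁.norm_iteratedFDerivWithin_comp_left (c1 z hz) hU.uniqueDiffOn hz le_rfl).trans ?_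
      gcongr; exact h₁ i z hz
    · refine (L₂.norm_iteratedFDerivWithin_comp_left (c2 z hz) hU.uniqueDiffOn hz le_rfl).trans ?_
      gcongr; exact h₂ i z hz

end Mixed

/-! ### A priori bounds for the flow in rescaled time -/

/-- A moving curve `Y`, on the time interval `[0, S]`, a time scale `a` and a forcing `u`. -/
structure FlowData where
  S : ℝ
  a : ℝ
  u : ℝ → ℝ
  Y : ℝ → ℝ → Plane

/-- The flow equation in the time scale `a`, with forcing bounded by `1` in `C^n`, for curves whose
geometry is controlled by `R` and `B`. -/
structure IsScaledFlow (R B lam : ℝ) (m₀ n : ℕ) (F : FlowData) : Prop where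
  S_pos : 0 < F.S
  a_nonneg : 0 ≤ F.a
  a_le_one : F.a ≤ 1
  smooth : ContDiffOn ℝ ∞ (fun p : ℝ × ℝ => F.Y p.1 p.2) (Icc 0 F.S ×ˢ univ)
  gauss : ∀ t ∈ Icc 0 F.S, IsGaussCurve (F.Y t)
  le_radius : ∀ t ∈ Icc 0 F.S, ∀ θ, R ≤ ‖deriv (F.Y t) θ‖
  radius_le : ∀ t ∈ Icc 0 F.S, ∀ θ, ‖deriv (F.Y t) θ‖ ≤ B
  norm_le : ∀ t ∈ Icc 0 F.S, ∀ θ, ‖F.Y t θ‖ ≤ B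
  dist_le : ∀ t ∈ Icc 0 F.S, ∀ θ, ∀ m ≤ m₀,
    ‖iteratedFDeriv ℝ m (curveSignedDist (F.Y t)) (F.Y t θ)‖ ≤ B
  velocity : ∀ t ∈ Ioo 0 F.S, ∀ θ, inner ℝ (deriv (fun s => F.Y s θ) t) (unitNormal θ)
    = -(F.a * curvature (F.Y t) θ) + (2 * Real.pi * F.a - lam * F.u t) * (curveLength (F.Y t))⁻¹
  forcing_smooth : ContDiffOn ℝ ∞ F.u (Ioo 0 F.S)
  forcing_le : ∀ t ∈ Ioo 0 F.S, ∀ k ≤ n, |iteratedDeriv k F.u t| ≤ 1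

/-- The scaled flows with given constants. -/
abbrev ScaledFlow (R B lam : ℝ) (m₀ n : ℕ) : Type := {F : FlowData // IsScaledFlow R B lam m₀ n F}

namespace ScaledFlow

variable {R B lam : ℝ} {m₀ n : ℕ}

/-- The lifetimes. -/
def S (i : ScaledFlow R B lam m₀ n) : ℝ := i.1.S

variable (R B lam m₀ n) in
/-- The components of the position vectors. -/
def coord (b : Fin 2) : ScaledFlow R B lam m₀ n → ℝ → ℝ → ℝ := fun i t θ => i.1.Y t θ b

variable (R B lam m₀ n) in
/-- The support functions. -/
noncomputable def support : ScaledFlow R B lam m₀ n → ℝ → ℝ → ℝ :=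
  fun i t θ => i.1.Y t θ 0 * Real.cos θ + i.1.Y t θ 1 * Real.sin θ

variable (R B lam m₀ n) in
/-- The radii of curvature. -/
noncomputable def radius : ScaledFlow R B lam m₀ n → ℝ → ℝ → ℝ := fun i t θ => ‖deriv (i.1.Y t) θ‖

variable (R B lam m₀ n) in
/-- The partial derivatives of the signed distances on the curves. -/
noncomputable def distDeriv {m : ℕ} (e : Fin m → Fin 2) : ScaledFlow R B lam m₀ n → ℝ → ℝ → ℝ :=
  fun i t θ => iteratedFDeriv ℝ m (curveSignedDist (i.1.Y t)) (i.1.Y t θ)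
    (fun l => EuclideanSpace.single (e l) (1 : ℝ))

theorem smooth_coord (b : Fin 2) : SmoothFamily S (coord R B lam m₀ n b) := fun i =>
  (contDiffOn_euclidean.1 i.2.smooth b).mono (prod_mono Ioo_subset_Icc_self le_rfl)

theorem smooth_support : SmoothFamily S (support R B lam m₀ n) := fun i =>
  ((smooth_coord 0 i).mul (Real.contDiff_cos.comp contDiff_snd).contDiffOn).add
    ((smooth_coord 1 i).mul (Real.contDiff_sin.comp contDiff_snd).contDiffOn)

theorem gauss (i : ScaledFlow R B lam m₀ n) {t : ℝ} (ht : t ∈ Ioo 0 (S i)) :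
    IsGaussCurve (i.1.Y t) := i.2.gauss t (Ioo_subset_Icc_self ht)

theorem hasDerivAt_coord (i : ScaledFlow R B lam m₀ n) {t : ℝ} (ht : t ∈ Ioo 0 (S i)) (θ : ℝ)
    (b : Fin 2) : HasDerivAt (fun θ => i.1.Y t θ b) (‖deriv (i.1.Y t) θ‖ * unitTangent θ b) θ :=
  HasFDerivAt.comp_hasDerivAt (f := i.1.Y t) θ
    ((EuclideanSpace.proj b : Plane →L[ℝ] ℝ).hasFDerivAt) ((gauss i ht).hasDerivAt θ)

theorem hasDerivAt_support (i : ScaledFlow R B lam m₀ n) {t : ℝ} (ht : t ∈ Ioo 0 (S i)) (θ : ℝ) :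
    HasDerivAt (support R B lam m₀ n i t)
      (-(i.1.Y t θ 0 * Real.sin θ) + i.1.Y t θ 1 * Real.cos θ) θ := by
  refine (((hasDerivAt_coord i ht θ 0).mul (Real.hasDerivAt_cos θ)).add
    ((hasDerivAt_coord i ht θ 1).mul (Real.hasDerivAt_sin θ))).congr_deriv ?_
  simp; ring

theorem angleDeriv_support (i : ScaledFlow R B lam m₀ n) {t : ℝ} (ht : t ∈ Ioo 0 (S i)) (θ : ℝ) :
    angleDeriv (support R B lam m₀ n) i t θ
      = -(i.1.Y t θ 0 * Real.sin θ) + i.1.Y t θ 1 * Real.cos θ :=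
  (hasDerivAt_support i ht θ).deriv

theorem angleDeriv_angleDeriv_support (i : ScaledFlow R B lam m₀ n) {t : ℝ}
    (ht : t ∈ Ioo 0 (S i)) (θ : ℝ) :
    angleDeriv (angleDeriv (support R B lam m₀ n)) i t θ
      = ‖deriv (i.1.Y t) θ‖ - support R B lam m₀ n i t θ := by
  have h : angleDeriv (support R B lam m₀ n) i t
      = fun θ => -(i.1.Y t θ 0 * Real.sin θ) + i.1.Y t θ 1 * Real.cos θ :=
    funext (angleDeriv_support i ht)
  have h2 := ((hasDerivAt_coord i ht θ 0).mul (Real.hasDerivAt_sin θ)).neg.add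
    ((hasDerivAt_coord i ht θ 1).mul (Real.hasDerivAt_cos θ))
  rw [angleDeriv, h]
  refine h2.deriv.trans ?_
  simp only [unitTangent_zero, unitTangent_one, support]
  linear_combination ‖deriv (i.1.Y t) θ‖ * Real.sin_sq_add_cos_sq θ

/-- The curve is `h n + (∂_θ h) e`. It is recovered from its support function at the price of one
angular derivative, so that the normal velocity alone determines the motion of the Gauss
parametrization. -/
theorem coord_eq (i : ScaledFlow R B lam m₀ n) {t : ℝ} (ht : t ∈ Ioo 0 (S i)) (θ : ℝ) :
    i.1.Y t θ 0 = support R B lam m₀ n i t θ * Real.cos θ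
        + -(angleDeriv (support R B lam m₀ n) i t θ * Real.sin θ) ∧
      i.1.Y t θ 1 = support R B lam m₀ n i t θ * Real.sin θ
        + angleDeriv (support R B lam m₀ n) i t θ * Real.cos θ := by
  rw [angleDeriv_support i ht, support]
  constructor
  · linear_combination (-i.1.Y t θ 0) * Real.sin_sq_add_cos_sq θ
  · linear_combination (-i.1.Y t θ 1) * Real.sin_sq_add_cos_sq θ

theorem iteratedFDeriv_cons_unitTangent (f : Plane → ℝ) (x : Plane) (θ : ℝ) {m : ℕ}
    (e : Fin m → Fin 2) :
    iteratedFDeriv ℝ (m + 1) f x (Fin.cons (unitTangent θ)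
      fun l => EuclideanSpace.single (e l) (1 : ℝ))
      = -(Real.sin θ * iteratedFDeriv ℝ (m + 1) f x
          fun l => EuclideanSpace.single (Fin.cons (α := fun _ => Fin 2) 0 e l) (1 : ℝ))
        + Real.cos θ * iteratedFDeriv ℝ (m + 1) f x
          fun l => EuclideanSpace.single (Fin.cons (α := fun _ => Fin 2) 1 e l) (1 : ℝ) := by
  have hT : unitTangent θ = (-Real.sin θ) • EuclideanSpace.single 0 (1 : ℝ)
      + Real.cos θ • EuclideanSpace.single 1 (1 : ℝ) := by
    apply Plane.ext' <;> simp
  have hc : ∀ b : Fin 2, (fun l => EuclideanSpace.single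
      (Fin.cons (α := fun _ => Fin 2) b e l) (1 : ℝ))
      = (Fin.cons (EuclideanSpace.single b (1 : ℝ)) fun l => EuclideanSpace.single (e l) (1 : ℝ)
        : Fin (m + 1) → Plane) := fun b => by
    funext l
    refine Fin.cases ?_ (fun l => ?_) l <;> simp
  rw [hc, hc, hT, ContinuousMultilinearMap.cons_add, ContinuousMultilinearMap.cons_smul,
    ContinuousMultilinearMap.cons_smul]
  simp

theorem angleDeriv_distDeriv (i : ScaledFlow R B lam m₀ n) {t : ℝ} (ht : t ∈ Ioo 0 (S i)) (θ : ℝ)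
    {m : ℕ} (e : Fin m → Fin 2) :
    HasDerivAt (distDeriv R B lam m₀ n e i t) (radius R B lam m₀ n i t θ *
      (-(Real.sin θ * distDeriv R B lam m₀ n (Fin.cons (α := fun _ => Fin 2) 0 e) i t θ)
        + Real.cos θ * distDeriv R B lam m₀ n (Fin.cons (α := fun _ => Fin 2) 1 e) i t θ)) θ := by
  refine ((gauss i ht).hasDerivAt_iteratedFDeriv_apply
    (fun l => EuclideanSpace.single (e l) (1 : ℝ)) θ).congr_deriv ?_
  rw [iteratedFDeriv_cons_unitTangent]
  rfl

theorem curvature_eq (i : ScaledFlow R B lam m₀ n) {t : ℝ} (ht : t ∈ Ioo 0 (S i)) (θ : ℝ) :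
    curvature (i.1.Y t) θ =
      (Real.sin θ * Real.sin θ * distDeriv R B lam m₀ n ![0, 0] i t θ
        + -(Real.sin θ * Real.cos θ * distDeriv R B lam m₀ n ![0, 1] i t θ))
      + (-(Real.cos θ * Real.sin θ * distDeriv R B lam m₀ n ![1, 0] i t θ)
        + Real.cos θ * Real.cos θ * distDeriv R B lam m₀ n ![1, 1] i t θ) := by
  have hT : unitTangent θ = (-Real.sin θ) • EuclideanSpace.single 0 (1 : ℝ)
      + Real.cos θ • EuclideanSpace.single 1 (1 : ℝ) := by
    apply Plane.ext' <;> simp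
  rw [(gauss i ht).curvature_eq]
  simp only [distDeriv, iteratedFDeriv_two_apply, Matrix.cons_val_zero, Matrix.cons_val_one,
    Matrix.cons_val_fin_one]
  rw [hT]
  simp only [map_add, map_smul, add_apply, smul_apply, smul_eq_mul]
  ring

theorem mixedBdd_distDeriv_zero {m : ℕ} (hm : m ≤ m₀) (e : Fin m → Fin 2) :
    MixedBdd S 0 0 (distDeriv R B lam m₀ n e) := by
  refine ⟨⟨B, fun i t ht θ => ?_⟩, by omega, by omega, by omega, by omega⟩
  refine ((iteratedFDeriv ℝ m (curveSignedDist (i.1.Y t)) (i.1.Y t θ)).le_opNorm _).trans ?_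
  simpa using i.2.dist_le t (Ioo_subset_Icc_self ht) θ m hm

theorem mixedBdd_radius_of_distDeriv (hB : 0 < B) {j : ℕ}
    (h : ∀ e : Fin 2 → Fin 2, MixedBdd S 0 j (distDeriv R B lam m₀ n e)) :
    MixedBdd S 0 j (radius R B lam m₀ n) := by
  have hκ : MixedBdd S 0 j (fun (i : ScaledFlow R B lam m₀ n) t θ => curvature (i.1.Y t) θ) :=
    ((((MixedBdd.sin.mul MixedBdd.sin).mul (h ![0, 0])).add
        ((MixedBdd.sin.mul MixedBdd.cos).mul (h ![0, 1])).neg).add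
      (((MixedBdd.cos.mul MixedBdd.sin).mul (h ![1, 0])).neg.add
        ((MixedBdd.cos.mul MixedBdd.cos).mul (h ![1, 1])))).congr
      fun i t ht θ => (curvature_eq i ht θ).symm
  refine (hκ.inv (c := B⁻¹) (inv_pos.2 hB) fun i t ht θ => ?_).congr fun i t ht θ => ?_
  · exact inv_anti₀ ((gauss i ht).norm_deriv_pos θ) (i.2.radius_le t (Ioo_subset_Icc_self ht) θ)
  · simp [curvature, radius]

/-- An angular derivative of an order-`m` derivative of `d` is `ρ` times derivatives of order `m +
1`. The factor `ρ = 1/κ` comes from the derivatives of order two and is thus controlled by the same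
induction. Hence `m + j ≤ m₀` suffices, and `m ≥ 1` leaves room for `ρ`. -/
theorem mixedBdd_distDeriv (hB : 0 < B) (j : ℕ) :
    ∀ {m : ℕ}, 1 ≤ m → m + j ≤ m₀ → ∀ e : Fin m → Fin 2,
      MixedBdd S 0 j (distDeriv R B lam m₀ n e) := by
  induction j with
  | zero => exact fun _ hm e => mixedBdd_distDeriv_zero hm e
  | succ j ih =>
    intro m hm1 hm e
    refine ⟨(mixedBdd_distDeriv_zero (by omega) e).bdd, by omega,
      fun _ i t ht θ => (angleDeriv_distDeriv i ht θ e).differentiableAt, by omega, fun c hc => ?_⟩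
    obtain rfl : c = j := by omega
    have hρ : MixedBdd S 0 c (radius R B lam m₀ n) :=
      mixedBdd_radius_of_distDeriv hB (ih (m := 2) (by omega) (by omega))
    exact (hρ.mul (((MixedBdd.sin.mul (ih (by omega) (by omega) _)).neg).add
      (MixedBdd.cos.mul (ih (by omega) (by omega) _)))).congr
      fun i t ht θ => (angleDeriv_distDeriv i ht θ e).deriv.symm

theorem mixedBdd_radius (hB : 0 < B) {j : ℕ} (hj : j + 2 ≤ m₀) :
    MixedBdd S 0 j (radius R B lam m₀ n) :=
  mixedBdd_radius_of_distDeriv hB (mixedBdd_distDeriv hB j (by omega) (by omega))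

theorem mixedBdd_coord_zero (hB : 0 < B) {j : ℕ} (hj : j + 2 ≤ m₀) (b : Fin 2) :
    MixedBdd S 0 j (coord R B lam m₀ n b) := by
  refine ⟨⟨B, fun i t ht θ => (PiLp.norm_apply_le (i.1.Y t θ) b).trans
    (i.2.norm_le t (Ioo_subset_Icc_self ht) θ)⟩, by omega,
    fun _ i t ht θ => (hasDerivAt_coord i ht θ b).differentiableAt, by omega, fun c hc => ?_⟩
  have hT : MixedBdd S 0 c (fun (_ : ScaledFlow R B lam m₀ n) _ θ => unitTangent θ b) := by
    fin_cases b
    · exact MixedBdd.sin.neg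
    · exact MixedBdd.cos
  exact ((mixedBdd_radius hB (by omega)).mul hT).congr
    fun i t ht θ => (hasDerivAt_coord i ht θ b).deriv.symm

theorem mixedBdd_support_zero (hB : 0 < B) {j : ℕ} (hj : j + 2 ≤ m₀) :
    MixedBdd S 0 j (support R B lam m₀ n) :=
  ((mixedBdd_coord_zero hB hj 0).mul MixedBdd.cos).add
    ((mixedBdd_coord_zero hB hj 1).mul MixedBdd.sin)

/-- The normal at fixed `θ` does not move, so the time derivative of the support function is the
outward normal velocity. -/
theorem timeDeriv_support (i : ScaledFlow R B lam m₀ n) {t : ℝ} (ht : t ∈ Ioo 0 (S i)) (θ : ℝ) :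
    timeDeriv (support R B lam m₀ n) i t θ = -(i.1.a * (radius R B lam m₀ n i t θ)⁻¹)
      + (2 * Real.pi * i.1.a + -(lam * i.1.u t))
        * (∫ φ in (0 : ℝ)..(2 * Real.pi), radius R B lam m₀ n i t φ)⁻¹ := by
  have h := i.2.velocity t ht θ
  rw [← sub_eq_add_neg]
  refine Eq.trans ?_ h
  have hY : ∀ b, HasDerivAt (fun s => i.1.Y s θ b) (deriv (fun s => i.1.Y s θ b) t) t := fun b =>
    ((smooth_coord b).hasDerivAt_time ht θ).differentiableAt.hasDerivAt
  have hv : HasDerivAt (fun s => i.1.Y s θ)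
      (!₂[deriv (fun s => i.1.Y s θ 0) t, deriv (fun s => i.1.Y s θ 1) t] : Plane) t :=
    Plane.hasDerivAt (hY 0) (hY 1)
  rw [hv.deriv, Plane.inner_eq]
  exact (((hY 0).mul_const (Real.cos θ)).add ((hY 1).mul_const (Real.sin θ))).deriv

/-- The right-hand side of the equation depends on `ρ = h + ∂_θ² h`, so one more time derivative
costs two angular ones. The term `2` in the count stems from the initial bound of `ρ` by second
derivatives of `d`. Order `k` uses the forcing only up to order `k - 1`, hence `k ≤ n + 1`. -/
theorem mixedBdd_support (hB : 0 < B) (hR : 0 < R) (k : ℕ) : ∀ {j : ℕ}, k ≤ n + 1 →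
    j + 2 * k + 2 ≤ m₀ → MixedBdd S k j (support R B lam m₀ n) := by
  induction k with
  | zero => exact fun _ hj => mixedBdd_support_zero hB (by omega)
  | succ k ih =>
    intro j hk hj
    refine MixedBdd.of_timeDeriv smooth_support (mixedBdd_support_zero hB (by omega)) ?_
    have hs : MixedBdd S k (j + 2) (support R B lam m₀ n) := ih (by omega) (by omega)
    have he : ∀ i, ∀ t ∈ Ioo 0 (S i), ∀ θ, support R B lam m₀ n i t θ
        + angleDeriv (angleDeriv (support R B lam m₀ n)) i t θ = radius R B lam m₀ n i t θ :=
      fun i t ht θ => by rw [angleDeriv_angleDeriv_support i ht, radius]; ring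
    have hρ : MixedBdd S k j (radius R B lam m₀ n) :=
      ((hs.mono le_rfl (by omega)).add hs.angle.angle).congr he
    have hρs : SmoothFamily S (radius R B lam m₀ n) := fun i =>
      ((smooth_support i).add (smooth_support.angle.angle i)).congr
        fun p hp => (he i p.1 hp.1 p.2).symm
    have hρR : ∀ i, ∀ t ∈ Ioo 0 (S i), ∀ θ, R ≤ radius R B lam m₀ n i t θ := fun i t ht θ =>
      i.2.le_radius t (Ioo_subset_Icc_self ht) θ
    have hℓ : MixedBdd S k j (fun i t _ => ∫ φ in (0 : ℝ)..(2 * Real.pi), radius R B lam m₀ n i t φ) :=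
      MixedBdd.integral hρs (hρ.mono le_rfl (by omega)) _ _
    have hℓR : ∀ i, ∀ t ∈ Ioo 0 (S i), ∀ _θ : ℝ, 2 * Real.pi * R
        ≤ ∫ φ in (0 : ℝ)..(2 * Real.pi), radius R B lam m₀ n i t φ := fun i t ht _ => by
      have := intervalIntegral.integral_mono_on (f := fun _ => R) Real.two_pi_pos.le
        (by simp) ((hρs.continuous_slice ht).intervalIntegrable (μ := volume) 0 (2 * Real.pi))
        (fun x _ => hρR i t ht x)
      simpa using this
    have ha : MixedBdd S k j (fun (i : ScaledFlow R B lam m₀ n) _ _ => i.1.a) :=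
      MixedBdd.const_param ⟨1, fun i => by
        rw [abs_of_nonneg i.2.a_nonneg]; exact i.2.a_le_one⟩
    have hu : MixedBdd S k j (fun (i : ScaledFlow R B lam m₀ n) t _ => i.1.u t) :=
      MixedBdd.of_time (u := fun i : ScaledFlow R B lam m₀ n => i.1.u) (fun i => i.2.forcing_smooth)
        ⟨1, fun i t ht a hak => i.2.forcing_le t ht a (by omega)⟩
    exact (((ha.mul (hρ.inv hR hρR)).neg).add ((((MixedBdd.const (2 * Real.pi)).mul ha).add
      ((MixedBdd.const lam).mul hu).neg).mul
        (hℓ.inv (mul_pos Real.two_pi_pos hR) hℓR))).congr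
      fun i t ht θ => (timeDeriv_support i ht θ).symm

theorem mixedBdd_coord (hB : 0 < B) (hR : 0 < R) {k j : ℕ} (hk : k ≤ n + 1)
    (hj : j + 2 * k + 3 ≤ m₀) (b : Fin 2) : MixedBdd S k j (coord R B lam m₀ n b) := by
  have h : MixedBdd S k (j + 1) (support R B lam m₀ n) := mixedBdd_support hB hR k hk (by omega)
  fin_cases b
  · exact (((h.mono le_rfl (by omega)).mul MixedBdd.cos).add
      (h.angle.mul MixedBdd.sin).neg).congr fun i t ht θ => (coord_eq i ht θ).1.symm
  · exact (((h.mono le_rfl (by omega)).mul MixedBdd.sin).add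
      (h.angle.mul MixedBdd.cos)).congr fun i t ht θ => (coord_eq i ht θ).2.symm

end ScaledFlow

/-! ### Uniform space-time bounds up to the boundary times -/

theorem uniqueDiffOn_strip {S : ℝ} (hS : 0 < S) {E : Type*} [NormedAddCommGroup E]
    [NormedSpace ℝ E] : UniqueDiffOn ℝ (Icc 0 S ×ˢ (univ : Set E)) :=
  (uniqueDiffOn_Icc hS).prod uniqueDiffOn_univ

/-- Bounds on the interior of a strip extend to its closure. -/
theorem norm_iteratedFDerivWithin_strip_le {S : ℝ} (hS : 0 < S) {f : ℝ × ℝ → ℝ}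
    (hf : ContDiffOn ℝ ∞ f (Icc 0 S ×ˢ univ)) {k : ℕ} {C : ℝ}
    (h : ∀ z ∈ Ioo 0 S ×ˢ (univ : Set ℝ),
      ‖iteratedFDerivWithin ℝ k f (Ioo 0 S ×ˢ univ) z‖ ≤ C) {z : ℝ × ℝ}
    (hz : z ∈ Icc 0 S ×ˢ (univ : Set ℝ)) :
    ‖iteratedFDerivWithin ℝ k f (Icc 0 S ×ˢ univ) z‖ ≤ C := by
  have hcl : closure (Ioo 0 S ×ˢ (univ : Set ℝ)) = Icc 0 S ×ˢ univ := by
    rw [closure_prod_eq, closure_Ioo hS.ne, closure_univ]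
  have hsub : Ioo 0 S ×ˢ (univ : Set ℝ) ⊆ Icc 0 S ×ˢ univ := prod_mono Ioo_subset_Icc_self le_rfl
  have hc : ContinuousWithinAt (fun z => ‖iteratedFDerivWithin ℝ k f (Icc 0 S ×ˢ univ) z‖)
      (Ioo 0 S ×ˢ univ) z :=
    ((hf.continuousOn_iteratedFDerivWithin (by exact_mod_cast le_top)
      (uniqueDiffOn_strip hS)).norm z hz).mono hsub
  refine ContinuousWithinAt.closure_le (hcl ▸ hz) hc continuousWithinAt_const fun y hy => ?_
  have hU : IsOpen (Ioo 0 S ×ˢ (univ : Set ℝ)) := isOpen_Ioo.prod isOpen_univ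
  have : Ioo 0 S ×ˢ (univ : Set ℝ) =ᶠ[𝓝 y] Icc 0 S ×ˢ (univ : Set ℝ) := by
    filter_upwards [hU.mem_nhds hy] with x hx
    exact propext ⟨fun _ => hsub hx, fun _ => hx⟩
  rw [← iteratedFDerivWithin_congr_set this]
  exact h y hy

/-- All space-time derivatives of scaled flows are bounded by a constant. -/
theorem ScaledFlow.exists_bound {R B lam : ℝ} {m₀ n : ℕ} (hB : 0 < B) (hR : 0 < R)
    (hm₀ : 3 * n + 3 ≤ m₀) : ∃ C, ∀ F, IsScaledFlow R B lam m₀ n F → ∀ b : Fin 2, ∀ k ≤ n,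
      ∀ z ∈ Icc 0 F.S ×ˢ (univ : Set ℝ),
        ‖iteratedFDerivWithin ℝ k (fun p : ℝ × ℝ => F.Y p.1 p.2 b) (Icc 0 F.S ×ˢ univ) z‖ ≤ C := by
  have key : ∀ (b : Fin 2) (k : ℕ), ∃ C, k ≤ n → ∀ F, IsScaledFlow R B lam m₀ n F →
      ∀ z ∈ Icc 0 F.S ×ˢ (univ : Set ℝ),
        ‖iteratedFDerivWithin ℝ k (fun p : ℝ × ℝ => F.Y p.1 p.2 b) (Icc 0 F.S ×ˢ univ) z‖ ≤ C := by
    intro b k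
    by_cases hk : k ≤ n
    · obtain ⟨C, hC⟩ := (ScaledFlow.mixedBdd_coord (k := k) (j := k) (n := n) (lam := lam) (m₀ := m₀)
        hB hR (by omega) (by omega) b).exists_iteratedFDerivWithin_le (ScaledFlow.smooth_coord b)
      exact ⟨C, fun _ F hF z hz => norm_iteratedFDerivWithin_strip_le hF.S_pos
        (contDiffOn_euclidean.1 hF.smooth b) (hC ⟨F, hF⟩) hz⟩
    · exact ⟨0, fun h => (hk h).elim⟩
  choose C hC using key
  refine ⟨∑ b, ∑ k ∈ Finset.range (n + 1), |C b k|, fun F hF b k hk z hz => ?_⟩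
  refine (hC b k hk F hF z hz).trans ((le_abs_self _).trans ?_)
  refine le_trans ?_ (Finset.single_le_sum (f := fun b => ∑ k ∈ Finset.range (n + 1), |C b k|)
    (fun b _ => Finset.sum_nonneg fun k _ => abs_nonneg _) (Finset.mem_univ b))
  exact Finset.single_le_sum (f := fun k => |C b k|) (fun k _ => abs_nonneg _)
    (Finset.mem_range.2 (by omega))

/-! ### Bounds for the derivatives at a point -/

section Jet

variable {E F G : Type*} [NormedAddCommGroup E] [NormedSpace ℝ E] [NormedAddCommGroup F]
  [NormedSpace ℝ F] [NormedAddCommGroup G] [NormedSpace ℝ G]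

/-- `f` is smooth on `s` and its derivatives of order at most `n` at `z` are bounded by `C`. -/
structure JetBound (s : Set E) (z : E) (n : ℕ) (C : ℝ) (f : E → F) : Prop where
  smooth : ContDiffOn ℝ ∞ f s
  le : ∀ i ≤ n, ‖iteratedFDerivWithin ℝ i f s z‖ ≤ C

namespace JetBound

variable {s : Set E} {z : E} {n : ℕ} {C C' : ℝ} {f g : E → F}

theorem _root_.natCast_le_smooth (n : ℕ) : (n : ℕ∞ω) ≤ ∞ := by exact_mod_cast le_top

theorem nonneg (h : JetBound s z n C f) : 0 ≤ C := (norm_nonneg _).trans (h.le 0 (Nat.zero_le n))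

theorem norm_le (h : JetBound s z n C f) : ‖f z‖ ≤ C := by
  simpa using h.le 0 (Nat.zero_le n)

theorem mono (h : JetBound s z n C f) (hC : C ≤ C') : JetBound s z n C' f :=
  ⟨h.smooth, fun i hi => (h.le i hi).trans hC⟩

theorem mono_order (h : JetBound s z n C f) {m : ℕ} (hm : m ≤ n) : JetBound s z m C f :=
  ⟨h.smooth, fun i hi => h.le i (hi.trans hm)⟩

theorem congr (h : JetBound s z n C f) (hz : z ∈ s) (hfg : EqOn g f s) : JetBound s z n C g :=
  ⟨h.smooth.congr hfg, fun i hi => by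
    rw [iteratedFDerivWithin_congr hfg hz]; exact h.le i hi⟩

theorem add (hs : UniqueDiffOn ℝ s) (hz : z ∈ s) (hf : JetBound s z n C f)
    (hg : JetBound s z n C' g) : JetBound s z n (C + C') (fun x => f x + g x) :=
  ⟨hf.smooth.add hg.smooth, fun i hi => by
    have e : iteratedFDerivWithin ℝ i (fun x => f x + g x) s z = _ :=
      iteratedFDerivWithin_add_apply (hf.smooth.of_le (natCast_le_smooth i) z hz)
        (hg.smooth.of_le (natCast_le_smooth i) z hz) hs hz
    rw [e]
    exact (norm_add_le _ _).trans (add_le_add (hf.le i hi) (hg.le i hi))⟩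

theorem clm_comp (hs : UniqueDiffOn ℝ s) (hz : z ∈ s) (hf : JetBound s z n C f) (L : F →L[ℝ] G) :
    JetBound s z n (‖L‖ * C) (fun x => L (f x)) :=
  ⟨L.contDiff.comp_contDiffOn hf.smooth, fun i hi =>
    (L.norm_iteratedFDerivWithin_comp_left (hf.smooth.of_le (natCast_le_smooth i) z hz) hs hz
      le_rfl).trans (mul_le_mul_of_nonneg_left (hf.le i hi) (norm_nonneg L))⟩

theorem neg (hs : UniqueDiffOn ℝ s) (hz : z ∈ s) (hf : JetBound s z n C f) :
    JetBound s z n C (fun x => -f x) := by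
  refine (hf.clm_comp hs hz (-ContinuousLinearMap.id ℝ F)).mono ?_
  have h1 : ‖-ContinuousLinearMap.id ℝ F‖ ≤ 1 := by
    rw [norm_neg]; exact ContinuousLinearMap.norm_id_le
  nlinarith [hf.nonneg]

theorem smul (hs : UniqueDiffOn ℝ s) (hz : z ∈ s) {a : E → ℝ} (ha : JetBound s z n C a)
    (hf : JetBound s z n C' f) : JetBound s z n (2 ^ n * (C * C')) (fun x => a x • f x) := by
  refine ⟨ha.smooth.smul hf.smooth, fun i hi => ?_⟩
  refine (norm_iteratedFDerivWithin_smul_le ha.smooth hf.smooth hs hz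
    (natCast_le_smooth i)).trans ?_
  have h0 : 0 ≤ C * C' := mul_nonneg ha.nonneg hf.nonneg
  calc _ ≤ ∑ j ∈ Finset.range (i + 1), (i.choose j : ℝ) * (C * C') := by
        refine Finset.sum_le_sum fun j hj => ?_
        rw [mul_assoc]
        refine mul_le_mul_of_nonneg_left ?_ (Nat.cast_nonneg _)
        have := Finset.mem_range.1 hj
        exact mul_le_mul (ha.le j (by omega)) (hf.le (i - j) (by omega)) (norm_nonneg _) ha.nonneg
    _ = 2 ^ i * (C * C') := by
        rw [← Finset.sum_mul]
        congr 1
        exact_mod_cast Nat.sum_range_choose i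
    _ ≤ 2 ^ n * (C * C') := by gcongr; norm_num

theorem mul (hs : UniqueDiffOn ℝ s) (hz : z ∈ s) {a b : E → ℝ} (ha : JetBound s z n C a)
    (hb : JetBound s z n C' b) : JetBound s z n (2 ^ n * (C * C')) (fun x => a x * b x) :=
  ha.smul hs hz hb

/-- No bound on the value of the inner function is needed, only on its derivatives of positive
order. The condition `1 ≤ C'` allows `C'` to be replaced by `C' ^ i`, as the estimate for composites
requires. -/
theorem comp (hs : UniqueDiffOn ℝ s) (hz : z ∈ s) {t : Set F} (ht : UniqueDiffOn ℝ t) {h : F → G}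
    (hh : JetBound t (f z) n C h) (hf : ContDiffOn ℝ ∞ f s)
    (hfC : ∀ i, 1 ≤ i → i ≤ n → ‖iteratedFDerivWithin ℝ i f s z‖ ≤ C') (hst : MapsTo f s t)
    (hC' : 1 ≤ C') : JetBound s z n (n.factorial * C * C' ^ n) (fun x => h (f x)) := by
  refine ⟨hh.smooth.comp hf hst, fun i hi => ?_⟩
  refine (norm_iteratedFDerivWithin_comp_le hh.smooth hf (natCast_le_smooth i) ht hs hst hz
    (C := C) (D := C') (fun j hj => hh.le j (hj.trans hi))
    (fun j hj hji => (hfC j hj (hji.trans hi)).trans (le_self_pow₀ hC' (by omega)))).trans ?_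
  have := hh.nonneg
  gcongr

theorem _root_.norm_iteratedFDerivWithin_clm_le (hs : UniqueDiffOn ℝ s) (hz : z ∈ s)
    (L : E →L[ℝ] F) {i : ℕ} (hi : 1 ≤ i) :
    ‖iteratedFDerivWithin ℝ i (fun x => L x) s z‖ ≤ ‖L‖ := by
  obtain ⟨i, rfl⟩ := Nat.exists_eq_add_of_le' hi
  rw [← norm_iteratedFDerivWithin_fderivWithin hs hz]
  have : EqOn (fderivWithin ℝ (fun x : E => L x) s) (fun _ => L) s :=
    fun x hx => L.fderivWithin (hs x hx)
  rw [iteratedFDerivWithin_congr this hz]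
  match i with
  | 0 => simp
  | i + 1 =>
    rw [iteratedFDerivWithin_succ_const]
    simp

theorem clm (hs : UniqueDiffOn ℝ s) (hz : z ∈ s) (L : E →L[ℝ] F) :
    JetBound s z n (‖L z‖ + ‖L‖) (fun x => L x) := by
  refine ⟨L.contDiff.contDiffOn, fun i _ => ?_⟩
  match i with
  | 0 => simp
  | i + 1 =>
    exact (norm_iteratedFDerivWithin_clm_le hs hz L (by omega)).trans
      (le_add_of_nonneg_left (norm_nonneg _))

theorem comp_clm (hs : UniqueDiffOn ℝ s) (hz : z ∈ s) {t : Set F} (ht : UniqueDiffOn ℝ t)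
    {h : F → G} {L : E →L[ℝ] F} (hh : JetBound t (L z) n C h) (hst : MapsTo L s t) :
    JetBound s z n (n.factorial * C * (‖L‖ + 1) ^ n) (fun x => h (L x)) :=
  JetBound.comp (f := fun x => L x) hs hz ht hh L.contDiff.contDiffOn (fun _ hi _ =>
    (norm_iteratedFDerivWithin_clm_le hs hz L hi).trans (le_add_of_nonneg_right zero_le_one)) hst
    (le_add_of_nonneg_left (norm_nonneg _))

theorem _root_.norm_iteratedFDerivWithin_prodMk_le (hs : UniqueDiffOn ℝ s) (hz : z ∈ s) {h : E → G}
    (hf : ContDiffOn ℝ ∞ f s) (hh : ContDiffOn ℝ ∞ h s) (i : ℕ) :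
    ‖iteratedFDerivWithin ℝ i (fun x => (f x, h x)) s z‖
      ≤ ‖iteratedFDerivWithin ℝ i f s z‖ + ‖iteratedFDerivWithin ℝ i h s z‖ := by
  have e : EqOn (fun x => (f x, h x)) ((ContinuousLinearMap.inl ℝ F G ∘ f)
      + (ContinuousLinearMap.inr ℝ F G ∘ h)) s := fun x _ => by simp
  have hf' := hf.of_le (natCast_le_smooth i)
  have hh' := hh.of_le (natCast_le_smooth i)
  rw [iteratedFDerivWithin_congr e hz, iteratedFDerivWithin_add_apply
    (((ContinuousLinearMap.inl ℝ F G).contDiff.comp_contDiffOn hf') z hz)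
    (((ContinuousLinearMap.inr ℝ F G).contDiff.comp_contDiffOn hh') z hz) hs hz]
  refine (norm_add_le _ _).trans (add_le_add ?_ ?_)
  · refine ((ContinuousLinearMap.inl ℝ F G).norm_iteratedFDerivWithin_comp_left (hf' z hz) hs hz
      le_rfl).trans (mul_le_of_le_one_left (norm_nonneg _) ?_)
    exact ContinuousLinearMap.opNorm_le_bound _ zero_le_one fun x => by simp [Prod.norm_def]
  · refine ((ContinuousLinearMap.inr ℝ F G).norm_iteratedFDerivWithin_comp_left (hh' z hz) hs hz
      le_rfl).trans (mul_le_of_le_one_left (norm_nonneg _) ?_)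
    exact ContinuousLinearMap.opNorm_le_bound _ zero_le_one fun x => by simp [Prod.norm_def]

theorem fderivWithin (hs : UniqueDiffOn ℝ s) (hz : z ∈ s) (hf : JetBound s z (n + 1) C f) :
    JetBound s z n C (fderivWithin ℝ f s) :=
  ⟨hf.smooth.fderivWithin hs (by simp), fun i hi => by
    rw [norm_iteratedFDerivWithin_fderivWithin hs hz]
    exact hf.le (i + 1) (by omega)⟩

theorem _root_.exists_jetBound_inv (n : ℕ) {c C : ℝ} (hc : 0 < c) :
    ∃ B, ∀ x : ℝ, c ≤ |x| → |x| ≤ C → JetBound {x : ℝ | x ≠ 0} x n B (fun x : ℝ => x⁻¹) := by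
  have hopen : IsOpen {x : ℝ | x ≠ 0} := isOpen_ne
  have hsm : ContDiffOn ℝ ∞ (fun x : ℝ => x⁻¹) {x : ℝ | x ≠ 0} := fun x hx =>
    (contDiffAt_inv ℝ hx).contDiffWithinAt
  have key : ∀ i, ∃ B, ∀ x : ℝ, c ≤ |x| → |x| ≤ C →
      ‖iteratedFDerivWithin ℝ i (fun x : ℝ => x⁻¹) {x : ℝ | x ≠ 0} x‖ ≤ B := fun i => by
    have hK : IsCompact {x : ℝ | c ≤ |x| ∧ |x| ≤ C} := by
      refine Metric.isCompact_of_isClosed_isBounded ?_ ?_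
      · exact (isClosed_le continuous_const continuous_abs).inter
          (isClosed_le continuous_abs continuous_const)
      · exact (Metric.isBounded_closedBall (x := (0 : ℝ)) (r := C)).subset fun x hx => by
          simpa using hx.2
    obtain ⟨B, hB⟩ := hK.exists_bound_of_continuousOn
      ((hsm.continuousOn_iteratedFDerivWithin (natCast_le_smooth i) hopen.uniqueDiffOn).mono
        fun x hx => by
          have : 0 < |x| := hc.trans_le hx.1
          exact abs_pos.1 this)
    exact ⟨B, fun x h1 h2 => hB x ⟨h1, h2⟩⟩
  choose B hB using key
  refine ⟨∑ i ∈ Finset.range (n + 1), |B i|, fun x h1 h2 => ⟨hsm, fun i hi => ?_⟩⟩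
  exact (hB i x h1 h2).trans ((le_abs_self _).trans (Finset.single_le_sum (f := fun i => |B i|)
    (fun _ _ => abs_nonneg _) (Finset.mem_range.2 (by omega))))

end JetBound

/-! ### Implicit functions on sets with boundary -/

/-- `Θ` solves `Φ (z, Θ z) = 0` on `s ∩ W` and `Φ` is regular there in the last variable. -/
structure IsImplicitOn (s W : Set E) (Φ : E × ℝ → ℝ) (Θ : E → ℝ) : Prop where
  uniq : UniqueDiffOn ℝ s
  isOpen : IsOpen W
  smooth : ContDiffOn ℝ ∞ Φ (s ×ˢ univ)
  cont : ContinuousOn Θ (s ∩ W)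
  zero : ∀ z ∈ s ∩ W, Φ (z, Θ z) = 0
  ne_zero : ∀ z ∈ s ∩ W, fderivWithin ℝ Φ (s ×ˢ univ) (z, Θ z) (0, 1) ≠ 0

namespace IsImplicitOn

variable {s W : Set E} {Φ : E × ℝ → ℝ} {Θ : E → ℝ}

theorem uniq_prod (h : IsImplicitOn s W Φ Θ) : UniqueDiffOn ℝ (s ×ˢ (univ : Set ℝ)) :=
  h.uniq.prod uniqueDiffOn_univ

theorem uniq_inter (h : IsImplicitOn s W Φ Θ) : UniqueDiffOn ℝ (s ∩ W) := h.uniq.inter h.isOpen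

/-- The map `(z, y) ↦ (z, Φ(z, y))` has an invertible derivative, and `z ↦ (z, Θ z)` is a continuous
right inverse of it over the zero level. Continuity of `Θ` replaces the open neighbourhoods that are
not available at the end points of the time interval. -/
theorem hasFDerivWithinAt (h : IsImplicitOn s W Φ Θ) {z : E} (hz : z ∈ s ∩ W) :
    HasFDerivWithinAt Θ (-((fderivWithin ℝ Φ (s ×ˢ univ) (z, Θ z) (0, 1))⁻¹ •
      (fderivWithin ℝ Φ (s ×ˢ univ) (z, Θ z)).comp (ContinuousLinearMap.inl ℝ E ℝ))) (s ∩ W) z := by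
  set P := fderivWithin ℝ Φ (s ×ˢ univ) (z, Θ z) with hP
  set b := P (0, 1) with hb
  have hb0 : b ≠ 0 := h.ne_zero z hz
  set a := P.comp (ContinuousLinearMap.inl ℝ E ℝ) with ha
  have hPd : HasFDerivWithinAt Φ P (s ×ˢ univ) (z, Θ z) :=
    (h.smooth.differentiableOn (by simp) (z, Θ z) ⟨hz.1, mem_univ _⟩).hasFDerivWithinAt
  have hPe : ∀ x : E, ∀ r : ℝ, P (x, r) = a x + r * b := fun x r => by
    have : ((x, r) : E × ℝ) = (x, 0) + r • (0, 1) := by ext <;> simp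
    rw [this, map_add, map_smul]; simp [ha, hb]
  let e : (E × ℝ) ≃L[ℝ] (E × ℝ) := ContinuousLinearEquiv.equivOfInverse
    ((ContinuousLinearMap.fst ℝ E ℝ).prod P)
    ((ContinuousLinearMap.fst ℝ E ℝ).prod
      (b⁻¹ • (ContinuousLinearMap.snd ℝ E ℝ - a.comp (ContinuousLinearMap.fst ℝ E ℝ))))
    (fun p => by ext <;> simp [hPe]; field_simp)
    (fun p => by ext <;> simp [hPe]; field_simp; simp)
  have hf : HasFDerivWithinAt (fun p : E × ℝ => (p.1, Φ p)) (e : (E × ℝ) →L[ℝ] (E × ℝ))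
      (s ×ˢ univ) (z, Θ z) := hasFDerivWithinAt_fst.prodMk hPd
  have hg : Tendsto (fun p : E × ℝ => (p.1, Θ p.1)) (𝓝[(s ∩ W) ×ˢ {0}] (z, 0))
      (𝓝[s ×ˢ univ] (z, Θ z)) := by
    refine tendsto_nhdsWithin_iff.2 ⟨?_, ?_⟩
    · have h1 : Tendsto (fun p : E × ℝ => p.1) (𝓝[(s ∩ W) ×ˢ {0}] (z, 0)) (𝓝[s ∩ W] z) :=
        tendsto_nhdsWithin_iff.2 ⟨(continuous_fst.tendsto _).mono_left nhdsWithin_le_nhds,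
          eventually_mem_nhdsWithin.mono fun p hp => hp.1⟩
      exact ((h1.mono_right nhdsWithin_le_nhds).prodMk_nhds ((h.cont z hz).tendsto.comp h1))
    · exact eventually_mem_nhdsWithin.mono fun p hp => ⟨hp.1.1, mem_univ _⟩
  have hinv := HasFDerivWithinAt.of_local_left_inverse (f' := e) (g := fun p : E × ℝ => (p.1, Θ p.1))
    (a := ((z, 0) : E × ℝ)) hg hf
    (show (z, (0 : ℝ)) ∈ (s ∩ W) ×ˢ {0} from ⟨hz, rfl⟩) (by
      filter_upwards [self_mem_nhdsWithin] with p hp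
      have h0 : p.2 = 0 := hp.2
      ext
      · rfl
      · simp [h.zero p.1 hp.1, h0])
  have hc : HasFDerivWithinAt (fun x : E => ((x, 0) : E × ℝ)) (ContinuousLinearMap.inl ℝ E ℝ)
      (s ∩ W) z := (ContinuousLinearMap.inl ℝ E ℝ).hasFDerivWithinAt
  have hcomp := (hinv.comp z hc (fun x hx => (show (x, (0 : ℝ)) ∈ (s ∩ W) ×ˢ {0} from ⟨hx, rfl⟩))).snd
  refine hcomp.congr_fderiv ?_
  ext x
  simp [e]

theorem fderivWithin_eq (h : IsImplicitOn s W Φ Θ) {z : E} (hz : z ∈ s ∩ W) :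
    _root_.fderivWithin ℝ Θ (s ∩ W) z
      = -((_root_.fderivWithin ℝ Φ (s ×ˢ univ) (z, Θ z) (0, 1))⁻¹ •
      (_root_.fderivWithin ℝ Φ (s ×ˢ univ) (z, Θ z)).comp (ContinuousLinearMap.inl ℝ E ℝ)) :=
  (h.hasFDerivWithinAt hz).fderivWithin (h.uniq_inter z hz)

/-- The derivative of `Θ` is a smooth expression in the derivative of `Φ` at `(z, Θ z)`, so each
order of smoothness of `Θ` gives the next. -/
theorem contDiffOn (h : IsImplicitOn s W Φ Θ) : ContDiffOn ℝ ∞ Θ (s ∩ W) := by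
  refine contDiffOn_infty.2 fun n => ?_
  induction n with
  | zero => exact contDiffOn_zero.2 h.cont
  | succ n ih =>
    refine (contDiffOn_succ_iff_fderivWithin h.uniq_inter).2
      ⟨fun z hz => (h.hasFDerivWithinAt hz).differentiableWithinAt,
        fun h' => ((WithTop.coe_lt_top (n : ℕ∞)).ne h').elim, ?_⟩
    have hP : ContDiffOn ℝ n (fun z => _root_.fderivWithin ℝ Φ (s ×ˢ univ) (z, Θ z)) (s ∩ W) :=
      (h.smooth.fderivWithin h.uniq_prod (m := n) (by
        exact_mod_cast le_top)).comp (contDiffOn_id.prodMk ih) fun z hz => ⟨hz.1, mem_univ _⟩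
    refine ContDiffOn.congr ?_ fun z hz => h.fderivWithin_eq hz
    exact (((hP.clm_apply contDiffOn_const).inv h.ne_zero).smul
      (hP.clm_comp contDiffOn_const)).neg

/-- The derivatives of an implicit function are bounded by those of the equation. -/
theorem _root_.exists_jetBound_implicit (E : Type*) [NormedAddCommGroup E] [NormedSpace ℝ E] (n : ℕ)
    {c : ℝ} (hc : 0 < c) (C R : ℝ) : ∃ B, ∀ (s W : Set E) (Φ : E × ℝ → ℝ) (Θ : E → ℝ) (z : E),
      IsImplicitOn s W Φ Θ → z ∈ s ∩ W → JetBound (s ×ˢ univ) (z, Θ z) n C Φ → |Θ z| ≤ R →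
      c ≤ |_root_.fderivWithin ℝ Φ (s ×ˢ univ) (z, Θ z) (0, 1)| → JetBound (s ∩ W) z n B Θ := by
  induction n with
  | zero =>
    refine ⟨R, fun s W Φ Θ z h hz _ hΘ _ => ⟨h.contDiffOn, fun i hi => ?_⟩⟩
    obtain rfl : i = 0 := by omega
    simpa using hΘ
  | succ n ih =>
    obtain ⟨B, hB⟩ := ih
    set C₁ := (n.factorial : ℝ) * C * (1 + |B|) ^ n
    set L₁ : (E × ℝ →L[ℝ] ℝ) →L[ℝ] ℝ := ContinuousLinearMap.apply ℝ ℝ ((0, 1) : E × ℝ)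
    set L₂ : (E × ℝ →L[ℝ] ℝ) →L[ℝ] (E →L[ℝ] ℝ) :=
      (ContinuousLinearMap.compL ℝ E (E × ℝ) ℝ).flip (ContinuousLinearMap.inl ℝ E ℝ)
    obtain ⟨B₁, hB₁⟩ := exists_jetBound_inv n (C := ‖L₁‖ * C₁) hc
    set B₂ := 2 ^ n * ((n.factorial * B₁ * (‖L₁‖ * C₁ + 1) ^ n) * (‖L₂‖ * C₁))
    -- `R` serves for order zero and `B₂` for the orders reached through the quotient formula for
    -- the derivative.
    refine ⟨max R B₂, fun s W Φ Θ z h hz hΦ hΘ hcb => ⟨h.contDiffOn, fun i hi => ?_⟩⟩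
    have hs := h.uniq_inter
    have hΘn : JetBound (s ∩ W) z n |B| Θ :=
      (hB s W Φ Θ z h hz (hΦ.mono_order (by omega)) hΘ hcb).mono (le_abs_self B)
    have hpair : ∀ i, 1 ≤ i → i ≤ n →
        ‖iteratedFDerivWithin ℝ i (fun x => (x, Θ x)) (s ∩ W) z‖ ≤ 1 + |B| := fun i hi hin =>
      (norm_iteratedFDerivWithin_prodMk_le hs hz contDiffOn_id hΘn.smooth i).trans
        (add_le_add ((norm_iteratedFDerivWithin_clm_le hs hz (ContinuousLinearMap.id ℝ E) hi).trans
          ContinuousLinearMap.norm_id_le) (hΘn.le i hin))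
    have hP : JetBound (s ∩ W) z n C₁ (fun x => _root_.fderivWithin ℝ Φ (s ×ˢ univ) (x, Θ x)) :=
      (JetBound.fderivWithin h.uniq_prod (show (z, Θ z) ∈ s ×ˢ univ from ⟨hz.1, mem_univ _⟩) hΦ).comp hs hz h.uniq_prod (contDiffOn_id.prodMk hΘn.smooth) hpair
        (fun x hx => ⟨hx.1, mem_univ _⟩) (by linarith [abs_nonneg B])
    have hb : JetBound (s ∩ W) z n (‖L₁‖ * C₁)
      (fun x => _root_.fderivWithin ℝ Φ (s ×ˢ univ) (x, Θ x) (0, 1)) := hP.clm_comp hs hz L₁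
    have ha : JetBound (s ∩ W) z n (‖L₂‖ * C₁)
      (fun x => (_root_.fderivWithin ℝ Φ (s ×ˢ univ) (x, Θ x)).comp
        (ContinuousLinearMap.inl ℝ E ℝ)) := hP.clm_comp hs hz L₂
    have hinv := (hB₁ _ hcb hb.norm_le).comp hs hz isOpen_ne.uniqueDiffOn
      hb.smooth (fun i _ hi => (hb.le i hi).trans (le_add_of_nonneg_right zero_le_one))
      (fun x hx => h.ne_zero x hx)
      (by linarith [hb.nonneg])
    have hG := (hinv.smul hs hz ha).neg hs hz
    match i with
    | 0 => exact le_max_of_le_left (by simpa using hΘ)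
    | i + 1 =>
      rw [← norm_iteratedFDerivWithin_fderivWithin hs hz,
        iteratedFDerivWithin_congr (fun x hx => h.fderivWithin_eq hx) hz]
      exact (hG.le i (by omega)).trans (le_max_right _ _)

end IsImplicitOn

/-! ### Mixed partial derivatives -/

/-- The strip has no boundary in the space directions, so there the one-sided derivatives are
ordinary ones, even at the end points in time. -/
theorem iteratedFDeriv_slice {S : ℝ} {W : Set (ℝ × F)} (hS : 0 < S) (hW : IsOpen W)
    {f : ℝ × F → G} (hf : ContDiffOn ℝ ∞ f ((Icc 0 S ×ˢ univ) ∩ W)) (m : ℕ) :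
    ∀ (e : Fin m → F), ∀ z ∈ (Icc 0 S ×ˢ univ) ∩ W,
      iteratedFDeriv ℝ m (fun y => f (z.1, y)) z.2 e
        = iteratedFDerivWithin ℝ m f ((Icc 0 S ×ˢ univ) ∩ W) z (fun l => (0, e l)) := by
  have hu : UniqueDiffOn ℝ ((Icc 0 S ×ˢ (univ : Set F)) ∩ W) := (uniqueDiffOn_strip hS).inter hW
  induction m with
  | zero => intro e z _; simp
  | succ m ih =>
    intro e z hz
    set A := (Icc 0 S ×ˢ (univ : Set F)) ∩ W with hA
    have hslice : {y | (z.1, y) ∈ A} ∈ 𝓝 z.2 := by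
      have : (fun y => (z.1, y)) ⁻¹' W ∈ 𝓝 z.2 :=
        (hW.preimage (by fun_prop)).mem_nhds hz.2
      filter_upwards [this] with y hy using ⟨⟨hz.1.1, mem_univ _⟩, hy⟩
    have hsm : ContDiffAt ℝ ∞ (fun y => f (z.1, y)) z.2 := by
      have h1 : ContDiffOn ℝ ∞ (fun y => f (z.1, y)) {y | (z.1, y) ∈ A} :=
        hf.comp (contDiffOn_const.prodMk contDiffOn_id) fun y hy => hy
      exact h1.contDiffAt hslice
    rw [iteratedFDeriv_succ_apply_left, iteratedFDerivWithin_succ_apply_left]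
    have hd1 : HasFDerivAt (iteratedFDeriv ℝ m fun y => f (z.1, y)) _ z.2 :=
      ((hsm.iteratedFDeriv_right (m := 1) (i := m)
        (by norm_cast; simp)).differentiableAt (by simp)).hasFDerivAt
    have hd1' : HasFDerivAt (fun y => iteratedFDeriv ℝ m (fun y => f (z.1, y)) y (Fin.tail e)) _ z.2 :=
      (ContinuousMultilinearMap.apply ℝ (fun _ : Fin m => F) G (Fin.tail e)).hasFDerivAt.comp z.2 hd1
    have hd2 : HasFDerivWithinAt (iteratedFDerivWithin ℝ m f A) _ A z :=
      (hf.differentiableOn_iteratedFDerivWithin (m := m)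
        (by exact_mod_cast WithTop.coe_lt_top m) hu z hz).hasFDerivWithinAt
    have hd2' : HasFDerivWithinAt (fun p => iteratedFDerivWithin ℝ m f A p
        (fun l => ((0 : ℝ), Fin.tail e l))) _ A z :=
      (ContinuousMultilinearMap.apply ℝ (fun _ : Fin m => ℝ × F) G
        (fun l => ((0 : ℝ), Fin.tail e l))).hasFDerivAt.comp_hasFDerivWithinAt z hd2
    have hline : HasFDerivWithinAt (fun y : F => ((z.1, y) : ℝ × F))
        ((0 : F →L[ℝ] ℝ).prod (ContinuousLinearMap.id ℝ F)) {y | (z.1, y) ∈ A} z.2 :=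
      (hasFDerivWithinAt_const z.1 z.2 _).prodMk (hasFDerivWithinAt_id _ _)
    have hd3 := (hd2'.comp z.2 hline (fun y hy => hy)).hasFDerivAt hslice
    have heq : (fun y => iteratedFDeriv ℝ m (fun y => f (z.1, y)) y (Fin.tail e))
        =ᶠ[𝓝 z.2] ((fun p => iteratedFDerivWithin ℝ m f A p
        (fun l => ((0 : ℝ), Fin.tail e l))) ∘ fun y => (z.1, y)) := by
      filter_upwards [hslice] with y hy using ih (Fin.tail e) (z.1, y) hy
    have := (hd1'.congr_of_eventuallyEq heq.symm).unique hd3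
    exact congrArg (fun L => L (e 0)) this

/-- Each time derivative inserts the vector `(1, 0)` of norm one. Only the product of the norms of
the test vectors matters afterwards. -/
theorem exists_iteratedDerivWithin_slice {S : ℝ} {W : Set (ℝ × F)} (hS : 0 < S) (hW : IsOpen W)
    {f : ℝ × F → G} (hf : ContDiffOn ℝ ∞ f ((Icc 0 S ×ˢ univ) ∩ W)) {m : ℕ} (v : Fin m → ℝ × F)
    (x : F) (k : ℕ) : ∃ w : Fin (m + k) → ℝ × F, (∏ l, ‖w l‖ = ∏ l, ‖v l‖) ∧
      ∀ t, (t, x) ∈ (Icc 0 S ×ˢ univ) ∩ W →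
      iteratedDerivWithin k
        (fun s => iteratedFDerivWithin ℝ m f ((Icc 0 S ×ˢ univ) ∩ W) (s, x) v) (Icc 0 S) t
        = iteratedFDerivWithin ℝ (m + k) f ((Icc 0 S ×ˢ univ) ∩ W) (t, x) w := by
  have hu : UniqueDiffOn ℝ ((Icc 0 S ×ˢ (univ : Set F)) ∩ W) := (uniqueDiffOn_strip hS).inter hW
  induction k with
  | zero => exact ⟨v, rfl, fun t ht => by simp⟩
  | succ k ih =>
    obtain ⟨w, hw, H⟩ := ih
    set A := (Icc 0 S ×ˢ (univ : Set F)) ∩ W with hA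
    refine ⟨Fin.cons (α := fun _ => ℝ × F) (1, 0) w, ?_, fun t ht => ?_⟩
    · refine (Fin.prod_univ_succ (n := m + k)
        (fun l => ‖(Fin.cons (α := fun _ => ℝ × F) (1, 0) w : Fin (m + k + 1) → ℝ × F) l‖)).trans ?_
      have h1 : ‖((1, 0) : ℝ × F)‖ = 1 := by simp [Prod.norm_def]
      simp only [Fin.cons_zero, Fin.cons_succ, hw, h1, one_mul]
    · have hI : {s | (s, x) ∈ A} ∈ 𝓝[Icc 0 S] t := by
        have : (fun s => (s, x)) ⁻¹' W ∈ 𝓝 t := (hW.preimage (by fun_prop)).mem_nhds ht.2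
        filter_upwards [self_mem_nhdsWithin, nhdsWithin_le_nhds this] with s hs hs'
          using ⟨⟨hs, mem_univ _⟩, hs'⟩
      have hd2 : HasFDerivWithinAt (iteratedFDerivWithin ℝ (m + k) f A) _ A (t, x) :=
        (hf.differentiableOn_iteratedFDerivWithin (m := m + k)
          (by exact_mod_cast WithTop.coe_lt_top _) hu _ ht).hasFDerivWithinAt
      have hd2' : HasFDerivWithinAt (fun p => iteratedFDerivWithin ℝ (m + k) f A p w) _ A (t, x) :=
        (ContinuousMultilinearMap.apply ℝ (fun _ : Fin (m + k) => ℝ × F) G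
          w).hasFDerivAt.comp_hasFDerivWithinAt (t, x) hd2
      have hline : HasDerivWithinAt (fun s : ℝ => ((s, x) : ℝ × F)) ((1, 0) : ℝ × F)
          {s | (s, x) ∈ A} t :=
        (hasDerivWithinAt_id t _).prodMk (hasDerivWithinAt_const t _ x)
      have hd3 := (hd2'.comp_hasDerivWithinAt t hline (fun s hs => hs)).mono_of_mem_nhdsWithin hI
      rw [iteratedDerivWithin_succ]
      have heq : (iteratedDerivWithin k
          (fun s => iteratedFDerivWithin ℝ m f A (s, x) v) (Icc 0 S)) =ᶠ[𝓝[Icc 0 S] t]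
          ((fun p => iteratedFDerivWithin ℝ (m + k) f A p w) ∘ fun s => (s, x)) := by
        filter_upwards [hI] with s hs using H s hs
      rw [heq.derivWithin_eq (H t ht), hd3.derivWithin (uniqueDiffOn_Icc hS t ht.1.1)]
      refine Eq.trans ?_ (iteratedFDerivWithin_succ_apply_left (n := m + k) _).symm
      simp [Fin.tail_cons]

/-- Mixed partial derivatives are bounded by the total derivative. -/
theorem abs_iteratedDerivWithin_iteratedFDeriv_le {S : ℝ} {W : Set (ℝ × F)} (hS : 0 < S)
    (hW : IsOpen W) {f : ℝ × F → ℝ} {k m n : ℕ} {C t : ℝ} {x : F}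
    (hf : JetBound ((Icc 0 S ×ˢ univ) ∩ W) (t, x) n C f) (hkm : m + k ≤ n)
    (ht : (t, x) ∈ (Icc 0 S ×ˢ univ) ∩ W) {e : Fin m → F} (he : ∀ l, ‖e l‖ ≤ 1) :
    |iteratedDerivWithin k (fun s => iteratedFDeriv ℝ m (fun y => f (s, y)) x e) (Icc 0 S) t|
      ≤ C := by
  obtain ⟨w, hw, H⟩ := exists_iteratedDerivWithin_slice hS hW hf.smooth (fun l => ((0 : ℝ), e l)) x k
  have hI : {s | (s, x) ∈ (Icc 0 S ×ˢ (univ : Set F)) ∩ W} ∈ 𝓝[Icc 0 S] t := by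
    have : (fun s => (s, x)) ⁻¹' W ∈ 𝓝 t := (hW.preimage (by fun_prop)).mem_nhds ht.2
    filter_upwards [self_mem_nhdsWithin, nhdsWithin_le_nhds this] with s hs hs'
      using ⟨⟨hs, mem_univ _⟩, hs'⟩
  have heq : (fun s => iteratedFDeriv ℝ m (fun y => f (s, y)) x e) =ᶠ[𝓝[Icc 0 S] t]
      fun s => iteratedFDerivWithin ℝ m f ((Icc 0 S ×ˢ univ) ∩ W) (s, x)
        (fun l => ((0 : ℝ), e l)) := by
    filter_upwards [hI] with s hs using iteratedFDeriv_slice hS hW hf.smooth m e (s, x) hs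
  have heq2 := Filter.EventuallyEq.iteratedDerivWithin_eq heq
    (iteratedFDeriv_slice hS hW hf.smooth m e (t, x) ht) (n := k)
  rw [heq2, H t ht, ← Real.norm_eq_abs]
  refine (ContinuousMultilinearMap.le_opNorm _ _).trans ?_
  rw [hw]
  have h1 : ∏ l, ‖(((0 : ℝ), e l) : ℝ × F)‖ ≤ 1 :=
    Finset.prod_le_one (fun _ _ => norm_nonneg _) fun l _ => by simpa [Prod.norm_def] using he l
  calc _ ≤ C * 1 := mul_le_mul (hf.le (m + k) hkm) h1
        (Finset.prod_nonneg fun _ _ => norm_nonneg _) hf.nonneg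
    _ = C := mul_one C

end Jet

/-! ### The angular coordinate near a moving curve -/

/-- A smooth family of convex curves with radius of curvature at least `6 δ`. -/
structure IsMovingCurve (δ S : ℝ) (Y : ℝ → ℝ → Plane) : Prop where
  pos_width : 0 < δ
  pos_time : 0 < S
  smooth : ContDiffOn ℝ ∞ (fun p : ℝ × ℝ => Y p.1 p.2) (Icc 0 S ×ˢ univ)
  gauss : ∀ t ∈ Icc 0 S, IsGaussCurve (Y t)
  le_radius : ∀ t ∈ Icc 0 S, ∀ θ, 6 * δ ≤ ‖deriv (Y t) θ‖

namespace IsMovingCurve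

variable {δ S : ℝ} {Y : ℝ → ℝ → Plane}

theorem eventually_norm_sub_le (h : IsMovingCurve δ S Y) {t₁ : ℝ} (ht₁ : t₁ ∈ Icc 0 S) {ε : ℝ}
    (hε : 0 < ε) : ∀ᶠ t in 𝓝[Icc 0 S] t₁, ∀ ψ, ‖Y t ψ - Y t₁ ψ‖ ≤ ε := by
  have hK : IsCompact (Icc 0 S ×ˢ Icc 0 (2 * Real.pi)) := isCompact_Icc.prod isCompact_Icc
  have hu := hK.uniformContinuousOn_of_continuous
    (h.smooth.continuousOn.mono (prod_mono_right (subset_univ _)))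
  obtain ⟨r, hr, H⟩ := Metric.uniformContinuousOn_iff.1 hu ε hε
  filter_upwards [self_mem_nhdsWithin, nhdsWithin_le_nhds (Metric.ball_mem_nhds t₁ hr)]
    with t ht htr ψ
  have hp : Function.Periodic (fun ψ => ‖Y t ψ - Y t₁ ψ‖) (2 * Real.pi) := fun ψ => by
    simp only [(h.gauss t ht).periodic ψ, (h.gauss t₁ ht₁).periodic ψ]
  obtain ⟨ψ', hψ', e⟩ := hp.exists_mem_Ico₀ Real.two_pi_pos ψ
  have e' : ‖Y t ψ - Y t₁ ψ‖ = ‖Y t ψ' - Y t₁ ψ'‖ := e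
  rw [e', ← dist_eq_norm]
  refine (H (t, ψ') ⟨ht, Ico_subset_Icc_self hψ'⟩ (t₁, ψ') ⟨ht₁, Ico_subset_Icc_self hψ'⟩ ?_).le
  rw [Prod.dist_eq, dist_self]
  exact max_lt htr hr

theorem gaussAngle_spec (h : IsMovingCurve δ S Y) {t : ℝ} (ht : t ∈ Icc 0 S) {x : Plane}
    (hx : |curveSignedDist (Y t) x| < 3 * δ) : gaussAngle Y t x ∈ Ico 0 (2 * Real.pi) ∧
      Y t (gaussAngle Y t x) + curveSignedDist (Y t) x • unitNormal (gaussAngle Y t x) = x := by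
  have hex := (h.gauss t ht).exists_normal_coordinate (h.le_radius t ht)
    (hx.trans (by linarith [h.pos_width]))
  rw [gaussAngle, dif_pos hex]
  exact hex.choose_spec

/-- Radii of at least `6δ` and `r + r₁ > -6δ` leave the monotonicity constant `3δ`. -/
theorem norm_unitNormal_sub_le (h : IsMovingCurve δ S Y) {t t₁ : ℝ} (ht : t ∈ Icc 0 S) {x x₁ : Plane}
    {φ φ₁ r r₁ : ℝ} (hr : |r| < 3 * δ) (hr₁ : |r₁| < 3 * δ) (hx : Y t φ + r • unitNormal φ = x)
    (hx₁ : Y t₁ φ₁ + r₁ • unitNormal φ₁ = x₁) :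
    ‖unitNormal φ - unitNormal φ₁‖ ≤ (‖x - x₁‖ + ‖Y t φ₁ - Y t₁ φ₁‖) / (3 * δ) := by
  have := _root_.norm_unitNormal_sub_le (h.gauss t ht) (h.le_radius t ht) (c := 3 * δ)
    (r := r) (r' := r₁) (φ := φ) (ψ := φ₁) (Γ' := Y t₁) (by linarith [h.pos_width])
    (by linarith [(abs_lt.1 hr).1, (abs_lt.1 hr₁).1])
  rwa [hx, hx₁] at this

theorem existsUnique_coordinates (h : IsMovingCurve δ S Y) {t : ℝ} (ht : t ∈ Icc 0 S) {x : Plane}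
    (hx : |curveSignedDist (Y t) x| < 3 * δ) :
    ∃! p : ℝ × ℝ, p.1 ∈ Ico (0 : ℝ) (2 * Real.pi) ∧ |p.2| < 3 * δ ∧
      Y t p.1 + p.2 • unitNormal p.1 = x := by
  obtain ⟨h1, h2⟩ := h.gaussAngle_spec ht hx
  refine ⟨(gaussAngle Y t x, curveSignedDist (Y t) x), ⟨h1, hx, h2⟩, ?_⟩
  rintro ⟨φ, r⟩ ⟨hφ, hr, e⟩
  have hn := h.norm_unitNormal_sub_le ht (t₁ := t) hr hx e h2
  rw [sub_self, sub_self, norm_zero, add_zero, zero_div] at hn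
  have hφ' : φ = gaussAngle Y t x :=
    unitNormal_injOn hφ h1 (sub_eq_zero.1 (norm_le_zero_iff.1 hn))
  have hr' : curveSignedDist (Y t) (Y t φ + r • unitNormal φ) = r :=
    (h.gauss t ht).curveSignedDist_add_smul
      (fun θ => by linarith [(abs_lt.1 hr).1, h.le_radius t ht θ, h.pos_width]) φ
  rw [show Y t φ + r • unitNormal φ = x from e] at hr'
  rw [hφ', hr']

/-- The coordinates persist, and the angle varies continuously in the circle. -/
theorem eventually_unitNormal_gaussAngle (h : IsMovingCurve δ S Y) {t₁ : ℝ} (ht₁ : t₁ ∈ Icc 0 S)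
    {x₁ : Plane} (hx₁ : |curveSignedDist (Y t₁) x₁| < 3 * δ) {ε : ℝ} (hε : 0 < ε) :
    ∀ᶠ z in 𝓝[Icc 0 S ×ˢ univ] (t₁, x₁), |curveSignedDist (Y z.1) z.2| < 3 * δ ∧
      ‖unitNormal (gaussAngle Y z.1 z.2) - unitNormal (gaussAngle Y t₁ x₁)‖ ≤ ε := by
  have hδ := h.pos_width
  set g := 3 * δ - |curveSignedDist (Y t₁) x₁| with hg
  have hg0 : 0 < g := by linarith
  -- With `η ≤ g/3` the perturbed distance stays below `3δ`, as it grows by at most `2η`. The other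
  -- bound makes `2η/(3δ) ≤ ε`.
  set η := min (g / 3) (ε * (3 * δ) / 2) with hη
  have hη0 : 0 < η := lt_min (by positivity) (by positivity)
  have hη1 : η ≤ g / 3 := min_le_left _ _
  have hη2 : η ≤ ε * (3 * δ) / 2 := min_le_right _ _
  have hfst : Tendsto (fun z : ℝ × Plane => z.1) (𝓝[Icc 0 S ×ˢ univ] (t₁, x₁)) (𝓝[Icc 0 S] t₁) :=
    tendsto_nhdsWithin_of_tendsto_nhds_of_eventually_within _
      ((continuous_fst.tendsto (t₁, x₁)).mono_left nhdsWithin_le_nhds)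
      (by filter_upwards [self_mem_nhdsWithin] with z hz using hz.1)
  have hsnd : Tendsto (fun z : ℝ × Plane => z.2) (𝓝[Icc 0 S ×ˢ univ] (t₁, x₁)) (𝓝 x₁) :=
    (continuous_snd.tendsto (t₁, x₁)).mono_left nhdsWithin_le_nhds
  filter_upwards [self_mem_nhdsWithin, hfst.eventually (h.eventually_norm_sub_le ht₁ hη0),
    hsnd.eventually (Metric.ball_mem_nhds x₁ hη0)] with z hz hY hzx
  have hzx' : ‖z.2 - x₁‖ ≤ η := by
    rw [← dist_eq_norm]; exact (Metric.mem_ball.1 hzx).le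
  have hd : |curveSignedDist (Y z.1) z.2| < 3 * δ := by
    obtain ⟨-, e⟩ := h.gaussAngle_spec ht₁ hx₁
    rw [IsGaussCurve.abs_curveSignedDist]
    set φ := gaussAngle Y t₁ x₁
    have e1 : dist z.2 (Y z.1 φ) ≤ η + |curveSignedDist (Y t₁) x₁| + η := by
      rw [dist_eq_norm]
      have : z.2 - Y z.1 φ = (z.2 - x₁) + curveSignedDist (Y t₁) x₁ • unitNormal φ
          - (Y z.1 φ - Y t₁ φ) := by
        rw [eq_sub_of_add_eq' e]; abel
      rw [this]
      refine (norm_sub_le _ _).trans (add_le_add ((norm_add_le _ _).trans (add_le_add hzx' ?_))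
        (hY φ))
      rw [norm_smul, norm_unitNormal, mul_one, Real.norm_eq_abs]
    have e2 := (Metric.infDist_le_dist_of_mem (mem_range_self (f := Y z.1) φ)).trans e1
    linarith
  refine ⟨hd, ?_⟩
  refine (h.norm_unitNormal_sub_le hz.1 hd hx₁ (h.gaussAngle_spec hz.1 hd).2
    (h.gaussAngle_spec ht₁ hx₁).2).trans ?_
  rw [div_le_iff₀ (by positivity)]
  linarith [hY (gaussAngle Y t₁ x₁)]

end IsMovingCurve

/-! ### The real-valued branch of the angle -/

theorem exists_angleBranch_eq (Y : ℝ → ℝ → Plane) (t : ℝ) (x : Plane) (s : ℝ) (y : Plane) :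
    ∃ k : ℤ, angleBranch Y t x s y = gaussAngle Y s y - k • (2 * Real.pi) :=
  ⟨_, (self_sub_toIcoDiv_zsmul Real.two_pi_pos _ _).symm⟩

theorem unitNormal_angleBranch (Y : ℝ → ℝ → Plane) (t : ℝ) (x : Plane) (s : ℝ) (y : Plane) :
    unitNormal (angleBranch Y t x s y) = unitNormal (gaussAngle Y s y) := by
  obtain ⟨k, hk⟩ := exists_angleBranch_eq Y t x s y
  rw [hk, periodic_unitNormal.sub_zsmul_eq]

theorem abs_angleBranch_sub_le (Y : ℝ → ℝ → Plane) (t : ℝ) (x : Plane) (s : ℝ) (y : Plane) :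
    |angleBranch Y t x s y - gaussAngle Y t x| ≤ Real.pi := by
  have := toIcoMod_mem_Ico Real.two_pi_pos (gaussAngle Y t x - Real.pi) (gaussAngle Y s y)
  rw [abs_le]; unfold angleBranch
  constructor <;> linarith [this.1, this.2]

/-- The equation `⟨x - Y (t, φ), e(φ)⟩ = 0` for the angle, with the tangent vectors `e(φ)`. -/
noncomputable def angleEquation (Y : ℝ → ℝ → Plane) (q : (ℝ × Plane) × ℝ) : ℝ :=
  (q.1.2 0 - Y q.1.1 q.2 0) * (-Real.sin q.2) + (q.1.2 1 - Y q.1.1 q.2 1) * Real.cos q.2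

theorem angleEquation_eq_inner (Y : ℝ → ℝ → Plane) (t φ : ℝ) (x : Plane) :
    angleEquation Y ((t, x), φ) = inner ℝ (x - Y t φ) (unitTangent φ) := by
  simp [angleEquation, Plane.inner_eq]

theorem contDiffOn_angleEquation {S : ℝ} {Y : ℝ → ℝ → Plane}
    (hY : ContDiffOn ℝ ∞ (fun p : ℝ × ℝ => Y p.1 p.2) (Icc 0 S ×ˢ univ)) :
    ContDiffOn ℝ ∞ (angleEquation Y) ((Icc 0 S ×ˢ univ) ×ˢ univ) := by
  have h1 : ContDiffOn ℝ ∞ (fun q : (ℝ × Plane) × ℝ => Y q.1.1 q.2) ((Icc 0 S ×ˢ univ) ×ˢ univ) :=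
    hY.comp (f := fun q : (ℝ × Plane) × ℝ => (q.1.1, q.2)) (by fun_prop)
      fun q hq => ⟨hq.1.1, mem_univ _⟩
  have h2 : ∀ b : Fin 2, ContDiffOn ℝ ∞ (fun q : (ℝ × Plane) × ℝ => q.1.2 b - Y q.1.1 q.2 b)
      ((Icc 0 S ×ˢ univ) ×ˢ univ) := fun b =>
    (EuclideanSpace.proj (𝕜 := ℝ) b).contDiff.comp_contDiffOn
      (contDiffOn_fst.snd.sub h1)
  exact ((h2 0).mul (Real.contDiff_sin.comp_contDiffOn contDiffOn_snd).neg).add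
    ((h2 1).mul (Real.contDiff_cos.comp_contDiffOn contDiffOn_snd))

theorem jetBound_sin (φ : ℝ) (n : ℕ) : JetBound univ φ n 1 Real.sin :=
  ⟨Real.contDiff_sin.contDiffOn, fun i _ => by
    rw [iteratedFDerivWithin_univ, norm_iteratedFDeriv_eq_norm_iteratedDeriv]
    exact Real.abs_iteratedDeriv_sin_le_one i φ⟩

theorem jetBound_cos (φ : ℝ) (n : ℕ) : JetBound univ φ n 1 Real.cos :=
  ⟨Real.contDiff_cos.contDiffOn, fun i _ => by
    rw [iteratedFDerivWithin_univ, norm_iteratedFDeriv_eq_norm_iteratedDeriv]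
    exact Real.abs_iteratedDeriv_cos_le_one i φ⟩

theorem exists_jetBound_angleEquation (n : ℕ) (R C : ℝ) : ∃ B, ∀ (S : ℝ) (Y : ℝ → ℝ → Plane),
    0 < S → ∀ t ∈ Icc 0 S, ∀ (x : Plane) (φ : ℝ), ‖x‖ ≤ R →
      (∀ b : Fin 2, JetBound (Icc 0 S ×ˢ univ) (t, φ) n C fun p : ℝ × ℝ => Y p.1 p.2 b) →
      JetBound ((Icc 0 S ×ˢ univ) ×ˢ univ) ((t, x), φ) n B (angleEquation Y) := by
  set L₁ : Fin 2 → ((ℝ × Plane) × ℝ →L[ℝ] ℝ) := fun b => (EuclideanSpace.proj (𝕜 := ℝ) b).comp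
    ((ContinuousLinearMap.snd ℝ ℝ Plane).comp (ContinuousLinearMap.fst ℝ (ℝ × Plane) ℝ)) with hL₁
  set L₂ : (ℝ × Plane) × ℝ →L[ℝ] ℝ × ℝ :=
    ((ContinuousLinearMap.fst ℝ ℝ Plane).comp (ContinuousLinearMap.fst ℝ (ℝ × Plane) ℝ)).prod
      (ContinuousLinearMap.snd ℝ (ℝ × Plane) ℝ) with hL₂
  set L₃ : (ℝ × Plane) × ℝ →L[ℝ] ℝ := ContinuousLinearMap.snd ℝ (ℝ × Plane) ℝ with hL₃
  -- The constant is read off from the final term. It must not involve `S`, `Y`, `t`, `x` or `φ`, so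
  -- the bound `R` replaces the norm of the point.
  apply Exists.intro
  intro S Y hS t ht x φ hx hY
  have hs : UniqueDiffOn ℝ ((Icc 0 S ×ˢ (univ : Set Plane)) ×ˢ (univ : Set ℝ)) :=
    (uniqueDiffOn_strip hS).prod uniqueDiffOn_univ
  have hz : ((t, x), φ) ∈ (Icc 0 S ×ˢ (univ : Set Plane)) ×ˢ (univ : Set ℝ) :=
    ⟨⟨ht, mem_univ _⟩, mem_univ _⟩
  have hx' : ∀ b, ‖L₁ b ((t, x), φ)‖ ≤ R := fun b => (PiLp.norm_apply_le x b).trans hx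
  have h1 := fun b => ((JetBound.clm (n := n) hs hz (L₁ b)).mono
    (add_le_add_left (hx' b) ‖L₁ b‖)).add hs hz
      ((JetBound.comp_clm hs hz (uniqueDiffOn_strip hS) (L := L₂) (hY b)
        (fun q hq => ⟨hq.1.1, mem_univ _⟩)).neg hs hz)
  have h2 := JetBound.comp_clm hs hz uniqueDiffOn_univ (L := L₃) (jetBound_sin φ n)
    (mapsTo_univ _ _)
  have h3 := JetBound.comp_clm hs hz uniqueDiffOn_univ (L := L₃) (jetBound_cos φ n)
    (mapsTo_univ _ _)
  refine (((h1 0).mul hs hz (h2.neg hs hz)).add hs hz ((h1 1).mul hs hz h3)).congr hz ?_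
  intro q _
  simp [angleEquation, hL₁, hL₂, hL₃, sub_eq_add_neg]

namespace IsMovingCurve

variable {δ S : ℝ} {Y : ℝ → ℝ → Plane}

theorem fderivWithin_angleEquation (h : IsMovingCurve δ S Y) {t : ℝ} (ht : t ∈ Icc 0 S)
    (x : Plane) (φ : ℝ) :
    fderivWithin ℝ (angleEquation Y) ((Icc 0 S ×ˢ univ) ×ˢ univ) ((t, x), φ) (0, 1)
      = -(‖deriv (Y t) φ‖ + inner ℝ (x - Y t φ) (unitNormal φ)) := by
  have h1 := ((contDiffOn_angleEquation h.smooth).differentiableOn (by simp) ((t, x), φ)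
    ⟨⟨ht, mem_univ _⟩, mem_univ _⟩).hasFDerivWithinAt
  have h2 : HasDerivWithinAt (fun ψ : ℝ => (((t, x), ψ) : (ℝ × Plane) × ℝ)) (0, 1) univ φ :=
    ((hasDerivAt_const φ (t, x)).prodMk (hasDerivAt_id φ)).hasDerivWithinAt
  have h3 := h1.comp_hasDerivWithinAt φ h2
    (fun ψ _ => show ((t, x), ψ) ∈ (Icc 0 S ×ˢ univ) ×ˢ univ from ⟨⟨ht, mem_univ _⟩, mem_univ _⟩)
  have h4 : HasDerivAt (fun ψ => inner ℝ (x - Y t ψ) (unitTangent ψ))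
      (inner ℝ (x - Y t φ) (-unitNormal φ)
        + inner ℝ (-(‖deriv (Y t) φ‖ • unitTangent φ)) (unitTangent φ)) φ :=
    (((h.gauss t ht).hasDerivAt φ).const_sub x).inner ℝ (hasDerivAt_unitTangent φ)
  have h5 : angleEquation Y ∘ (fun ψ : ℝ => (((t, x), ψ) : (ℝ × Plane) × ℝ))
      = fun ψ => inner ℝ (x - Y t ψ) (unitTangent ψ) :=
    funext fun ψ => angleEquation_eq_inner Y t ψ x
  rw [h5, hasDerivWithinAt_univ] at h3
  rw [h3.unique h4, inner_neg_right, inner_neg_left, inner_smul_left, inner_unitTangent_self]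
  simp

theorem angleBranch_spec (h : IsMovingCurve δ S Y) {t : ℝ} (ht : t ∈ Icc 0 S) {x : Plane}
    (hx : |curveSignedDist (Y t) x| < 3 * δ) (t₀ : ℝ) (x₀ : Plane) :
    Y t (angleBranch Y t₀ x₀ t x)
      + curveSignedDist (Y t) x • unitNormal (angleBranch Y t₀ x₀ t x) = x := by
  rw [unitNormal_angleBranch]
  obtain ⟨k, hk⟩ := exists_angleBranch_eq Y t₀ x₀ t x
  rw [hk, (h.gauss t ht).periodic.sub_zsmul_eq]
  exact (h.gaussAngle_spec ht hx).2

theorem fderivWithin_angleEquation_le (h : IsMovingCurve δ S Y) {t : ℝ} (ht : t ∈ Icc 0 S)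
    {x : Plane} (hx : |curveSignedDist (Y t) x| < 3 * δ) (t₀ : ℝ) (x₀ : Plane) :
    3 * δ ≤ |fderivWithin ℝ (angleEquation Y) ((Icc 0 S ×ˢ univ) ×ˢ univ)
      ((t, x), angleBranch Y t₀ x₀ t x) (0, 1)| := by
  have e := h.angleBranch_spec ht hx t₀ x₀
  rw [h.fderivWithin_angleEquation ht]
  set φ := angleBranch Y t₀ x₀ t x
  have e1 : x - Y t φ = curveSignedDist (Y t) x • unitNormal φ := by
    nth_rewrite 1 [← e]; abel
  rw [e1, inner_smul_left, inner_unitNormal_self, abs_neg]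
  refine le_trans ?_ (le_abs_self _)
  simp only [conj_trivial, mul_one]
  linarith [h.le_radius t ht φ, (abs_lt.1 hx).1]

/-- Near a point of the tube, the branch of the angle is an implicit function. -/
theorem exists_isImplicitOn (h : IsMovingCurve δ S Y) {t : ℝ} (ht : t ∈ Icc 0 S) {x : Plane}
    (hx : |curveSignedDist (Y t) x| < 3 * δ) : ∃ W : Set (ℝ × Plane), (t, x) ∈ W ∧
      IsImplicitOn (Icc 0 S ×ˢ univ) W (angleEquation Y)
        (fun z => angleBranch Y t x z.1 z.2) := by
  -- A chord of length at most `1` keeps the branch within `π/2` of its base value. Two values on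
  -- `W` then differ by at most `π`, so the chord controls their difference and the representative
  -- modulo `2π` cannot jump.
  obtain ⟨W, hW, hmem, hsub⟩ := mem_nhdsWithin.1
    (h.eventually_unitNormal_gaussAngle ht hx (ε := 1) one_pos)
  have hpi := Real.pi_pos
  have key : ∀ z ∈ (Icc 0 S ×ˢ univ) ∩ W, |curveSignedDist (Y z.1) z.2| < 3 * δ ∧
      |angleBranch Y t x z.1 z.2 - gaussAngle Y t x| ≤ Real.pi / 2 := by
    intro z hz
    obtain ⟨h1, h2⟩ := hsub ⟨hz.2, hz.1⟩
    refine ⟨h1, (abs_sub_le_norm_unitNormal_sub (abs_angleBranch_sub_le Y t x z.1 z.2)).trans ?_⟩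
    rw [unitNormal_angleBranch]
    exact mul_le_of_le_one_right (by positivity) h2
  refine ⟨W, hmem, uniqueDiffOn_strip h.pos_time, hW, contDiffOn_angleEquation h.smooth, ?_, ?_, ?_⟩
  · intro z₁ hz₁
    rw [ContinuousWithinAt, Metric.tendsto_nhds]
    intro ε hε
    have h1 := h.eventually_unitNormal_gaussAngle hz₁.1.1 (key z₁ hz₁).1 (ε := ε / Real.pi)
      (by positivity)
    filter_upwards [self_mem_nhdsWithin, nhdsWithin_mono z₁ inter_subset_left h1] with z hz hn
    have h2 : |angleBranch Y t x z.1 z.2 - angleBranch Y t x z₁.1 z₁.2| ≤ Real.pi := by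
      have a := abs_le.1 (key z hz).2
      have b := abs_le.1 (key z₁ hz₁).2
      rw [abs_le]; constructor <;> linarith [a.1, a.2, b.1, b.2]
    have h3 := abs_sub_le_norm_unitNormal_sub h2
    rw [unitNormal_angleBranch, unitNormal_angleBranch] at h3
    rw [Real.dist_eq]
    refine h3.trans_lt ?_
    calc _ ≤ Real.pi / 2 * (ε / Real.pi) := by gcongr; exact hn.2
      _ = ε / 2 := by field_simp
      _ < ε := by linarith
  · intro z hz
    have e := h.angleBranch_spec hz.1.1 (key z hz).1 t x
    rw [show z = (z.1, z.2) from rfl, angleEquation_eq_inner]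
    set φ := angleBranch Y t x z.1 z.2
    have e1 : z.2 - Y z.1 φ = curveSignedDist (Y z.1) z.2 • unitNormal φ := by
      nth_rewrite 1 [← e]; abel
    rw [e1, inner_smul_left, inner_unitNormal_unitTangent, mul_zero]
  · intro z hz h0
    have := h.fderivWithin_angleEquation_le hz.1.1 (key z hz).1 t x
    rw [h0, abs_zero] at this
    linarith [h.pos_width]

theorem contDiffWithinAt_angleBranch (h : IsMovingCurve δ S Y) {t : ℝ} (ht : t ∈ Icc 0 S)
    {x : Plane} (hx : |curveSignedDist (Y t) x| < 3 * δ) :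
    ContDiffWithinAt ℝ ∞ (fun p : ℝ × Plane => angleBranch Y t x p.1 p.2) (Icc 0 S ×ˢ univ)
      (t, x) := by
  obtain ⟨W, hmem, hW⟩ := h.exists_isImplicitOn ht hx
  exact (hW.contDiffOn (t, x) ⟨⟨ht, mem_univ _⟩, hmem⟩).mono_of_mem_nhdsWithin
    (inter_mem_nhdsWithin _ (hW.isOpen.mem_nhds hmem))

end IsMovingCurve

/-- The derivatives of the angle are bounded by those of the parametrization. -/
theorem exists_abs_derivAngle_le {δ : ℝ} (hδ : 0 < δ) (n : ℕ) (R C : ℝ) : ∃ B,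
    ∀ (S : ℝ) (Y : ℝ → ℝ → Plane), IsMovingCurve δ S Y → (∀ t ∈ Icc 0 S, ∀ θ, ‖Y t θ‖ ≤ R) →
      (∀ b : Fin 2, ∀ k ≤ n, ∀ z ∈ Icc 0 S ×ˢ univ, ‖iteratedFDerivWithin ℝ k
        (fun p : ℝ × ℝ => Y p.1 p.2 b) (Icc 0 S ×ˢ univ) z‖ ≤ C) →
      ∀ t ∈ Icc 0 S, ∀ x, |curveSignedDist (Y t) x| < 3 * δ → ∀ k m, m + k ≤ n →
        ∀ j : Fin m → Fin 2, |derivAngle Y S k j t x| ≤ B := by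
  obtain ⟨B₁, hB₁⟩ := exists_jetBound_angleEquation n (R + 3 * δ) C
  -- `3δ` is the lower bound of the `φ`-derivative of the equation on the tube. The branch lies
  -- within `π` of an angle in `[0, 2π)`, hence the bound `3π`.
  obtain ⟨B, hB⟩ := exists_jetBound_implicit (ℝ × Plane) n (c := 3 * δ) (by positivity) B₁
    (3 * Real.pi)
  refine ⟨B, fun S Y h hR hC t ht x hx k m hkm j => ?_⟩
  obtain ⟨W, hmem, hW⟩ := h.exists_isImplicitOn ht hx
  have hz : (t, x) ∈ (Icc 0 S ×ˢ (univ : Set Plane)) ∩ W := ⟨⟨ht, mem_univ _⟩, hmem⟩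
  obtain ⟨h1, h2⟩ := h.gaussAngle_spec ht hx
  have hx' : ‖x‖ ≤ R + 3 * δ := by
    rw [← h2]
    refine (norm_add_le _ _).trans (add_le_add (hR t ht _) ?_)
    rw [norm_smul, norm_unitNormal, mul_one]
    exact hx.le
  have hJ := hB _ W _ _ (t, x) hW hz
    (hB₁ S Y h.pos_time t ht x (angleBranch Y t x t x) hx' fun b =>
      ⟨(EuclideanSpace.proj (𝕜 := ℝ) b).contDiff.comp_contDiffOn h.smooth,
        fun i hi => hC b i hi _ ⟨ht, mem_univ _⟩⟩)
    (by
      have a := abs_le.1 (abs_angleBranch_sub_le Y t x t x)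
      rw [abs_le]
      constructor <;> linarith [h1.1, h1.2, a.1, a.2, Real.pi_pos])
    (h.fderivWithin_angleEquation_le ht hx t x)
  exact abs_iteratedDerivWithin_iteratedFDeriv_le h.pos_time hW.isOpen hJ hkm hz
    fun l => by simp

/-! ### Rescaling time -/

section Scaling

open scoped Pointwise

theorem iteratedDerivWithin_comp_mul_left {F : Type*} [NormedAddCommGroup F] [NormedSpace ℝ F]
    (a : ℝ) (f : ℝ → F) (s : Set ℝ) (k : ℕ) {x : ℝ} (hx : x ∈ s) :
    iteratedDerivWithin k (fun y => f (a * y)) s x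
      = a ^ k • iteratedDerivWithin k f (a • s) (a * x) := by
  induction k generalizing x with
  | zero => simp
  | succ k ih =>
    rw [iteratedDerivWithin_succ, derivWithin_congr (fun y hy => ih hy) (ih hx),
      derivWithin_fun_const_smul_field,
      derivWithin_comp_mul_left a (iteratedDerivWithin k f (a • s)) s x, iteratedDerivWithin_succ,
      smul_smul, pow_succ]

theorem iteratedDerivWithin_Icc_comp_mul_left {F : Type*} [NormedAddCommGroup F] [NormedSpace ℝ F]
    {a T : ℝ} (ha : 0 < a) (f : ℝ → F) (k : ℕ) {x : ℝ} (hx : x ∈ Icc 0 (a⁻¹ * T)) :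
    iteratedDerivWithin k (fun y => f (a * y)) (Icc 0 (a⁻¹ * T)) x
      = a ^ k • iteratedDerivWithin k f (Icc 0 T) (a * x) := by
  rw [iteratedDerivWithin_comp_mul_left a f _ k hx, LinearOrderedField.smul_Icc ha, mul_zero,
    mul_inv_cancel_left₀ ha.ne']

theorem iteratedDeriv_comp_mul_left {a : ℝ} (ha : a ≠ 0) (f : ℝ → ℝ) (k : ℕ) (x : ℝ) :
    iteratedDeriv k (fun y => f (a * y)) x = a ^ k * iteratedDeriv k f (a * x) := by
  rw [← iteratedDerivWithin_univ, iteratedDerivWithin_comp_mul_left a f univ k (mem_univ x),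
    smul_set_univ₀ ha, iteratedDerivWithin_univ, smul_eq_mul]

end Scaling

theorem derivX_comp_mul_left {a T : ℝ} (ha : 0 < a) (X : ℝ → ℝ → Plane) (k m : ℕ) (i : Fin 2)
    {t : ℝ} (ht : t ∈ Icc 0 (a⁻¹ * T)) (θ : ℝ) :
    derivX (fun s => X (a * s)) (a⁻¹ * T) k m i t θ = a ^ k * derivX X T k m i (a * t) θ :=
  iteratedDerivWithin_Icc_comp_mul_left ha (fun s => iteratedDeriv m (fun φ => X s φ i) θ) k ht

theorem derivAngle_comp_mul_left {a T : ℝ} (ha : 0 < a) (X : ℝ → ℝ → Plane) (k : ℕ) {m : ℕ}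
    (j : Fin m → Fin 2) {t : ℝ} (ht : t ∈ Icc 0 (a⁻¹ * T)) (x : Plane) :
    derivAngle (fun s => X (a * s)) (a⁻¹ * T) k j t x = a ^ k * derivAngle X T k j (a * t) x :=
  iteratedDerivWithin_Icc_comp_mul_left ha (fun s => iteratedFDeriv ℝ m
    (angleBranch X (a * t) x s) x (fun l => EuclideanSpace.single (j l) (1 : ℝ))) k ht

/-! ### The forced flow in the time scale of its forcing -/

theorem IsGaussCurve.averageCurvature_eq {Γ : ℝ → Plane} (h : IsGaussCurve Γ) :
    averageCurvature Γ = (curveLength Γ)⁻¹ * (2 * Real.pi) := by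
  have : ∀ θ, curvature Γ θ * ‖deriv Γ θ‖ = 1 := fun θ =>
    inv_mul_cancel₀ (h.norm_deriv_pos θ).ne'
  simp [averageCurvature, this]

theorem abs_iteratedDerivWithin_le_timeNorm {v : ℝ → ℝ} (hv : ContDiffOn ℝ ∞ v (Ici 0)) {N i : ℕ}
    (hi : i ≤ N) {T t : ℝ} (ht : t ∈ Icc 0 T) :
    |iteratedDerivWithin i v (Ici 0) t| ≤ timeNorm N T v := by
  have hc : ContinuousOn (fun t => |iteratedDerivWithin i v (Ici 0) t|) (Icc 0 T) :=
    ((hv.continuousOn_iteratedDerivWithin (natCast_le_smooth i) (uniqueDiffOn_Ici 0)).mono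
      Icc_subset_Ici_self).abs
  have hb : BddAbove (range fun t : Icc (0 : ℝ) T => |iteratedDerivWithin i v (Ici 0) t|) := by
    have := isCompact_Icc.bddAbove_image hc
    rwa [image_eq_range] at this
  refine (le_ciSup hb ⟨t, ht⟩).trans ?_
  refine Finset.single_le_sum
    (f := fun i => ⨆ t : Icc (0 : ℝ) T, |iteratedDerivWithin i v (Ici 0) t|)
    (fun i _ => Real.iSup_nonneg fun _ => abs_nonneg _) (Finset.mem_range.2 (by omega))

theorem timeNorm_nonneg (N : ℕ) (T : ℝ) (v : ℝ → ℝ) : 0 ≤ timeNorm N T v :=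
  Finset.sum_nonneg fun _ _ => Real.iSup_nonneg fun _ => abs_nonneg _

namespace IsConvexFlow

variable {D : Set Plane} {Γ₀ : ℝ → Plane} {v : ℝ → ℝ} {σ : ℝ} {X : ℝ → ℝ → Plane}

/-- A convex flow in the time scale of its forcing. -/
theorem isScaledFlow (h : IsConvexFlow D Γ₀ v σ X) (hv : ContDiffOn ℝ ∞ v (Ici 0)) {R B T : ℝ}
    {m₀ n : ℕ} (hT : 0 < T) (hTσ : T ≤ σ) (hgeom : ∀ t ∈ Icc 0 T, ∀ θ, R ≤ ‖deriv (X t) θ‖ ∧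
      ‖deriv (X t) θ‖ ≤ B ∧ ‖X t θ‖ ≤ B ∧
      ∀ m ≤ m₀, ‖iteratedFDeriv ℝ m (curveSignedDist (X t)) (X t θ)‖ ≤ B) {a : ℝ}
    (ha : a = (1 + timeNorm n T v)⁻¹) :
    IsScaledFlow R B ((volume D).toReal / 2) m₀ n
      ⟨a⁻¹ * T, a, fun s => a * v (a * s), fun s => X (a * s)⟩ := by
  have hA := timeNorm_nonneg n T v
  have ha0 : 0 < a := by rw [ha]; positivity
  have ha1 : a ≤ 1 := by rw [ha]; exact inv_le_one_of_one_le₀ (by linarith)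
  have hmap : ∀ s ∈ Icc 0 (a⁻¹ * T), a * s ∈ Icc 0 T := fun s hs =>
    ⟨mul_nonneg ha0.le hs.1, by
      have := mul_le_mul_of_nonneg_left hs.2 ha0.le
      rwa [mul_inv_cancel_left₀ ha0.ne'] at this⟩
  have hmap' : ∀ s ∈ Ioo 0 (a⁻¹ * T), a * s ∈ Ioo 0 T := fun s hs =>
    ⟨mul_pos ha0 hs.1, by
      have := mul_lt_mul_of_pos_left hs.2 ha0
      rwa [mul_inv_cancel_left₀ ha0.ne'] at this⟩
  have hIcc : Icc 0 T ⊆ Icc 0 σ := Icc_subset_Icc_right hTσ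
  refine ⟨by positivity, ha0.le, ha1, ?_, fun s hs => h.gauss _ (hIcc (hmap s hs)),
    fun s hs θ => (hgeom _ (hmap s hs) θ).1, fun s hs θ => (hgeom _ (hmap s hs) θ).2.1,
    fun s hs θ => (hgeom _ (hmap s hs) θ).2.2.1, fun s hs θ => (hgeom _ (hmap s hs) θ).2.2.2,
    ?_, ?_, ?_⟩
  · exact h.smooth.comp (f := fun p : ℝ × ℝ => (a * p.1, p.2)) (by fun_prop)
      fun p hp => ⟨hIcc (hmap _ hp.1), mem_univ _⟩
  · intro s hs θ
    have ht := hmap' s hs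
    have h1 := h.velocity (a * s) (hIcc (Ioo_subset_Icc_self ht)) θ
    rw [derivWithin_of_mem_nhds (Icc_mem_nhds ht.1 (ht.2.trans_le hTσ)),
      (h.gauss _ (hIcc (Ioo_subset_Icc_self ht))).averageCurvature_eq] at h1
    have h2 := deriv_comp_mul_left a (fun t => X t θ) s
    change inner ℝ (deriv (fun s => X (a * s) θ) s) (unitNormal θ) = -(a * curvature (X (a * s)) θ)
      + (2 * Real.pi * a - (volume D).toReal / 2 * (a * v (a * s))) * (curveLength (X (a * s)))⁻¹
    rw [h2, inner_smul_left]
    simp only [conj_trivial]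
    rw [div_eq_mul_inv, mul_inv] at h1
    linear_combination (-a) * h1
  · refine contDiffOn_const.mul (hv.comp (by fun_prop) fun s hs => ?_)
    exact (hmap' s hs).1.le
  · intro s hs i hi
    have ht := hmap' s hs
    have hd : ContDiffAt ℝ i v (a * s) :=
      (hv.contDiffAt (Ici_mem_nhds ht.1)).of_le (natCast_le_smooth i)
    change |iteratedDeriv i (fun s => a * v (a * s)) s| ≤ 1
    rw [iteratedDeriv_const_mul_field, iteratedDeriv_comp_mul_left ha0.ne',
      ← iteratedDerivWithin_eq_iteratedDeriv (uniqueDiffOn_Ici 0) hd ht.1.le, abs_mul, abs_mul,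
      abs_of_pos ha0, abs_of_nonneg (by positivity : 0 ≤ a ^ i)]
    have h1 := abs_iteratedDerivWithin_le_timeNorm hv hi (Ioo_subset_Icc_self ht)
    have h2 : a ^ i ≤ 1 := pow_le_one₀ ha0.le ha1
    have h3 : a * (1 + timeNorm n T v) = 1 := by
      rw [ha]; exact inv_mul_cancel₀ (by positivity)
    calc a * (a ^ i * |iteratedDerivWithin i v (Ici 0) (a * s)|)
        ≤ a * (1 * timeNorm n T v) := by gcongr
      _ ≤ 1 := by nlinarith

/-- The derivatives of a convex flow with controlled geometry, and of its angular coordinate, are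
bounded by powers of the norm of the forcing. -/
theorem exists_deriv_bound (D : Set Plane) {δ B : ℝ} (hδ : 0 < δ) (hB : 0 < B) {m₀ n : ℕ}
    (hm₀ : 3 * n + 3 ≤ m₀) : ∃ C, 0 < C ∧ ∀ (Γ₀ : ℝ → Plane) (v : ℝ → ℝ) (σ : ℝ)
      (X : ℝ → ℝ → Plane), IsConvexFlow D Γ₀ v σ X → ContDiffOn ℝ ∞ v (Ici 0) → ∀ T, 0 < T → T ≤ σ →
      (∀ t ∈ Icc 0 T, ∀ θ, 6 * δ ≤ ‖deriv (X t) θ‖ ∧ ‖deriv (X t) θ‖ ≤ B ∧ ‖X t θ‖ ≤ B ∧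
        ∀ m ≤ m₀, ‖iteratedFDeriv ℝ m (curveSignedDist (X t)) (X t θ)‖ ≤ B) →
      ∀ t ∈ Icc 0 T, ∀ k m, k + m ≤ n →
        (∀ (i : Fin 2) (θ : ℝ), |derivX X T k m i t θ| ≤ C * (1 + timeNorm n T v) ^ n) ∧
        ∀ x, |curveSignedDist (X t) x| < 3 * δ → ∀ j : Fin m → Fin 2,
          |derivAngle X T k j t x| ≤ C * (1 + timeNorm n T v) ^ n := by
  obtain ⟨C₁, hC₁⟩ := ScaledFlow.exists_bound (R := 6 * δ) (B := B)
    (lam := (volume D).toReal / 2) hB (by positivity) hm₀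
  obtain ⟨C₂, hC₂⟩ := exists_abs_derivAngle_le hδ n B C₁
  refine ⟨|C₁| + |C₂| + 1, by positivity, ?_⟩
  intro Γ₀ v σ X h hv T hT hTσ hgeom t ht k m hkm
  set A := 1 + timeNorm n T v with hA
  have hA1 : 1 ≤ A := by linarith [timeNorm_nonneg n T v]
  have hA0 : 0 < A := by linarith
  have hF := h.isScaledFlow hv hT hTσ hgeom (n := n) (a := A⁻¹) rfl
  set a := A⁻¹ with ha
  have ha0 : 0 < a := by positivity
  have haA : a⁻¹ = A := inv_inv A
  have hs : a⁻¹ * t ∈ Icc 0 (a⁻¹ * T) :=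
    ⟨mul_nonneg (by positivity) ht.1, by have := ht.2; gcongr⟩
  have hat : a * (a⁻¹ * t) = t := mul_inv_cancel_left₀ ha0.ne' t
  have hM : IsMovingCurve δ (a⁻¹ * T) (fun s => X (a * s)) :=
    ⟨hδ, hF.S_pos, hF.smooth, hF.gauss, hF.le_radius⟩
  have hbd := hC₁ _ hF
  -- Undoing the time change multiplies a derivative of order `k` in time by `A ^ k`, which is at
  -- most `A ^ n`.
  have key : ∀ d C : ℝ, C ≤ |C₁| + |C₂| + 1 → |a ^ k * d| ≤ C →
      |d| ≤ (|C₁| + |C₂| + 1) * A ^ n := by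
    intro d C hC hd
    rw [abs_mul, abs_of_pos (pow_pos ha0 k)] at hd
    have h1 : A ^ k * a ^ k = 1 := by rw [← mul_pow, ha, mul_inv_cancel₀ hA0.ne', one_pow]
    calc |d| = A ^ k * (a ^ k * |d|) := by rw [← mul_assoc, h1, one_mul]
      _ ≤ A ^ n * (|C₁| + |C₂| + 1) := by
        refine mul_le_mul (pow_le_pow_right₀ hA1 (by omega)) (hd.trans hC) (by positivity)
          (by positivity)
      _ = _ := mul_comm _ _
  refine ⟨fun i θ => key _ C₁ (by linarith [le_abs_self C₁, abs_nonneg C₂]) ?_,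
    fun x hx j => key _ C₂ (by linarith [le_abs_self C₂, abs_nonneg C₁]) ?_⟩
  · have e := derivX_comp_mul_left ha0 X k m i hs θ
    rw [hat] at e
    rw [← e]
    have hJ : JetBound ((Icc 0 (a⁻¹ * T) ×ˢ univ) ∩ univ) (a⁻¹ * t, θ) n C₁
        (fun p : ℝ × ℝ => X (a * p.1) p.2 i) := by
      rw [inter_univ]
      exact ⟨contDiffOn_euclidean.1 hF.smooth i, fun l hl => hbd i l hl _ ⟨hs, mem_univ _⟩⟩
    have := abs_iteratedDerivWithin_iteratedFDeriv_le hF.S_pos isOpen_univ hJ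
      (k := k) (m := m) (by omega) ⟨⟨hs, mem_univ _⟩, mem_univ _⟩ (e := fun _ => 1) (by simp)
    simpa only [derivX, iteratedDeriv_eq_iteratedFDeriv] using this
  · have e := derivAngle_comp_mul_left ha0 X k j hs x
    rw [hat] at e
    rw [← e]
    refine hC₂ _ _ hM hF.norm_le hbd _ hs x ?_ k m (by omega) j
    rwa [hat]

end IsConvexFlow

/-! ### Hitting times of continuous adapted processes -/

section Hitting

variable {Ω : Type*} {mΩ : MeasurableSpace Ω}

/-- A continuous path attains its maximum on `[0, i]`, so the event says that values above `c -
1/(n+1)` occur for every `n`, and these are detected at countably many times. Cutting these times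
off at `i` gives measurability at time `i` without right-continuity of the filtration. -/
theorem measurableSet_exists_le_hitting {ℱ : Filtration ℝ≥0 mΩ} {g : ℝ≥0 → Ω → ℝ}
    (hc : ∀ o, Continuous fun t => g t o) (hm : ∀ t, Measurable[ℱ t] (g t)) (c : ℝ) (i : ℝ≥0) :
    MeasurableSet[ℱ i] {o | ∃ t ≤ i, c ≤ g t o} := by
  have e : {o | ∃ t ≤ i, c ≤ g t o} = ⋂ n : ℕ, ⋃ k : ℕ,
      {o | c - 1 / ((n : ℝ) + 1) < g (min (TopologicalSpace.denseSeq ℝ≥0 k) i) o} := by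
    ext o
    simp only [mem_iInter, mem_iUnion, mem_ofPred_eq]
    constructor
    · rintro ⟨t, hti, ht⟩ n
      have hopen : IsOpen {s | c - 1 / ((n : ℝ) + 1) < g (min s i) o} :=
        isOpen_lt continuous_const ((hc o).comp (continuous_id.min continuous_const))
      have hmem : t ∈ {s | c - 1 / ((n : ℝ) + 1) < g (min s i) o} := by
        have : 0 < 1 / ((n : ℝ) + 1) := by positivity
        change c - 1 / ((n : ℝ) + 1) < g (min t i) o
        rw [min_eq_left hti]; linarith
      obtain ⟨k, hs⟩ :=
        (TopologicalSpace.denseRange_denseSeq ℝ≥0).exists_mem_open hopen ⟨t, hmem⟩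
      exact ⟨k, hs⟩
    · intro H
      obtain ⟨t, ht, hmax⟩ := isCompact_Icc.exists_isMaxOn (s := Icc (0 : ℝ≥0) i)
        ⟨0, left_mem_Icc.2 (zero_le)⟩ (hc o).continuousOn
      refine ⟨t, ht.2, le_of_forall_pos_lt_add fun ε hε => ?_⟩
      obtain ⟨n, hn⟩ := exists_nat_one_div_lt hε
      obtain ⟨k, hk⟩ := H n
      have : g (min (TopologicalSpace.denseSeq ℝ≥0 k) i) o ≤ g t o :=
        hmax ⟨zero_le, min_le_right _ _⟩
      linarith
  rw [e]
  refine MeasurableSet.iInter fun n => MeasurableSet.iUnion fun k => ?_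
  exact measurableSet_lt measurable_const ((hm _).mono (ℱ.mono (min_le_right _ _)) le_rfl)

/-- A continuous adapted process that starts below the level `c` stays below it up to a positive
stopping time. -/
theorem exists_isStoppingTime_le {ℱ : Filtration ℝ≥0 mΩ} {g : ℝ≥0 → Ω → ℝ}
    (hc : ∀ o, Continuous fun t => g t o) (hm : ∀ t, Measurable[ℱ t] (g t)) {c : ℝ}
    (h0 : ∀ o, g 0 o < c) : ∃ τ : Ω → WithTop ℝ≥0, IsStoppingTime ℱ τ ∧
      ∀ o, 0 < τ o ∧ ∀ t : ℝ≥0, t ≤ τ o → g t o ≤ c := by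
  set τ : Ω → WithTop ℝ≥0 := fun o => sInf {a | ∃ t : ℝ≥0, c ≤ g t o ∧ a = t} with hτ
  -- By continuity the level is attained at the infimum whenever the latter is finite, so `τ o ≤ i`
  -- is an event of the past up to `i`.
  have hle : ∀ o (i : ℝ≥0), τ o ≤ i ↔ ∃ t ≤ i, c ≤ g t o := by
    intro o i
    constructor
    · intro hi
      by_contra! hn
      have hev : ∀ᶠ s in 𝓝[>] i, g s o < c :=
        nhdsWithin_le_nhds ((hc o).continuousAt.eventually_lt continuousAt_const (hn i le_rfl))
      obtain ⟨s, his, hs⟩ := mem_nhdsGT_iff_exists_Ioc_subset.1 hev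
      refine absurd (hi.trans_lt (WithTop.coe_lt_coe.2 his)) (not_lt.2 (le_sInf ?_))
      rintro _ ⟨t, ht, rfl⟩
      by_contra! hts
      have hts' : t < s := WithTop.coe_lt_coe.1 hts
      rcases le_or_gt t i with h | h
      · exact (hn t h).not_ge ht
      · exact (show g t o < c from hs ⟨h, hts'.le⟩).not_ge ht
    · rintro ⟨t, hti, ht⟩
      have hmem : (t : WithTop ℝ≥0) ∈ {a : WithTop ℝ≥0 | ∃ t : ℝ≥0, c ≤ g t o ∧ a = t} :=
        ⟨t, ht, rfl⟩
      exact (sInf_le hmem).trans (WithTop.coe_le_coe.2 hti)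
  refine ⟨τ, fun i => ?_, fun o => ⟨?_, fun t ht => ?_⟩⟩
  · simp only [hle]
    exact measurableSet_exists_le_hitting hc hm c i
  · by_contra! hn
    obtain ⟨t, ht, hct⟩ := (hle o 0).1 hn
    rw [nonpos_iff_eq_zero.1 ht] at hct
    exact (h0 o).not_ge hct
  · by_contra! hn
    have ht0 : 0 < t := by
      rcases eq_zero_or_pos t with h | h
      · rw [h] at hn; exact absurd hn (h0 o).not_gt
      · exact h
    have := nhdsLT_neBot_of_exists_lt ⟨0, ht0⟩
    obtain ⟨s, hst, hs⟩ := ((frequently_lt_nhds t).and_eventually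
      (continuousAt_const.eventually_lt (hc o).continuousAt hn)).exists
    have h1 : τ o ≤ s := (hle o s).2 ⟨s, le_rfl, hs.le⟩
    exact (ht.trans h1).not_gt (WithTop.coe_lt_coe.2 hst)

end Hitting

/-! ### Closeness of the flows to the initial curve up to a stopping time -/

theorem abs_ciSup_sub_ciSup_le {ι : Type*} [Nonempty ι] {f g : ι → ℝ} (hf : BddAbove (range f))
    (hg : BddAbove (range g)) {ε : ℝ} (h : ∀ i, |f i - g i| ≤ ε) :
    |(⨆ i, f i) - ⨆ i, g i| ≤ ε := by
  rw [abs_sub_le_iff, sub_le_iff_le_add, sub_le_iff_le_add]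
  exact ⟨ciSup_le fun i => by linarith [(abs_le.1 (h i)).2, le_ciSup hg i],
    ciSup_le fun i => by linarith [(abs_le.1 (h i)).1, le_ciSup hf i]⟩

theorem abs_min_sub_min_le (a b : ℝ) : |min 1 a - min 1 b| ≤ |a - b| := by
  simpa using abs_min_sub_min_le_max 1 a 1 b

namespace IsConvergentFamily

variable {Ω : Type u} {mΩ : MeasurableSpace Ω} {P : Measure Ω} {ℱ : Filtration ℝ≥0 mΩ}
  {D : Set Plane} {Γ₀ : ℝ → Plane} {α : ℝ} {w : ℝ → Ω → ℝ → ℝ} {O : Set Plane}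
  {σ : ℝ → Ω → ℝ≥0} {X : ℝ → Ω → ℝ → ℝ → Plane} {σ₀ : Ω → ℝ≥0} {d : Ω → ℝ → Plane → ℝ}

/-- Up to a positive stopping time, the limit distance stays close to its initial value. -/
theorem exists_stoppingTime (h : IsConvergentFamily P ℱ D Γ₀ α w O σ X σ₀ d) (m₀ : ℕ) {c : ℝ}
    (hc : 0 < c) : ∃ τ : Ω → WithTop ℝ≥0, IsStoppingTime ℱ τ ∧ ∀ o, 0 < τ o ∧ τ o ≤ (1 : ℝ≥0) ∧
      ∀ t : ℝ≥0, t ≤ τ o → ∀ m ≤ m₀, ∀ x ∈ O,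
        ‖iteratedFDeriv ℝ m (d o t) x - iteratedFDeriv ℝ m (d o 0) x‖ ≤ c := by
  have hne : Nonempty O := ⟨⟨Γ₀ 0, h.subset ⟨0, rfl⟩⟩⟩
  set xs : ℕ → O := TopologicalSpace.denseSeq O with hxs
  -- The truncation at `1` keeps the supremum finite, since the derivatives need not be bounded on
  -- `O`. Countably many dense points make it measurable.
  set φ : Fin (m₀ + 1) × ℕ → ℝ≥0 → Ω → ℝ := fun p t o =>
    min 1 ‖iteratedFDeriv ℝ p.1 (d o t) (xs p.2) - iteratedFDeriv ℝ p.1 (d o (0 : ℝ≥0)) (xs p.2)‖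
    with hφ
  set g : ℝ≥0 → Ω → ℝ := fun t o => ⨆ p, φ p t o with hg
  have hbdd : ∀ t o, BddAbove (range fun p => φ p t o) := fun t o =>
    ⟨1, by rintro _ ⟨p, rfl⟩; exact min_le_left _ _⟩
  have hcont : ∀ o, Continuous fun t => g t o := by
    intro o
    rw [continuous_iff_continuousAt]
    intro t
    rw [ContinuousAt, Metric.tendsto_nhds]
    intro ε hε
    have h1 : ∀ᶠ s in 𝓝[Ici 0] (t : ℝ), ∀ m : Fin (m₀ + 1), ∀ x ∈ O,
        ‖iteratedFDeriv ℝ m (d o s) x - iteratedFDeriv ℝ m (d o t) x‖ ≤ ε / 2 :=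
      eventually_all.2 fun m => h.continuous_lim o m t t.2 (ε / 2) (by positivity)
    have h2 : Tendsto (fun s : ℝ≥0 => (s : ℝ)) (𝓝 t) (𝓝[Ici 0] (t : ℝ)) :=
      tendsto_nhdsWithin_of_tendsto_nhds_of_eventually_within _
        NNReal.continuous_coe.continuousAt (Eventually.of_forall fun s => s.2)
    filter_upwards [h2.eventually h1] with s hs
    rw [Real.dist_eq]
    refine (abs_ciSup_sub_ciSup_le (hbdd s o) (hbdd t o) (ε := ε / 2) fun p => ?_).trans_lt
      (by linarith)
    refine (abs_min_sub_min_le _ _).trans ((abs_norm_sub_norm_le _ _).trans ?_)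
    rw [sub_sub_sub_cancel_right]
    exact hs p.1 _ (xs p.2).2
  have hmeas : ∀ t, Measurable[ℱ t] (g t) := by
    intro t
    refine Measurable.iSup fun p => ?_
    have h1 := h.adapted_lim p.1 t _ (xs p.2).2
    have h2 := (h.adapted_lim p.1 0 _ (xs p.2).2).mono (ℱ.mono (zero_le : 0 ≤ t))
    exact measurable_const.min (h1.sub h2).norm.measurable
  have hg0 : ∀ o, g 0 o = 0 := by
    intro o
    have : ∀ p, φ p 0 o = 0 := fun p => by simp [hφ]
    simp [hg, this]
  -- A level of at most `1/2` lies below the truncation, so a bound on `g` is a bound on the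
  -- derivatives themselves.
  obtain ⟨τ, hτ, H⟩ := exists_isStoppingTime_le hcont hmeas (c := min c (1 / 2)) fun o => by
    rw [hg0]; exact lt_min hc (by norm_num)
  -- The cap at time `1` makes the stopping time finite and lets the convergence of the distances be
  -- used on `[0, 1]` only.
  refine ⟨fun o => min (τ o) (1 : ℝ≥0), hτ.min_const 1, fun o => ⟨lt_min (H o).1 (by simp),
    min_le_right _ _, fun t ht m hm => ?_⟩⟩
  have hgt := (H o).2 t (ht.trans (min_le_left _ _))
  have hcO : ContinuousOn (fun x => ‖iteratedFDeriv ℝ m (d o t) x - iteratedFDeriv ℝ m (d o 0) x‖)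
      O := by
    have hj : ∀ s : ℝ, 0 ≤ s → ContinuousOn (iteratedFDeriv ℝ m (d o s)) O := fun s hs =>
      ((h.smooth_lim o s hs).continuousOn_iteratedFDerivWithin (natCast_le_smooth m)
        h.isOpen.uniqueDiffOn).congr fun x hx => (iteratedFDerivWithin_of_isOpen m h.isOpen hx).symm
    exact ((hj t t.2).sub (hj 0 le_rfl)).norm
  have hclosed : IsClosed {x : O |
      ‖iteratedFDeriv ℝ m (d o t) x - iteratedFDeriv ℝ m (d o 0) x‖ ≤ c} :=
    isClosed_le (continuousOn_iff_continuous_domRestrict.1 hcO) continuous_const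
  intro x hx
  have huniv : {x : O | ‖iteratedFDeriv ℝ m (d o t) x - iteratedFDeriv ℝ m (d o 0) x‖ ≤ c}
      = univ := by
    rw [← hclosed.closure_eq]
    refine ((TopologicalSpace.denseRange_denseSeq O).mono ?_).closure_eq
    rintro _ ⟨k, rfl⟩
    have h1 : φ (⟨m, by omega⟩, k) t o ≤ min c (1 / 2) := (le_ciSup (hbdd t o) _).trans hgt
    have h2 : φ (⟨m, by omega⟩, k) t o = min 1 ‖iteratedFDeriv ℝ m (d o t) (xs k)
      - iteratedFDeriv ℝ m (d o 0) (xs k)‖ := by simp [hφ]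
    rw [h2] at h1
    rcases min_le_iff.1 (h1.trans (min_le_right _ _)) with h3 | h3
    · norm_num at h3
    · rw [min_eq_right (h3.trans (by norm_num))] at h1
      exact h1.trans (min_le_left _ _)
  exact (huniv ▸ mem_univ (⟨x, hx⟩ : O) : (⟨x, hx⟩ : O) ∈ {x : O |
    ‖iteratedFDeriv ℝ m (d o t) x - iteratedFDeriv ℝ m (d o 0) x‖ ≤ c})

/-- For small `ε`, the flows stay close to the initial curve up to a common stopping time. -/
theorem exists_isDistClose (h : IsConvergentFamily P ℱ D Γ₀ α w O σ X σ₀ d) (h₀ : IsGaussCurve Γ₀)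
    (m₀ : ℕ) {η : ℝ} (hη : 0 < η) : ∃ τ : Ω → WithTop ℝ≥0, IsStoppingTime ℱ τ ∧
      (∀ o, 0 < τ o) ∧ ∀ᵐ o ∂P, ∃ ε₀ ∈ Ioc (0 : ℝ) 1,
        (∃ T : ℝ≥0, 0 < T ∧ (T : WithTop ℝ≥0) ≤ τ o ∧ ∀ ε ∈ Ioc 0 ε₀, T ≤ σ ε o) ∧
        ∀ ε ∈ Ioc 0 ε₀, ∀ t : ℝ≥0, (t : WithTop ℝ≥0) ≤ τ o → t ≤ σ ε o →
          IsDistClose O m₀ η Γ₀ (X ε o t) := by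
  obtain ⟨r, hr, hrO⟩ := h₀.isCompact_range.exists_thickening_subset_open h.isOpen h.subset
  -- `c < r` keeps the curves inside the thickening contained in `O`. One half of `c` is spent on
  -- the motion of the limit, the other on the convergence in `ε`.
  set c := min η (r / 2) with hcdef
  have hc : 0 < c := lt_min hη (by positivity)
  have hcη : c ≤ η := min_le_left _ _
  have hcr : c < r := (min_le_right _ _).trans_lt (by linarith)
  obtain ⟨τ, hτ, H⟩ := h.exists_stoppingTime m₀ (c := c / 2) (by positivity)
  refine ⟨τ, hτ, fun o => (H o).1, ?_⟩
  filter_upwards [h.flow, h.pos_lim, h.tendsto_time, h.tendsto_dist] with o hflow hpos htime hdist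
  obtain ⟨hτ0, hτ1, hclose⟩ := H o
  -- All flows start from `γ₀`, so convergence at time zero identifies the initial value of the
  -- limit with the distance from `γ₀`.
  have hinit : ∀ m, ∀ x ∈ O,
      iteratedFDeriv ℝ m (curveSignedDist Γ₀) x = iteratedFDeriv ℝ m (d o 0) x := by
    intro m x hx
    refine sub_eq_zero.1 (norm_le_zero_iff.1 (le_of_forall_pos_le_add fun e he => ?_))
    obtain ⟨ε, hε, hε1⟩ := ((hdist m 1 one_pos e he).and (Ioc_mem_nhdsGT one_pos)).exists
    have := hε 0 ⟨le_rfl, zero_le_one⟩ x hx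
    rw [min_eq_left (NNReal.coe_nonneg _), (hflow ε hε1).initial] at this
    linarith
  have hev : ∀ᶠ ε in 𝓝[>] (0 : ℝ), σ₀ o / 2 < σ ε o ∧ ∀ m : Fin (m₀ + 1), ∀ t ∈ Icc (0 : ℝ) 1,
      ∀ x ∈ O, ‖iteratedFDeriv ℝ m (curveSignedDist (X ε o (min t (σ ε o)))) x
        - iteratedFDeriv ℝ m (d o t) x‖ ≤ c / 2 :=
    (htime.eventually (lt_mem_nhds (NNReal.half_lt_self hpos.ne'))).and
      (eventually_all.2 fun m => hdist m 1 one_pos (c / 2) (by positivity))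
  obtain ⟨ε₁, hε₁, hsub⟩ := mem_nhdsGT_iff_exists_Ioc_subset.1 hev
  refine ⟨min ε₁ 1, ⟨lt_min hε₁ one_pos, min_le_right _ _⟩, ?_, ?_⟩
  · obtain ⟨s, hs⟩ := WithTop.ne_top_iff_exists.1 (hτ1.trans_lt (WithTop.coe_lt_top _)).ne
    rw [← hs] at hτ0 ⊢
    -- Convergence of the lifetimes gives `σ^ε > σ₀/2` for all small `ε`, hence a common time
    -- interval.
    refine ⟨min (σ₀ o / 2) s, lt_min (half_pos hpos) (WithTop.coe_lt_coe.1 hτ0),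
      WithTop.coe_le_coe.2 (min_le_right _ _), fun ε hε => (min_le_left _ _).trans ?_⟩
    exact (hsub ⟨hε.1, hε.2.trans (min_le_left _ _)⟩).1.le
  · intro ε hε t htτ htσ
    have hfl := hflow ε ⟨hε.1, hε.2.trans (min_le_right _ _)⟩
    have hcl := (hsub ⟨hε.1, hε.2.trans (min_le_left _ _)⟩).2
    have key : ∀ m ≤ m₀, ∀ s ∈ Icc (0 : ℝ) t, ∀ x ∈ O,
        ‖iteratedFDeriv ℝ m (curveSignedDist (X ε o s)) x
          - iteratedFDeriv ℝ m (curveSignedDist Γ₀) x‖ ≤ c := by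
      intro m hm s hs x hx
      let s' : ℝ≥0 := ⟨s, hs.1⟩
      have hst : s' ≤ t := hs.2
      have hsτ : (s' : WithTop ℝ≥0) ≤ τ o := (WithTop.coe_le_coe.2 hst).trans htτ
      have hs1 : s' ≤ 1 := WithTop.coe_le_coe.1 (hsτ.trans hτ1)
      have h1 := hcl ⟨m, by omega⟩ s ⟨hs.1, hs1⟩ x hx
      have hsσ : s ≤ σ ε o := hs.2.trans (NNReal.coe_le_coe.2 htσ)
      rw [min_eq_left hsσ] at h1
      have h2 := hclose s' hsτ m hm x hx
      rw [hinit m x hx]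
      refine (norm_sub_le_norm_sub_add_norm_sub _ (iteratedFDeriv ℝ m (d o s) x) _).trans ?_
      have h2' : ‖iteratedFDeriv ℝ m (d o s) x - iteratedFDeriv ℝ m (d o 0) x‖ ≤ c / 2 := h2
      have h1' : ‖iteratedFDeriv ℝ m (curveSignedDist (X ε o s)) x
        - iteratedFDeriv ℝ m (d o s) x‖ ≤ c / 2 := h1
      linarith
    have hX0 : X ε o 0 = Γ₀ := hfl.initial
    have hinf : ∀ θ, Metric.infDist (X ε o t θ) (range Γ₀) ≤ c := by
      intro θ
      rw [← hX0]
      refine infDist_le_of_curveSignedDist_close (T := t) (r := r) (O := O) ?_ (by rwa [hX0]) hcr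
        hc.le ?_ ⟨t.2, le_rfl⟩ θ
      · intro θ
        refine hfl.smooth.continuousOn.comp (f := fun s : ℝ => (s, θ)) (by fun_prop) ?_
        exact fun s hs => ⟨⟨hs.1, hs.2.trans (NNReal.coe_le_coe.2 htσ)⟩, mem_univ _⟩
      · intro s hs x hx
        have := key 0 (Nat.zero_le _) s hs x hx
        rw [hX0, ← Real.norm_eq_abs]
        simpa only [iteratedFDeriv_zero_eq_comp, Function.comp_apply, ← map_sub,
          LinearIsometryEquiv.norm_map] using this
    refine ⟨fun θ => hrO ?_, fun θ => (hinf θ).trans hcη, fun m hm x hx =>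
      (key m hm t ⟨t.2, le_rfl⟩ x hx).trans hcη⟩
    rw [Metric.mem_thickening_iff_infDist_lt (range_nonempty _)]
    exact (hinf θ).trans_lt hcr

end IsConvergentFamily

/-! ### The main estimate -/

theorem contDiffOn_forcing {w : ℝ → ℝ} (hw : ContDiffOn ℝ ∞ w (Ici 0)) (α : ℝ) :
    ContDiffOn ℝ ∞ (forcing α w) (Ici 0) :=
  contDiffOn_const.mul ((contDiffOn_infty_iff_derivWithin (uniqueDiffOn_Ici 0)).1 hw).2

theorem lemma5 (K M : ℕ) :
    ∃ N : ℕ,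
      ∀ (D : Set Plane) (Γ₀ : ℝ → Plane) (δ α : ℝ),
        IsOpen D → IsConnected D → Bornology.IsBounded D →
        IsGaussCurve Γ₀ → convexHull ℝ (range Γ₀) ⊆ D → 0 < α →
        -- `δ` is small enough for the initial curve
        0 < δ → (∃ l : ℝ, 0 < l ∧ ¬ exitCondition D δ l Γ₀) →
        ∀ L : ℕ, ∃ C : ℝ, 0 < C ∧
          ∀ (Ω : Type u) (mΩ : MeasurableSpace Ω) (P : Measure Ω) (_ : IsProbabilityMeasure P)
            (ℱ : Filtration ℝ≥0 mΩ) (w : ℝ → Ω → ℝ → ℝ) (O : Set Plane)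
            (σ : ℝ → Ω → ℝ≥0) (X : ℝ → Ω → ℝ → ℝ → Plane)
            (σ₀ : Ω → ℝ≥0) (d : Ω → ℝ → Plane → ℝ),
            IsSmoothNoise P ℱ w → IsConvergentFamily P ℱ D Γ₀ α w O σ X σ₀ d →
            ∃ τ : Ω → WithTop ℝ≥0, IsStoppingTime ℱ τ ∧ (∀ᵐ o ∂P, 0 < τ o) ∧
              ∀ᵐ o ∂P, ∃ ε₀ ∈ Ioc (0 : ℝ) 1,
                -- a common time interval for all `v = α ẇ^ε`, `0 < ε ≤ ε₀`
                (∃ T : ℝ≥0, 0 < T ∧ (T : WithTop ℝ≥0) ≤ τ o ∧ ∀ ε ∈ Ioc 0 ε₀, T ≤ σ ε o) ∧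
                ∀ ε ∈ Ioc 0 ε₀,
                  -- if `γ₀` satisfies the constraints of level `L` strictly, `τ` is at most `τ_L^ε`
                  ((∃ l : ℝ, 0 < l ∧ l < L ∧ ¬ exitCondition D δ l Γ₀) →
                    τ o ≤ exitTime D δ L (σ ε o) (X ε o)) ∧
                  ∀ T : ℝ≥0, 0 < T → (T : WithTop ℝ≥0) ≤ τ o → T ≤ σ ε o →
                    (∀ k ≤ K, ∀ m ≤ M, ∀ i : Fin 2, ∀ θ : ℝ, ∀ t ∈ Icc (0 : ℝ) T,
                      |derivX (X ε o) T k m i t θ|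
                        ≤ C * (1 + timeNorm N T (forcing α (w ε o))) ^ N) ∧
                    (∀ t ∈ Icc (0 : ℝ) T, ∀ x ∈ tube D δ (X ε o t),
                      -- `θ(t, x)` is well defined and smooth
                      (∃! p : ℝ × ℝ, p.1 ∈ Ico (0 : ℝ) (2 * Real.pi) ∧ |p.2| < 3 * δ ∧
                        X ε o t p.1 + p.2 • unitNormal p.1 = x) ∧
                      X ε o t (gaussAngle (X ε o) t x)
                        + curveSignedDist (X ε o t) x • unitNormal (gaussAngle (X ε o) t x) = x ∧
                      ContDiffWithinAt ℝ ∞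
                        (fun p : ℝ × Plane => angleBranch (X ε o) t x p.1 p.2)
                        (Icc (0 : ℝ) T ×ˢ univ) (t, x) ∧
                      ∀ k ≤ K, ∀ m ≤ M, ∀ j : Fin m → Fin 2,
                        |derivAngle (X ε o) T k j t x|
                          ≤ C * (1 + timeNorm N T (forcing α (w ε o))) ^ N) := by
  -- `N = K + M` bounds the total order of all derivatives involved. The signed distance is then
  -- needed up to order `3N + 3`.
  refine ⟨K + M, fun D Γ₀ δ α _ _ _ h₀ hD _ hδ he L => ?_⟩
  obtain ⟨B, hB, hbar⟩ := h₀.exists_barrier hD hδ he (m₀ := 3 * (K + M) + 3) (by omega)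
  obtain ⟨η, hη, H⟩ := hbar L
  obtain ⟨C, hC, hbd⟩ := IsConvexFlow.exists_deriv_bound D hδ hB (n := K + M) le_rfl
  refine ⟨C, hC, fun Ω mΩ P _ ℱ w O σ X σ₀ d hw h => ?_⟩
  obtain ⟨τ, hτ, hτ0, hclose⟩ := h.exists_isDistClose h₀ (3 * (K + M) + 3) hη
  refine ⟨τ, hτ, Eventually.of_forall hτ0, ?_⟩
  filter_upwards [hclose, h.flow, hw.smooth] with o ⟨ε₀, hε₀, hT, hcl⟩ hflow hsm
  refine ⟨ε₀, hε₀, hT, fun ε hε => ?_⟩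
  have hε1 : ε ∈ Ioc (0 : ℝ) 1 := ⟨hε.1, hε.2.trans hε₀.2⟩
  have hfl := hflow ε hε1
  have hv := contDiffOn_forcing (hsm ε hε1) α
  refine ⟨fun hl => le_sInf ?_, fun T hT0 hTτ hTσ => ?_⟩
  · rintro _ ⟨t, ht0, htσ, hex, rfl⟩
    -- Before `τ` the curve is so close to `γ₀` that the constraints of level `L` persist, which
    -- excludes an exit.
    by_contra! hlt
    exact (H O _ (hfl.gauss t ⟨t.2, htσ⟩) (hcl ε hε t hlt.le htσ)).2 hl hex
  · have hTσ' : (T : ℝ) ≤ σ ε o := hTσ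
    have hg : ∀ t ∈ Icc (0 : ℝ) T, IsGaussCurve (X ε o t) := fun t ht =>
      hfl.gauss t ⟨ht.1, ht.2.trans hTσ'⟩
    have hgeom : ∀ t ∈ Icc (0 : ℝ) T, _ := fun t ht =>
      (H O _ (hg t ht) (hcl ε hε ⟨t, ht.1⟩
        ((WithTop.coe_le_coe.2 (show (⟨t, ht.1⟩ : ℝ≥0) ≤ T from ht.2)).trans hTτ)
        (show (⟨t, ht.1⟩ : ℝ≥0) ≤ σ ε o from ht.2.trans hTσ'))).1
    have hderiv := hbd Γ₀ _ _ _ hfl hv T hT0 hTσ' hgeom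
    have hM : IsMovingCurve δ T (X ε o) := ⟨hδ, hT0,
      hfl.smooth.mono (prod_mono_left (Icc_subset_Icc_right hTσ')), hg,
      fun t ht θ => (hgeom t ht θ).1⟩
    refine ⟨fun k hk m hm i θ t ht => (hderiv t ht k m (by omega)).1 i θ, fun t ht x hx => ?_⟩
    exact ⟨hM.existsUnique_coordinates ht hx.2, (hM.gaussAngle_spec ht hx.2).2,
      hM.contDiffWithinAt_angleBranch ht hx.2,
      fun k hk m hm j => (hderiv t ht k m (by omega)).2 x hx.2 j⟩
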